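/- Let $I\subseteq(0,\infty)$ be an open interval (bounded or unbounded). Consider Laplace's equation in spherical coordinates $$\frac{1}{r^2}\frac{\partial}{\partial r}\Big(r^2\frac{\partial U}{\partial r}\Big)+\frac{1}{r^2\sin\theta}\frac{\partial}{\partial\theta}\Big(\sin\theta\,\frac{\partial U}{\partial\theta}\Big)+\frac{1}{r^2\sin^2\theta}\frac{\partial^2U}{\partial\varphi^2}=0 \qquad (r\in I,\ 0<\theta<\pi,\ \varphi\in\mathbb R).\tag{1}$$ A *regular solution* of (1) is a real function $U$ that is $C^2$ on $I\times(0,\pi)\times\mathbb R$ and satisfies (1) there, is continuous on $I\times[0,\pi]\times\mathbb R$ (regularity at the poles), and is $2\pi$-periodic in $\varphi$. For real constants $\lambda_1,\lambda_2$ consider the separated equations $$\frac1{r^2}\frac{d}{dr}\Big(r^2\frac{dR}{dr}\Big)-\frac{\lambda_2}{r^2}R=0,\tag{2}$$ $$\frac1{\sin\theta}\frac{d}{d\theta}\Big(\sin\theta\,\frac{d\Theta}{d\theta}\Big)+\frac{\lambda_1}{\sin^2\theta}\Theta+\lambda_2\Theta=0,\tag{3}$$ $$\frac{d^2\Phi}{d\varphi^2}-\lambda_1\Phi=0,\tag{4}$$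 for $R\in C^2(I)$, for $\Theta\in C^2((0,\pi))\cap C([0,\pi])$, and for $2\pi$-periodic $\Phi\in C^2(\mathbb R)$. 1. (Separated solutions.) Let $R,\Theta,\Phi$ be functions on $I$, $[0,\pi]$, $\mathbb R$, none of them identically zero. Then $R(r)\Theta(\theta)\Phi(\varphi)$ is a regular solution of (1) if and only if $R,\Theta,\Phi$ satisfy (2)–(4), with the stated regularity, for some real constants $\lambda_1,\lambda_2$. Whenever they do, the constants are of the form $\lambda_1=-m^2$ and $\lambda_2=\ell(\ell+1)$ with integers $\ell\ge0$ and $|m|\le\ell$. Thus (2) is the Euler–Cauchy equation, (3) the associated Legendre equation and (4) the harmonic-oscillator equation. 2. (General solution.) For every regular solution $U$ of (1) there are functions $R_{\ell m}$, $\Theta_{\ell m}$, $\Phi_m$ ($\ell\ge0$, $|m|\le\ell$) that satisfy (2)–(4), with the stated regularity, for $\lambda_1=-m^2$ and $\lambda_2=\ell(\ell+1)$, and such that $$U(r,\theta,\varphi)=\sum_{\ell=0}^{\infty}\sum_{m=-\ell}^{\ell}R_{\ell m}(r)\,\Theta_{\ell m}(\theta)\,\Phi_m(\varphi),\tag{5}$$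 where the series over $\ell$ converges unconditionally and locally uniformly on $I\times[0,\pi]\times\mathbb R$. 3. (Converse.) If $R_{\ell m},\Theta_{\ell m},\Phi_m$ satisfy (2)–(4), with the stated regularity, for $\lambda_1=-m^2$ and $\lambda_2=\ell(\ell+1)$, and the partial sums over $\ell$ of the series (5) converge locally uniformly on $I\times[0,\pi]\times\mathbb R$ to a function $U$, then $U$ is a regular solution of (1). -/

import Mathlib

open Filter Topology

noncomputable section

/-- The left-hand side of Laplace's equation in spherical coordinates: radius `r`,
inclination `θ` (measured from the positive `z`-axis), azimuth `φ`. -/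
def sphericalLaplacian (U : ℝ → ℝ → ℝ → ℝ) (r θ φ : ℝ) : ℝ :=
  1 / r ^ 2 * deriv (fun s => s ^ 2 * deriv (fun t => U t θ φ) s) r
    + 1 / (r ^ 2 * Real.sin θ) *
        deriv (fun t => Real.sin t * deriv (fun τ => U r τ φ) t) θ
    + 1 / (r ^ 2 * Real.sin θ ^ 2) * iteratedDeriv 2 (fun ψ => U r θ ψ) φ

/-- The coordinate domain of the spherical shell with radii in `I`, poles included. -/
def closedShell (I : Set ℝ) : Set (ℝ × ℝ × ℝ) :=
  I ×ˢ Set.Icc 0 Real.pi ×ˢ Set.univ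

/-- The coordinate domain of the spherical shell with radii in `I`, poles excluded. -/
def openShell (I : Set ℝ) : Set (ℝ × ℝ × ℝ) :=
  I ×ˢ Set.Ioo 0 Real.pi ×ˢ Set.univ

/-- `U` solves Laplace's equation in spherical coordinates on the shell with radii in `I`:
it is a classical (`C²`) solution away from the poles, it is single-valued in the azimuth,
and it is regular (continuous up to `θ = 0` and `θ = π`) at the poles. -/
structure IsLaplaceSolution (I : Set ℝ) (U : ℝ → ℝ → ℝ → ℝ) : Prop where
  contDiffOn : ContDiffOn ℝ 2 (fun p : ℝ × ℝ × ℝ => U p.1 p.2.1 p.2.2) (openShell I)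
  regular : ContinuousOn (fun p : ℝ × ℝ × ℝ => U p.1 p.2.1 p.2.2) (closedShell I)
  periodic : ∀ r ∈ I, ∀ θ ∈ Set.Icc 0 Real.pi, ∀ φ : ℝ,
    U r θ (φ + 2 * Real.pi) = U r θ φ
  laplace : ∀ r ∈ I, ∀ θ ∈ Set.Ioo 0 Real.pi, ∀ φ : ℝ, sphericalLaplacian U r θ φ = 0

/-- The radial (Euler–Cauchy) equation on `I`, with separation constant `c₂`. -/
structure RadialEquation (I : Set ℝ) (c₂ : ℝ) (R : ℝ → ℝ) : Prop where
  contDiffOn : ContDiffOn ℝ 2 R I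
  ode : ∀ r ∈ I, 1 / r ^ 2 * deriv (fun s => s ^ 2 * deriv R s) r - c₂ / r ^ 2 * R r = 0

/-- The polar equation with separation constants `c₁`, `c₂`, for a function that is
regular at the poles; for `c₁ = -m²` and `c₂ = ℓ(ℓ+1)` it is the associated Legendre
equation. -/
structure PolarEquation (c₁ c₂ : ℝ) (Θ : ℝ → ℝ) : Prop where
  contDiffOn : ContDiffOn ℝ 2 Θ (Set.Ioo 0 Real.pi)
  regular : ContinuousOn Θ (Set.Icc 0 Real.pi)
  ode : ∀ θ ∈ Set.Ioo 0 Real.pi,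
    1 / Real.sin θ * deriv (fun t => Real.sin t * deriv Θ t) θ
      + c₁ / Real.sin θ ^ 2 * Θ θ + c₂ * Θ θ = 0

/-- The azimuthal equation with separation constant `c₁`, for a `2π`-periodic function;
for `c₁ = -m²` it is the harmonic-oscillator equation `Φ'' + m² Φ = 0`. -/
structure AzimuthalEquation (c₁ : ℝ) (Φ : ℝ → ℝ) : Prop where
  contDiff : ContDiff ℝ 2 Φ
  periodic : ∀ φ : ℝ, Φ (φ + 2 * Real.pi) = Φ φ
  ode : ∀ φ : ℝ, iteratedDeriv 2 Φ φ - c₁ * Φ φ = 0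

/-- The factors satisfy the three ordinary differential equations for every pair
`(ℓ, m)` with `|m| ≤ ℓ`. -/
def SatisfySeparatedEquations (I : Set ℝ) (R Θ : ℕ → ℤ → ℝ → ℝ) (Φ : ℤ → ℝ → ℝ) : Prop :=
  ∀ (ℓ : ℕ) (m : ℤ), |m| ≤ (ℓ : ℤ) →
    RadialEquation I ((ℓ : ℝ) * ((ℓ : ℝ) + 1)) (R ℓ m) ∧
    PolarEquation (-(m : ℝ) ^ 2) ((ℓ : ℝ) * ((ℓ : ℝ) + 1)) (Θ ℓ m) ∧
    AzimuthalEquation (-(m : ℝ) ^ 2) (Φ m)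

/-- The degree-`ℓ` term `∑_{m=-ℓ}^{ℓ} R_{ℓm}(r) Θ_{ℓm}(θ) Φ_m(φ)` of the double series. -/
def degreeTerm (R Θ : ℕ → ℤ → ℝ → ℝ) (Φ : ℤ → ℝ → ℝ) (ℓ : ℕ) (p : ℝ × ℝ × ℝ) : ℝ :=
  ∑ m ∈ Finset.Icc (-(ℓ : ℤ)) (ℓ : ℤ), R ℓ m p.1 * Θ ℓ m p.2.1 * Φ m p.2.2

end

/-!
Everything rests on the coefficients of a function on the sphere with respect to the spherical
harmonics `Y_{ℓm}(θ, φ) = P_{ℓ|m|}(θ) cas (mφ)`. Here `P_{ℓm}` is the associated Legendre function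
normalised in `L²(sin θ dθ)` and `cas x = cos x + sin x`, which gives a real basis of the
trigonometric polynomials indexed by the integer `m`, with a product structure in `θ` and `φ`. The
system is orthogonal (`harmonicCoeff_sphHarmonic`), complete on continuous functions
(`eq_zero_of_harmonicCoeff`, by Fourier series in `φ` and Weierstrass approximation in `cos θ`), and
grows polynomially in `ℓ` (`normLegendre_bounds`, by energy estimates for the Legendre equation).

The key point is `IsLaplaceSolution.isEuler_harmonicCoeff`: for every regular solution `U`, the
coefficient `r ↦ ⟨U(r, ·), Y_{ℓm}⟩` is `α r^ℓ + β r^{-ℓ-1}` exactly. Formally this is Green's formula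
on the sphere, but `U` is only continuous at the poles, so boundary terms there have to be excluded.
The test function is cut off with `χ(x/n)`, where `x = log tan (θ/2)` is the Mercator coordinate. As
`sin θ d/dθ = d/dx`, the derivatives of the cutoff contribute `O(1/n)` (`sin_mul_le_two`), so the
truncated coefficients satisfy the Euler–Cauchy equation up to `O(1/n)`. They are therefore close to
exact solutions (`exists_eulerSol_near`), and the two-dimensional solution space is closed
(`isEuler_of_approx`).

Separated solutions. If `RΘΦ` is a solution, freezing two of the variables yields the three ordinary
differential equations (`exists_separation_constants`). Conversely, if they hold, completeness gives
a nonzero coefficient of `ΘΦ`; then `R` is a multiple of a function `α r^ℓ + β r^{-ℓ-1}`, so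
`λ₂ = ℓ(ℓ+1)`, and Green's formula in `φ` gives `λ₁ = -m²` (`separation_constants_eq`).

General solution. The coefficients of `U` at two radii `a < b` are `O(ℓ⁴)`, and a function
`α r^ℓ + β r^{-ℓ-1}` with such boundary values decays geometrically in `ℓ`, with its derivatives, on
compact subintervals of `(a, b)` (`eulerSol_bounds`). Hence the series of solid harmonics converges
locally uniformly up to the poles and may be differentiated termwise away from them; its sum is a
regular solution (`PolynomialGrowth.isLaplaceSolution`) with the coefficients of `U`, so it equals
`U` (`exists_solid_expansion`).

Converse. Each partial sum is a regular solution, so its coefficients are Euler–Cauchy solutions; by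
closedness, so are those of the locally uniform limit, which is continuous and periodic. The
expansion above uses nothing else about `U`, and its sum is a regular solution
(`isLaplaceSolution_of_tendsto`).
-/

noncomputable section

/-! ### Legendre functions -/

open Polynomial in
/-- The `n`-th derivative of `(X² - 1)^ℓ`: up to a scalar, the `(n - ℓ)`-th derivative of the
Legendre polynomial of degree `ℓ`. -/
def rodrigues (ℓ n : ℕ) : ℝ[X] := derivative^[n] ((X ^ 2 - 1) ^ ℓ)

open Polynomial in
lemma derivative_rodrigues (ℓ n : ℕ) : derivative (rodrigues ℓ n) = rodrigues ℓ (n + 1) := by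
  simp only [rodrigues, Function.iterate_succ_apply']

open Polynomial in
/-- The differential equation of `(X² - 1)^ℓ`, differentiated `n + 1` times. -/
lemma rodrigues_ode_aux (ℓ n : ℕ) :
    (1 - X ^ 2) * rodrigues ℓ (n + 2) + 2 * ((ℓ : ℝ[X]) - (n : ℝ[X]) - 1) * X * rodrigues ℓ (n + 1)
      + ((n : ℝ[X]) + 1) * (2 * (ℓ : ℝ[X]) - (n : ℝ[X])) * rodrigues ℓ n = 0 := by
  have c2 : (C 2 : ℝ[X]) = 2 := map_ofNat C 2
  induction n with
  | zero =>
    have h0 : (1 - X ^ 2) * rodrigues ℓ 1 + 2 * (ℓ : ℝ[X]) * X * rodrigues ℓ 0 = 0 := by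
      rw [← derivative_rodrigues]
      rcases ℓ with _ | k
      · simp [rodrigues]
      · simp only [rodrigues, Function.iterate_zero, id, derivative_pow, derivative_sub,
          derivative_one, derivative_X]
        simp [c2]
        ring
    have h1 := congrArg derivative h0
    simp only [derivative_add, derivative_mul, derivative_sub, derivative_one, derivative_X_pow,
      derivative_natCast, derivative_X, derivative_rodrigues, derivative_zero,
      derivative_ofNat] at h1
    norm_num [c2] at h1 ⊢
    linear_combination h1
  | succ n ih =>
    have h1 := congrArg derivative ih
    simp only [derivative_add, derivative_mul, derivative_sub, derivative_one, derivative_X_pow,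
      derivative_natCast, derivative_X, derivative_rodrigues, derivative_zero,
      derivative_ofNat] at h1
    norm_num [c2] at h1
    push_cast
    linear_combination h1

/-- The equation satisfied by the `m`-th derivative of the Legendre polynomial. -/
lemma rodrigues_ode (ℓ m : ℕ) (x : ℝ) :
    (1 - x ^ 2) * (rodrigues ℓ (ℓ + m + 2)).eval x
      - 2 * (m + 1) * x * (rodrigues ℓ (ℓ + m + 1)).eval x
      + ((ℓ : ℝ) * (ℓ + 1) - m * (m + 1)) * (rodrigues ℓ (ℓ + m)).eval x = 0 := by
  have h := congrArg (Polynomial.eval x) (rodrigues_ode_aux ℓ (ℓ + m))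
  simp only [Polynomial.eval_add, Polynomial.eval_mul, Polynomial.eval_sub, Polynomial.eval_one,
    Polynomial.eval_pow, Polynomial.eval_X, Polynomial.eval_natCast, Polynomial.eval_ofNat,
    Polynomial.eval_zero] at h
  push_cast at h
  linear_combination h

open Polynomial in
lemma degree_rodrigues {ℓ n : ℕ} (h : n ≤ 2 * ℓ) :
    (rodrigues ℓ n).degree = ((2 * ℓ - n : ℕ) : WithBot ℕ) := by
  induction n with
  | zero =>
    rw [rodrigues, Function.iterate_zero, id, degree_pow,
      show (X ^ 2 - 1 : ℝ[X]) = X ^ 2 - C 1 by simp, degree_X_pow_sub_C two_pos]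
    simp [mul_comm]
  | succ n ih =>
    have h1 : (rodrigues ℓ n).natDegree = 2 * ℓ - n :=
      natDegree_eq_of_degree_eq_some (ih (by omega))
    rw [← derivative_rodrigues, degree_derivative (by omega), h1]
    congr 1

/-- A Legendre function with parameters `μ` and `lam`: a `C²` solution `P` of
`sin θ (sin θ P')' = (μ² - lam sin² θ) P` on the whole line, poles included. -/
structure IsLegendreFn (μ lam : ℝ) (P : ℝ → ℝ) : Prop where
  contDiff : ContDiff ℝ 2 P
  eqn : ∀ θ, Real.sin θ * deriv (fun t => Real.sin t * deriv P t) θ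
    = (μ ^ 2 - lam * Real.sin θ ^ 2) * P θ

/-- The associated Legendre function `sin^m θ · q(cos θ)` where `q` is the `m`-th derivative of
the Legendre polynomial of degree `ℓ`, up to a scalar. -/
def assocLegendre (ℓ m : ℕ) (θ : ℝ) : ℝ :=
  Real.sin θ ^ m * (rodrigues ℓ (ℓ + m)).eval (Real.cos θ)

lemma hasDerivAt_rodrigues_cos (ℓ n : ℕ) (θ : ℝ) :
    HasDerivAt (fun t => (rodrigues ℓ n).eval (Real.cos t))
      (-(Real.sin θ * (rodrigues ℓ (n + 1)).eval (Real.cos θ))) θ := by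
  have h := ((rodrigues ℓ n).hasDerivAt (Real.cos θ)).comp θ (Real.hasDerivAt_cos θ)
  rw [derivative_rodrigues] at h
  exact h.congr_deriv (by ring)

lemma contDiff_assocLegendre (ℓ m : ℕ) : ContDiff ℝ 2 (assocLegendre ℓ m) := by
  unfold assocLegendre
  exact (Real.contDiff_sin.pow m).mul
    (by simpa using! ((rodrigues ℓ (ℓ + m)).contDiff_aeval 2).comp (Real.contDiff_cos (n := 2)))

lemma hasDerivAt_sin_pow_mul (m : ℕ) {f : ℝ → ℝ} {f' θ : ℝ} (hf : HasDerivAt f f' θ) :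
    HasDerivAt (fun t => Real.sin t ^ m * f t)
      (m * Real.sin θ ^ (m - 1) * Real.cos θ * f θ + Real.sin θ ^ m * f') θ :=
  ((Real.hasDerivAt_sin θ).fun_pow m).mul hf

lemma sin_mul_pow_pred (m : ℕ) (s : ℝ) : s * (m * s ^ (m - 1)) = m * s ^ m := by
  rcases m with _ | m
  · simp
  · simp only [Nat.add_sub_cancel, pow_succ]; ring

lemma sin_mul_deriv_assocLegendre (ℓ m : ℕ) (θ : ℝ) :
    Real.sin θ * deriv (assocLegendre ℓ m) θ = Real.sin θ ^ m *
      (m * Real.cos θ * (rodrigues ℓ (ℓ + m)).eval (Real.cos θ)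
        - Real.sin θ ^ 2 * (rodrigues ℓ (ℓ + m + 1)).eval (Real.cos θ)) := by
  have h : HasDerivAt (assocLegendre ℓ m) _ θ :=
    hasDerivAt_sin_pow_mul m (hasDerivAt_rodrigues_cos ℓ (ℓ + m) θ)
  rw [h.deriv]
  have := sin_mul_pow_pred m (Real.sin θ)
  linear_combination (Real.cos θ * (rodrigues ℓ (ℓ + m)).eval (Real.cos θ)) * this

lemma isLegendreFn_assocLegendre (ℓ m : ℕ) :
    IsLegendreFn m ((ℓ : ℝ) * (ℓ + 1)) (assocLegendre ℓ m) where
  contDiff := contDiff_assocLegendre ℓ m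
  eqn θ := by
    simp only [sin_mul_deriv_assocLegendre]
    have h1 := ((((Real.hasDerivAt_cos θ).const_mul (m : ℝ)).fun_mul
      (hasDerivAt_rodrigues_cos ℓ (ℓ + m) θ)).fun_sub
      (((Real.hasDerivAt_sin θ).fun_pow 2).fun_mul (hasDerivAt_rodrigues_cos ℓ (ℓ + m + 1) θ)))
    have h := hasDerivAt_sin_pow_mul m h1
    rw [HasDerivAt.deriv (f := fun t => Real.sin t ^ m *
      (m * Real.cos t * (rodrigues ℓ (ℓ + m)).eval (Real.cos t)
        - Real.sin t ^ 2 * (rodrigues ℓ (ℓ + m + 1)).eval (Real.cos t))) h]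
    have e1 := sin_mul_pow_pred m (Real.sin θ)
    have e2 := rodrigues_ode ℓ m (Real.cos θ)
    have e3 : Real.cos θ ^ 2 = 1 - Real.sin θ ^ 2 := by
      rw [← Real.sin_sq_add_cos_sq θ]; ring
    simp only [assocLegendre]
    rw [e3] at e2
    set s := Real.sin θ
    set c := Real.cos θ
    set q := (rodrigues ℓ (ℓ + m)).eval c
    set q1 := (rodrigues ℓ (ℓ + m + 1)).eval c
    set q2 := (rodrigues ℓ (ℓ + m + 2)).eval c
    norm_num
    linear_combination (c * (m * c * q - s ^ 2 * q1)) * e1 + s ^ m * s ^ 2 * e2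
      + (m ^ 2 * s ^ m * q) * e3


namespace IsLegendreFn

variable {μ lam : ℝ} {P : ℝ → ℝ}

lemma differentiable (h : IsLegendreFn μ lam P) : Differentiable ℝ P :=
  h.contDiff.differentiable (by norm_num)

lemma continuous (h : IsLegendreFn μ lam P) : Continuous P := h.contDiff.continuous

lemma contDiff_deriv (h : IsLegendreFn μ lam P) : ContDiff ℝ 1 (deriv P) :=
  ((contDiff_succ_iff_deriv (n := 1)).1 h.contDiff).2.2

lemma hasDerivAt_deriv (h : IsLegendreFn μ lam P) (θ : ℝ) :
    HasDerivAt (deriv P) (deriv (deriv P) θ) θ :=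
  (h.contDiff_deriv.differentiable (by norm_num) θ).hasDerivAt

lemma continuous_flux (h : IsLegendreFn μ lam P) :
    Continuous fun t => Real.sin t * deriv P t :=
  Real.continuous_sin.mul h.contDiff_deriv.continuous

/-- The Legendre equation in divergence form. -/
lemma hasDerivAt_flux (h : IsLegendreFn μ lam P) {θ : ℝ} (hθ : Real.sin θ ≠ 0) :
    HasDerivAt (fun t => Real.sin t * deriv P t)
      ((μ ^ 2 / Real.sin θ - lam * Real.sin θ) * P θ) θ := by
  have h1 : DifferentiableAt ℝ (fun t => Real.sin t * deriv P t) θ :=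
    ((Real.hasDerivAt_sin θ).mul (h.hasDerivAt_deriv θ)).differentiableAt
  refine h1.hasDerivAt.congr_deriv ?_
  have := h.eqn θ
  field_simp
  linear_combination this

lemma sin_sq_mul_deriv_deriv (h : IsLegendreFn μ lam P) (θ : ℝ) :
    Real.sin θ ^ 2 * deriv (deriv P) θ = (μ ^ 2 - lam * Real.sin θ ^ 2) * P θ
      - Real.cos θ * (Real.sin θ * deriv P θ) := by
  have h1 := h.eqn θ
  rw [((Real.hasDerivAt_sin θ).fun_mul (h.hasDerivAt_deriv θ)).deriv] at h1
  linear_combination h1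

lemma mul_apply_zero (h : IsLegendreFn μ lam P) : μ * P 0 = 0 := by
  have := h.eqn 0
  simpa using this

lemma mul_apply_pi (h : IsLegendreFn μ lam P) : μ * P Real.pi = 0 := by
  have := h.eqn Real.pi
  simpa using this

lemma const_mul (h : IsLegendreFn μ lam P) (a : ℝ) : IsLegendreFn μ lam (fun θ => a * P θ) where
  contDiff := contDiff_const.mul h.contDiff
  eqn θ := by
    have e : (fun t => Real.sin t * deriv (fun θ => a * P θ) t)
        = fun t => a * (Real.sin t * deriv P t) := by
      funext t
      rw [deriv_const_mul_field]; ring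
    rw [e, deriv_const_mul_field]
    linear_combination a * h.eqn θ

lemma polarEquation (h : IsLegendreFn μ lam P) : PolarEquation (-μ ^ 2) lam P where
  contDiffOn := h.contDiff.contDiffOn
  regular := h.continuous.continuousOn
  ode θ hθ := by
    have hs := (Real.sin_pos_of_mem_Ioo hθ).ne'
    rw [(h.hasDerivAt_flux hs).deriv]
    field_simp
    ring

/-- Orthogonality of Legendre functions of the same order, from the Wronskian identity. -/
lemma integral_mul_eq_zero {lam' : ℝ} {Q : ℝ → ℝ} (h : IsLegendreFn μ lam P)
    (h' : IsLegendreFn μ lam' Q) (hne : lam ≠ lam') :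
    ∫ θ in (0 : ℝ)..Real.pi, P θ * Q θ * Real.sin θ = 0 := by
  have h1 : ∫ θ in (0 : ℝ)..Real.pi, (lam' - lam) * (P θ * Q θ * Real.sin θ)
      = ((Real.sin Real.pi * deriv P Real.pi) * Q Real.pi
          - P Real.pi * (Real.sin Real.pi * deriv Q Real.pi))
        - ((Real.sin 0 * deriv P 0) * Q 0 - P 0 * (Real.sin 0 * deriv Q 0)) := by
    refine intervalIntegral.integral_eq_sub_of_hasDerivAt_of_le
      (f := fun t => (Real.sin t * deriv P t) * Q t - P t * (Real.sin t * deriv Q t))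
      Real.pi_pos.le ?_ ?_ ?_
    · exact ((h.continuous_flux.mul h'.continuous).sub
        (h.continuous.mul h'.continuous_flux)).continuousOn
    · intro θ hθ
      have hs := (Real.sin_pos_of_mem_Ioo hθ).ne'
      refine (((h.hasDerivAt_flux hs).mul (h'.differentiable θ).hasDerivAt).sub
        ((h.differentiable θ).hasDerivAt.mul (h'.hasDerivAt_flux hs))).congr_deriv ?_
      ring
    · exact (continuous_const.mul ((h.continuous.mul h'.continuous).mul
        Real.continuous_sin)).intervalIntegrable _ _
  rw [intervalIntegral.integral_const_mul] at h1
  simp only [Real.sin_pi, Real.sin_zero, zero_mul, mul_zero, sub_zero] at h1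
  exact (mul_eq_zero.1 h1).resolve_left (sub_ne_zero.2 hne.symm)

/-- The squared norm of `P` with respect to the area of the sphere on the cap of angle `θ`. -/
def capNorm (P : ℝ → ℝ) (θ : ℝ) : ℝ := ∫ t in (0 : ℝ)..θ, P t ^ 2 * Real.sin t

lemma continuous_integrand (h : IsLegendreFn μ lam P) :
    Continuous fun t => P t ^ 2 * Real.sin t :=
  (h.continuous.pow 2).mul Real.continuous_sin

lemma hasDerivAt_capNorm (h : IsLegendreFn μ lam P) (θ : ℝ) :
    HasDerivAt (capNorm P) (P θ ^ 2 * Real.sin θ) θ :=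
  intervalIntegral.integral_hasDerivAt_right (h.continuous_integrand.intervalIntegrable _ _)
    (h.continuous_integrand.stronglyMeasurableAtFilter _ _) h.continuous_integrand.continuousAt

lemma capNorm_zero : capNorm P 0 = 0 := intervalIntegral.integral_same

lemma capNorm_mono (h : IsLegendreFn μ lam P) : MonotoneOn (capNorm P) (Set.Icc 0 Real.pi) := by
  refine monotoneOn_of_hasDerivWithinAt_nonneg (convex_Icc _ _)
    (fun θ _ => (h.hasDerivAt_capNorm θ).continuousAt.continuousWithinAt)
    (fun θ _ => (h.hasDerivAt_capNorm θ).hasDerivWithinAt) (fun θ hθ => ?_)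
  rw [interior_Icc] at hθ
  exact mul_nonneg (sq_nonneg _) (Real.sin_pos_of_mem_Ioo hθ).le

/-- For orders `|μ| ≥ 1` the sup norm is controlled by the energy
`∫ (sin θ P'² + μ² P² / sin θ) = lam ∫ P² sin θ`, because `P` vanishes at both poles. -/
lemma sq_le_of_one_le (h : IsLegendreFn μ lam P) (hμ : 1 ≤ μ ^ 2) {θ : ℝ}
    (hθ : θ ∈ Set.Icc 0 Real.pi) : 2 * P θ ^ 2 ≤ lam * capNorm P Real.pi := by
  have hμ0 : μ ≠ 0 := by rintro rfl; norm_num at hμ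
  have key : ∀ ε : ℝ, ε ^ 2 = 1 → MonotoneOn (fun t => (Real.sin t * deriv P t) * P t
      + lam * capNorm P t - ε * P t ^ 2) (Set.Icc 0 Real.pi) := by
    intro ε hε
    refine monotoneOn_of_hasDerivWithinAt_nonneg
      (f' := fun t => (μ ^ 2 / Real.sin t - lam * Real.sin t) * P t * P t
        + (Real.sin t * deriv P t) * deriv P t + lam * (P t ^ 2 * Real.sin t)
        - ε * (2 * P t * deriv P t)) (convex_Icc _ _) ?_ ?_ ?_
    · have : Continuous (capNorm P) :=
        continuous_iff_continuousAt.2 fun t => (h.hasDerivAt_capNorm t).continuousAt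
      exact (((h.continuous_flux.mul h.continuous).add (continuous_const.mul this)).sub
        (continuous_const.mul (h.continuous.pow 2))).continuousOn
    · intro t ht
      rw [interior_Icc] at ht
      have hs := (Real.sin_pos_of_mem_Ioo ht).ne'
      have hd := (h.differentiable t).hasDerivAt
      refine HasDerivAt.hasDerivWithinAt (HasDerivAt.congr_deriv
        ((((h.hasDerivAt_flux hs).mul hd).add ((h.hasDerivAt_capNorm t).const_mul lam)).sub
        ((hd.fun_pow 2).const_mul ε)) ?_)
      norm_num
    · intro t ht
      rw [interior_Icc] at ht
      have hs := Real.sin_pos_of_mem_Ioo ht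
      have e : (μ ^ 2 / Real.sin t - lam * Real.sin t) * P t * P t
          + (Real.sin t * deriv P t) * deriv P t + lam * (P t ^ 2 * Real.sin t)
          - ε * (2 * P t * deriv P t)
          = ((ε * P t - Real.sin t * deriv P t) ^ 2 + (μ ^ 2 - ε ^ 2) * P t ^ 2)
            / Real.sin t := by
        field_simp
        ring
      rw [e, hε]
      have := mul_nonneg (sub_nonneg.2 hμ) (sq_nonneg (P t))
      positivity
  have h0 := key 1 (by norm_num) (Set.left_mem_Icc.2 Real.pi_pos.le) hθ hθ.1
  have h1 := key (-1) (by norm_num) hθ (Set.right_mem_Icc.2 Real.pi_pos.le) hθ.2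
  have e0 := (mul_eq_zero.1 h.mul_apply_zero).resolve_left hμ0
  have e1 := (mul_eq_zero.1 h.mul_apply_pi).resolve_left hμ0
  simp only [e0, e1, capNorm_zero] at h0 h1
  norm_num at h0 h1
  linarith

/-- Green's identity: the Dirichlet energy of a Legendre function of order zero. -/
lemma integral_deriv_sq (h : IsLegendreFn 0 lam P) :
    capNorm (deriv P) Real.pi = lam * capNorm P Real.pi := by
  have h1 : ∫ θ in (0 : ℝ)..Real.pi,
      ((deriv P θ) ^ 2 * Real.sin θ - lam * (P θ ^ 2 * Real.sin θ))
      = (Real.sin Real.pi * deriv P Real.pi) * P Real.pi - (Real.sin 0 * deriv P 0) * P 0 := by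
    refine intervalIntegral.integral_eq_sub_of_hasDerivAt_of_le
      (f := fun t => (Real.sin t * deriv P t) * P t) Real.pi_pos.le ?_ ?_ ?_
    · exact (h.continuous_flux.mul h.continuous).continuousOn
    · intro θ hθ
      have hs := (Real.sin_pos_of_mem_Ioo hθ).ne'
      refine ((h.hasDerivAt_flux hs).mul (h.differentiable θ).hasDerivAt).congr_deriv ?_
      ring
    · exact ((((h.contDiff_deriv.continuous).pow 2).mul Real.continuous_sin).sub
        (continuous_const.mul h.continuous_integrand)).intervalIntegrable _ _
  rw [intervalIntegral.integral_sub, intervalIntegral.integral_const_mul] at h1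
  · simp only [Real.sin_pi, Real.sin_zero, zero_mul, sub_zero] at h1
    unfold capNorm
    linarith
  · exact (((h.contDiff_deriv.continuous).pow 2).mul Real.continuous_sin).intervalIntegrable _ _
  · exact (continuous_const.mul h.continuous_integrand).intervalIntegrable _ _

/-- The energy `(sin θ P')² + (lam sin² θ - μ²) P²` has derivative `2 lam sin θ cos θ P²`, which
bounds `sin θ P'`. -/
lemma flux_sq_le (h : IsLegendreFn μ lam P) (hl : 0 ≤ lam) {θ : ℝ}
    (hθ : θ ∈ Set.Icc 0 Real.pi) :
    (Real.sin θ * deriv P θ) ^ 2 ≤ 2 * lam * capNorm P Real.pi + μ ^ 2 * P θ ^ 2 := by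
  have key : MonotoneOn (fun t => 2 * lam * capNorm P t - ((Real.sin t * deriv P t) ^ 2
      + (lam * Real.sin t ^ 2 - μ ^ 2) * P t ^ 2)) (Set.Icc 0 Real.pi) := by
    refine monotoneOn_of_hasDerivWithinAt_nonneg
      (f' := fun t => 2 * lam * (P t ^ 2 * Real.sin t) * (1 - Real.cos t)) (convex_Icc _ _) ?_ ?_ ?_
    · have : Continuous (capNorm P) :=
        continuous_iff_continuousAt.2 fun t => (h.hasDerivAt_capNorm t).continuousAt
      exact ((continuous_const.mul this).sub ((h.continuous_flux.pow 2).add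
        (((continuous_const.mul (Real.continuous_sin.pow 2)).sub continuous_const).mul
          (h.continuous.pow 2)))).continuousOn
    · intro t ht
      rw [interior_Icc] at ht
      have hs := (Real.sin_pos_of_mem_Ioo ht).ne'
      have hd := (h.differentiable t).hasDerivAt
      refine HasDerivAt.hasDerivWithinAt (HasDerivAt.congr_deriv
        (((h.hasDerivAt_capNorm t).const_mul (2 * lam)).sub
        (((h.hasDerivAt_flux hs).fun_pow 2).add
          (((((Real.hasDerivAt_sin t).fun_pow 2).const_mul lam).sub_const (μ ^ 2)).mul
            (hd.fun_pow 2)))) ?_)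
      field_simp
      push_cast
      ring
    · intro t ht
      rw [interior_Icc] at ht
      have hs := Real.sin_pos_of_mem_Ioo ht
      have := Real.cos_le_one t
      have : 0 ≤ 1 - Real.cos t := by linarith
      positivity
  have h0 := key (Set.left_mem_Icc.2 Real.pi_pos.le) hθ hθ.1
  have h1 := mul_le_mul_of_nonneg_left
    (h.capNorm_mono hθ (Set.right_mem_Icc.2 Real.pi_pos.le) hθ.2) hl
  have e0 := h.mul_apply_zero
  simp only [capNorm_zero, Real.sin_zero] at h0
  have e : μ ^ 2 * P 0 ^ 2 = 0 := by rw [← mul_pow, e0]; norm_num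
  have h2 : 0 ≤ lam * Real.sin θ ^ 2 * P θ ^ 2 := by positivity
  nlinarith

end IsLegendreFn


lemma exists_eval_ne_zero {q : Polynomial ℝ} (hq : q ≠ 0) :
    ∃ x ∈ Set.Ioo (-1 : ℝ) 1, q.eval x ≠ 0 := by
  by_contra! h
  exact hq (Polynomial.eq_zero_of_infinite_isRoot q
    ((Set.Ioo_infinite (by norm_num : (-1 : ℝ) < 1)).mono fun x hx => h x hx))

lemma legendreNorm_pos {ℓ m : ℕ} (h : m ≤ ℓ) :
    0 < IsLegendreFn.capNorm (assocLegendre ℓ m) Real.pi := by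
  have hq : rodrigues ℓ (ℓ + m) ≠ 0 := fun h0 => by
    have := degree_rodrigues (ℓ := ℓ) (n := ℓ + m) (by omega)
    rw [h0, Polynomial.degree_zero] at this
    exact WithBot.bot_ne_coe this
  obtain ⟨x, hx, hqx⟩ := exists_eval_ne_zero hq
  refine intervalIntegral.integral_pos Real.pi_pos
    (isLegendreFn_assocLegendre ℓ m).continuous_integrand.continuousOn
    (fun θ hθ => mul_nonneg (sq_nonneg _)
      (Real.sin_nonneg_of_mem_Icc (Set.Ioc_subset_Icc_self hθ)))
    ⟨Real.arccos x, ⟨Real.arccos_nonneg x, Real.arccos_le_pi x⟩, ?_⟩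
  have hc : Real.cos (Real.arccos x) = x := Real.cos_arccos hx.1.le hx.2.le
  have hs : 0 < Real.sin (Real.arccos x) := by
    rw [Real.sin_arccos]
    exact Real.sqrt_pos.2 (by nlinarith [hx.1, hx.2])
  simp only [assocLegendre, hc]
  positivity

/-- The associated Legendre function of degree `ℓ` and order `m`, normalised with respect to the
measure `sin θ dθ` on `[0, π]`. -/
def normLegendre (ℓ m : ℕ) (θ : ℝ) : ℝ :=
  (√(IsLegendreFn.capNorm (assocLegendre ℓ m) Real.pi))⁻¹ * assocLegendre ℓ m θ

lemma isLegendreFn_normLegendre (ℓ m : ℕ) :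
    IsLegendreFn m ((ℓ : ℝ) * (ℓ + 1)) (normLegendre ℓ m) :=
  (isLegendreFn_assocLegendre ℓ m).const_mul _

lemma capNorm_normLegendre {ℓ m : ℕ} (h : m ≤ ℓ) :
    IsLegendreFn.capNorm (normLegendre ℓ m) Real.pi = 1 := by
  have h0 := legendreNorm_pos h
  simp only [IsLegendreFn.capNorm, normLegendre, mul_pow, mul_assoc] at h0 ⊢
  rw [intervalIntegral.integral_const_mul, inv_pow, Real.sq_sqrt h0.le, inv_mul_cancel₀ h0.ne']

lemma integral_normLegendre_mul {ℓ ℓ' m : ℕ} (h : m ≤ ℓ) :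
    ∫ θ in (0 : ℝ)..Real.pi, normLegendre ℓ m θ * normLegendre ℓ' m θ * Real.sin θ
      = if ℓ = ℓ' then 1 else 0 := by
  split_ifs with he
  · subst he
    rw [← capNorm_normLegendre h]
    simp only [IsLegendreFn.capNorm, sq]
  · refine (isLegendreFn_normLegendre ℓ m).integral_mul_eq_zero (isLegendreFn_normLegendre ℓ' m) ?_
    intro e
    apply he
    have e' : ℓ * (ℓ + 1) = ℓ' * (ℓ' + 1) := by exact_mod_cast e
    nlinarith

/-- The derivative of a zonal function is an associated Legendre function of order one; its sup
norm bounds the oscillation of the zonal function. -/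
lemma assocLegendre_zero_sq_le (ℓ : ℕ) {θ : ℝ} (hθ : θ ∈ Set.Icc 0 Real.pi) :
    assocLegendre ℓ 0 θ ^ 2 ≤ (1 + Real.pi ^ 2 * ((ℓ : ℝ) * (ℓ + 1)) ^ 2)
      * IsLegendreFn.capNorm (assocLegendre ℓ 0) Real.pi := by
  have hP := isLegendreFn_assocLegendre ℓ 0
  have hd : deriv (assocLegendre ℓ 0) = fun θ => (-1) * assocLegendre ℓ 1 θ := by
    funext t
    have : assocLegendre ℓ 0 = fun t => (rodrigues ℓ ℓ).eval (Real.cos t) := by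
      funext t; simp [assocLegendre]
    rw [this, (hasDerivAt_rodrigues_cos ℓ ℓ t).deriv]
    simp [assocLegendre]
  have hQ : IsLegendreFn 1 ((ℓ : ℝ) * (ℓ + 1)) (deriv (assocLegendre ℓ 0)) := by
    rw [hd]; simpa using (isLegendreFn_assocLegendre ℓ 1).const_mul (-1)
  set P := assocLegendre ℓ 0
  set lam : ℝ := (ℓ : ℝ) * (ℓ + 1)
  set N := IsLegendreFn.capNorm P Real.pi
  have hN : 0 < N := legendreNorm_pos (Nat.zero_le ℓ)
  have hP0 : IsLegendreFn 0 lam P := by simpa using hP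
  have hd2 : ∀ t ∈ Set.Icc 0 Real.pi, ‖deriv P t‖ ≤ √(lam ^ 2 * N / 2) := by
    intro t ht
    have := hQ.sq_le_of_one_le (by norm_num) ht
    rw [hP0.integral_deriv_sq] at this
    exact Real.abs_le_sqrt (by linarith)
  have hosc : ∀ t ∈ Set.Icc 0 Real.pi, P θ ^ 2 ≤ 2 * P t ^ 2 + Real.pi ^ 2 * (lam ^ 2 * N) := by
    intro t ht
    have h1 := (convex_Icc 0 Real.pi).norm_image_sub_le_of_norm_deriv_le
      (fun t _ => hP.differentiable t) hd2 ht hθ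
    have h2 : ‖θ - t‖ ≤ Real.pi := by
      rw [Real.norm_eq_abs, abs_le]; constructor <;> linarith [ht.1, ht.2, hθ.1, hθ.2]
    have h3 : ‖P θ - P t‖ ≤ √(lam ^ 2 * N / 2) * Real.pi :=
      h1.trans (mul_le_mul_of_nonneg_left h2 (Real.sqrt_nonneg _))
    have h4 : (P θ - P t) ^ 2 ≤ (lam ^ 2 * N / 2) * Real.pi ^ 2 := by
      have := pow_le_pow_left₀ (norm_nonneg _) h3 2
      rwa [Real.norm_eq_abs, sq_abs, mul_pow, Real.sq_sqrt (by positivity)] at this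
    nlinarith [sq_nonneg (P θ - 2 * P t)]
  have hint : ∫ t in (0 : ℝ)..Real.pi, P θ ^ 2 * Real.sin t
      ≤ ∫ t in (0 : ℝ)..Real.pi, (2 * (P t ^ 2 * Real.sin t)
        + Real.pi ^ 2 * (lam ^ 2 * N) * Real.sin t) := by
    refine intervalIntegral.integral_mono_on Real.pi_pos.le
      ((continuous_const.mul Real.continuous_sin).intervalIntegrable _ _)
      (((continuous_const.mul hP.continuous_integrand).add
        (continuous_const.mul Real.continuous_sin)).intervalIntegrable _ _) fun t ht => ?_
    have := mul_le_mul_of_nonneg_right (hosc t ht) (Real.sin_nonneg_of_mem_Icc ht)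
    linarith
  have hi1 : IntervalIntegrable (fun t => 2 * (P t ^ 2 * Real.sin t)) MeasureTheory.volume
      0 Real.pi := (continuous_const.mul hP.continuous_integrand).intervalIntegrable _ _
  have hi2 : IntervalIntegrable (fun t => Real.pi ^ 2 * (lam ^ 2 * N) * Real.sin t)
      MeasureTheory.volume 0 Real.pi :=
    (continuous_const.mul Real.continuous_sin).intervalIntegrable _ _
  rw [intervalIntegral.integral_add hi1 hi2] at hint
  simp only [intervalIntegral.integral_const_mul, integral_sin, Real.cos_zero, Real.cos_pi] at hint
  have : ∫ t in (0 : ℝ)..Real.pi, P t ^ 2 * Real.sin t = N := rfl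
  rw [this] at hint
  linarith

/-- Normalised Legendre functions and their first two derivatives grow at most polynomially
in the degree. -/
lemma normLegendre_bounds {ℓ m : ℕ} (h : m ≤ ℓ) {θ : ℝ} (hθ : θ ∈ Set.Icc 0 Real.pi) :
    |normLegendre ℓ m θ| ≤ 13 * ((ℓ : ℝ) + 1) ^ 4 ∧
    |Real.sin θ * deriv (normLegendre ℓ m) θ| ≤ 13 * ((ℓ : ℝ) + 1) ^ 4 ∧
    |Real.sin θ ^ 2 * deriv (deriv (normLegendre ℓ m)) θ| ≤ 13 * ((ℓ : ℝ) + 1) ^ 4 := by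
  have hY := isLegendreFn_normLegendre ℓ m
  have hN := capNorm_normLegendre h
  set Y := normLegendre ℓ m with hYdef
  set lam : ℝ := (ℓ : ℝ) * (ℓ + 1) with hlam
  set L : ℝ := ((ℓ : ℝ) + 1) ^ 2 with hL
  have hl0 : (0 : ℝ) ≤ ℓ := Nat.cast_nonneg ℓ
  have hlam0 : 0 ≤ lam := by positivity
  have hlamL : lam ≤ L := by nlinarith
  have hL1 : 1 ≤ L := by nlinarith
  have hm : (m : ℝ) ^ 2 ≤ lam := by
    have : (m : ℝ) ≤ ℓ := by exact_mod_cast h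
    have : (0 : ℝ) ≤ m := Nat.cast_nonneg m
    nlinarith
  have hpi : Real.pi ^ 2 ≤ 10 := by nlinarith [Real.pi_lt_d2, Real.pi_gt_three]
  have hlL2 : lam ^ 2 ≤ L ^ 2 := pow_le_pow_left₀ hlam0 hlamL 2
  have hsq : Y θ ^ 2 ≤ (4 * L) ^ 2 := by
    rcases Nat.eq_zero_or_pos m with rfl | hmpos
    · have h1 := assocLegendre_zero_sq_le ℓ hθ
      have h0 := legendreNorm_pos h
      have h2 : Y θ ^ 2 ≤ 1 + Real.pi ^ 2 * lam ^ 2 := by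
        rw [hYdef]
        simp only [normLegendre]
        rw [mul_pow, inv_pow, Real.sq_sqrt h0.le, inv_mul_le_iff₀ h0]
        linarith
      have : Real.pi ^ 2 * lam ^ 2 ≤ 10 * L ^ 2 := by gcongr
      nlinarith
    · have h1 := hY.sq_le_of_one_le (by
        have : (1 : ℝ) ≤ m := by exact_mod_cast hmpos
        nlinarith) hθ
      rw [hN] at h1
      nlinarith
  have hYa : |Y θ| ≤ 4 * L := abs_le_of_sq_le_sq hsq (by positivity)
  have hG2 : (Real.sin θ * deriv Y θ) ^ 2 ≤ (5 * L ^ 2) ^ 2 := by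
    have h1 := hY.flux_sq_le hlam0 hθ
    rw [hN] at h1
    have h2 : (m : ℝ) ^ 2 * Y θ ^ 2 ≤ L * (4 * L) ^ 2 := by
      gcongr; exact hm.trans hlamL
    have h3 : L ≤ L ^ 4 := by
      calc L = L * 1 := by ring
        _ ≤ L * L ^ 3 := by gcongr; exact one_le_pow₀ hL1
        _ = L ^ 4 := by ring
    have h4 : L ^ 3 ≤ L ^ 4 := pow_le_pow_right₀ hL1 (by norm_num)
    nlinarith
  have hGa : |Real.sin θ * deriv Y θ| ≤ 5 * L ^ 2 := abs_le_of_sq_le_sq hG2 (by positivity)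
  have hLL : L ≤ L ^ 2 := by nlinarith
  have hL4 : ((ℓ : ℝ) + 1) ^ 4 = L ^ 2 := by rw [hL]; ring
  rw [hL4]
  refine ⟨by nlinarith, by nlinarith, ?_⟩
  rw [hY.sin_sq_mul_deriv_deriv]
  have hs1 : Real.sin θ ^ 2 ≤ 1 := Real.sin_sq_le_one θ
  have hs0 : 0 ≤ Real.sin θ ^ 2 := sq_nonneg _
  have h5 : |(m : ℝ) ^ 2 - lam * Real.sin θ ^ 2| ≤ L := by
    have : lam * Real.sin θ ^ 2 ≤ lam := by nlinarith
    have : 0 ≤ lam * Real.sin θ ^ 2 := by positivity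
    have : (0 : ℝ) ≤ (m : ℝ) ^ 2 := by positivity
    rw [abs_le]; constructor <;> linarith
  calc |((m : ℝ) ^ 2 - lam * Real.sin θ ^ 2) * Y θ - Real.cos θ * (Real.sin θ * deriv Y θ)|
      ≤ |((m : ℝ) ^ 2 - lam * Real.sin θ ^ 2) * Y θ|
        + |Real.cos θ * (Real.sin θ * deriv Y θ)| := abs_sub _ _
    _ ≤ L * (4 * L) + 1 * (5 * L ^ 2) := by
        rw [abs_mul, abs_mul (Real.cos θ)]
        gcongr
        exact Real.abs_cos_le_one θ
    _ ≤ 13 * L ^ 2 := by nlinarith [sq_nonneg L]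

/-- Completeness of the Legendre functions of a fixed order. -/
lemma eq_zero_of_integral_assocLegendre (m : ℕ) {g : ℝ → ℝ}
    (hg : ContinuousOn g (Set.Icc 0 Real.pi))
    (h : ∀ ℓ, m ≤ ℓ → ∫ θ in (0 : ℝ)..Real.pi, g θ * assocLegendre ℓ m θ * Real.sin θ = 0) :
    ∀ θ ∈ Set.Icc 0 Real.pi, g θ = 0 := by
  set f : ℝ → ℝ := fun θ => g θ * Real.sin θ ^ (m + 1) with hf
  have hfc : ContinuousOn f (Set.Icc 0 Real.pi) :=
    hg.mul (Real.continuous_sin.pow _).continuousOn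
  have hu : Set.uIcc 0 Real.pi = Set.Icc 0 Real.pi := Set.uIcc_of_le Real.pi_pos.le
  have hqc : ∀ q : Polynomial ℝ, Continuous fun θ => q.eval (Real.cos θ) :=
    fun q => q.continuous.comp Real.continuous_cos
  have hii : ∀ q : Polynomial ℝ, IntervalIntegrable (fun θ => f θ * q.eval (Real.cos θ))
      MeasureTheory.volume 0 Real.pi := fun q =>
    (hu ▸ hfc.mul (hqc q).continuousOn : ContinuousOn _ (Set.uIcc 0 Real.pi)).intervalIntegrable
  -- orthogonality to every polynomial in `cos θ`
  have hpoly : ∀ q : Polynomial ℝ, ∫ θ in (0 : ℝ)..Real.pi, f θ * q.eval (Real.cos θ) = 0 := by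
    let S : Polynomial.Sequence ℝ :=
      { elems' := fun k => rodrigues (m + k) (m + k + m)
        degree_eq' := fun k => by
          rw [degree_rodrigues (by omega)]
          congr 1
          omega }
    intro q
    have hq : q ∈ Submodule.span ℝ (Set.range S) := by
      rw [S.span fun i => (Polynomial.leadingCoeff_ne_zero.2 (S.ne_zero i)).isUnit]
      trivial
    induction hq using Submodule.span_induction with
    | mem x hx =>
      obtain ⟨k, rfl⟩ := hx
      refine Eq.trans ?_ (h (m + k) (by omega))
      congr 1
      funext θ
      change f θ * (rodrigues (m + k) (m + k + m)).eval (Real.cos θ) = _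
      simp only [hf, assocLegendre]
      ring
    | zero => simp
    | add x y _ _ hx hy =>
      simp only [Polynomial.eval_add, mul_add]
      rw [intervalIntegral.integral_add (hii x) (hii y), hx, hy, add_zero]
    | smul a x _ hx =>
      simp only [Polynomial.eval_smul, smul_eq_mul]
      simp only [mul_left_comm _ a]
      rw [intervalIntegral.integral_const_mul, hx, mul_zero]
  have hff : IntervalIntegrable (fun θ => f θ ^ 2) MeasureTheory.volume 0 Real.pi :=
    (hu ▸ hfc.pow 2 : ContinuousOn _ (Set.uIcc 0 Real.pi)).intervalIntegrable
  have hfa : IntervalIntegrable (fun θ => |f θ|) MeasureTheory.volume 0 Real.pi :=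
    (hu ▸ hfc.abs : ContinuousOn _ (Set.uIcc 0 Real.pi)).intervalIntegrable
  -- Weierstrass approximation in the variable `cos θ`
  have hle : ∫ θ in (0 : ℝ)..Real.pi, f θ ^ 2 ≤ 0 := by
    set A := ∫ θ in (0 : ℝ)..Real.pi, |f θ|
    have hA : 0 ≤ A := intervalIntegral.integral_nonneg Real.pi_pos.le fun _ _ => abs_nonneg _
    refine le_of_forall_pos_le_add fun ε hε => ?_
    have hF : ContinuousOn (fun x => f (Real.arccos x)) (Set.Icc (-1) 1) :=
      hfc.comp Real.continuous_arccos.continuousOn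
        fun x _ => ⟨Real.arccos_nonneg x, Real.arccos_le_pi x⟩
    obtain ⟨q, hq⟩ := exists_polynomial_near_of_continuousOn (-1) 1 _ hF (ε / (A + 1))
      (by positivity)
    have h1 : ∫ θ in (0 : ℝ)..Real.pi, f θ ^ 2
        = ∫ θ in (0 : ℝ)..Real.pi, (f θ ^ 2 - f θ * q.eval (Real.cos θ)) := by
      rw [intervalIntegral.integral_sub hff (hii q), hpoly q, sub_zero]
    rw [h1, zero_add]
    calc ∫ θ in (0 : ℝ)..Real.pi, (f θ ^ 2 - f θ * q.eval (Real.cos θ))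
        ≤ ∫ θ in (0 : ℝ)..Real.pi, ε / (A + 1) * |f θ| := by
          refine intervalIntegral.integral_mono_on Real.pi_pos.le (hff.sub (hii q))
            (hfa.const_mul _) fun θ hθ => ?_
          have h2 := hq (Real.cos θ) ⟨Real.neg_one_le_cos θ, Real.cos_le_one θ⟩
          rw [Real.arccos_cos hθ.1 hθ.2] at h2
          calc f θ ^ 2 - f θ * q.eval (Real.cos θ) = f θ * (f θ - q.eval (Real.cos θ)) := by ring
            _ ≤ |f θ| * |f θ - q.eval (Real.cos θ)| := by
              rw [← abs_mul]; exact le_abs_self _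
            _ ≤ |f θ| * (ε / (A + 1)) := by
              rw [abs_sub_comm]; gcongr
            _ = _ := mul_comm _ _
      _ = ε / (A + 1) * A := intervalIntegral.integral_const_mul _ _
      _ ≤ ε := by
        rw [div_mul_eq_mul_div, div_le_iff₀ (by positivity)]
        nlinarith
  have hz : ∀ θ ∈ Set.Icc 0 Real.pi, f θ = 0 := by
    intro θ hθ
    by_contra hne
    exact absurd hle (not_le.2 (intervalIntegral.integral_pos Real.pi_pos (hfc.pow 2)
      (fun _ _ => sq_nonneg _) ⟨θ, hθ, by positivity⟩))
  have hz' : Set.EqOn g 0 (Set.Ioo 0 Real.pi) := fun θ hθ =>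
    (mul_eq_zero.1 (hz θ (Set.Ioo_subset_Icc_self hθ))).resolve_right
      (pow_ne_zero _ (Real.sin_pos_of_mem_Ioo hθ).ne')
  exact hz'.of_subset_closure hg continuousOn_const Set.Ioo_subset_Icc_self
    (by rw [closure_Ioo Real.pi_pos.ne])

/-! ### Azimuthal functions -/

/-- The real azimuthal function `cos (mφ) + sin (mφ)`. For `m ∈ ℤ` these are pairwise orthogonal
on a period, all with the same norm, and span the trigonometric polynomials. -/
def cas (m : ℤ) (φ : ℝ) : ℝ := Real.cos (m * φ) + Real.sin (m * φ)

lemma hasDerivAt_cas (m : ℤ) (φ : ℝ) : HasDerivAt (cas m) (m * cas (-m) φ) φ := by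
  have h : HasDerivAt (fun φ : ℝ => (m : ℝ) * φ) m φ := by
    simpa using (hasDerivAt_id φ).const_mul (m : ℝ)
  refine (h.cos.add h.sin).congr_deriv ?_
  simp only [cas, Int.cast_neg, neg_mul, Real.cos_neg, Real.sin_neg]
  ring

lemma deriv_cas (m : ℤ) : deriv (cas m) = fun φ => m * cas (-m) φ :=
  funext fun φ => (hasDerivAt_cas m φ).deriv

lemma hasDerivAt_deriv_cas (m : ℤ) (φ : ℝ) :
    HasDerivAt (deriv (cas m)) (-(m : ℝ) ^ 2 * cas m φ) φ := by
  rw [deriv_cas]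
  refine ((hasDerivAt_cas (-m) φ).const_mul (m : ℝ)).congr_deriv ?_
  push_cast
  rw [neg_neg]
  ring

lemma contDiff_cas (m : ℤ) : ContDiff ℝ 2 (cas m) :=
  (Real.contDiff_cos.comp (contDiff_const.mul contDiff_id)).add
    (Real.contDiff_sin.comp (contDiff_const.mul contDiff_id))

lemma continuous_cas (m : ℤ) : Continuous (cas m) := (contDiff_cas m).continuous

lemma cas_periodic (m : ℤ) : Function.Periodic (cas m) (2 * Real.pi) := by
  intro φ
  have e : (m : ℝ) * (φ + 2 * Real.pi) = m * φ + m * (2 * Real.pi) := by ring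
  simp only [cas, e, Real.cos_add_int_mul_two_pi, Real.sin_add_int_mul_two_pi]

lemma abs_cas_le (m : ℤ) (φ : ℝ) : |cas m φ| ≤ 2 := by
  have h1 := abs_add_le (Real.cos (m * φ)) (Real.sin (m * φ))
  have := Real.abs_cos_le_one (m * φ)
  have := Real.abs_sin_le_one (m * φ)
  unfold cas
  linarith

lemma azimuthalEquation_cas (m : ℤ) : AzimuthalEquation (-(m : ℝ) ^ 2) (cas m) where
  contDiff := contDiff_cas m
  periodic := cas_periodic m
  ode φ := by
    rw [iteratedDeriv_succ, iteratedDeriv_one, (hasDerivAt_deriv_cas m φ).deriv, sub_self]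

lemma integral_cos_int (k : ℤ) (hk : k ≠ 0) :
    ∫ φ in (0 : ℝ)..2 * Real.pi, Real.cos (k * φ) = 0 := by
  have hk' : (k : ℝ) ≠ 0 := by exact_mod_cast hk
  rw [intervalIntegral.integral_comp_mul_left (fun x => Real.cos x) hk', integral_cos]
  have : Real.sin ((k : ℝ) * (2 * Real.pi)) = 0 := by
    simpa using Real.sin_add_int_mul_two_pi 0 k
  simp [this]

lemma integral_sin_int (k : ℤ) : ∫ φ in (0 : ℝ)..2 * Real.pi, Real.sin (k * φ) = 0 := by
  rcases eq_or_ne k 0 with rfl | hk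
  · simp
  have hk' : (k : ℝ) ≠ 0 := by exact_mod_cast hk
  rw [intervalIntegral.integral_comp_mul_left (fun x => Real.sin x) hk', integral_sin]
  have : Real.cos ((k : ℝ) * (2 * Real.pi)) = 1 := by
    simp
  simp [this]

lemma integral_cas_mul_cas (m n : ℤ) :
    ∫ φ in (0 : ℝ)..2 * Real.pi, cas m φ * cas n φ = if m = n then 2 * Real.pi else 0 := by
  have e : ∀ φ : ℝ, cas m φ * cas n φ
      = Real.cos ((m - n : ℤ) * φ) + Real.sin ((m + n : ℤ) * φ) := by
    intro φ
    push_cast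
    rw [sub_mul, add_mul, Real.cos_sub, Real.sin_add]
    simp only [cas]
    ring
  simp only [e]
  rw [intervalIntegral.integral_add, integral_sin_int]
  · split_ifs with h
    · subst h; simp
    · rw [integral_cos_int _ (sub_ne_zero.2 h), add_zero]
  · exact (Real.continuous_cos.comp (continuous_const.mul continuous_id)).intervalIntegrable _ _
  · exact (Real.continuous_sin.comp (continuous_const.mul continuous_id)).intervalIntegrable _ _

/-- Completeness of the azimuthal functions. -/
lemma eq_zero_of_integral_cas {f : ℝ → ℝ} (hf : Continuous f)
    (hp : Function.Periodic f (2 * Real.pi))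
    (h : ∀ m : ℤ, ∫ φ in (0 : ℝ)..2 * Real.pi, f φ * cas m φ = 0) (φ : ℝ) : f φ = 0 := by
  have : Fact (0 < 2 * Real.pi) := ⟨Real.two_pi_pos⟩
  have hp' : Function.Periodic (fun x => (f x : ℂ)) (2 * Real.pi) := fun x => by simp [hp x]
  let F : C(AddCircle (2 * Real.pi), ℂ) :=
    ⟨hp'.lift, continuous_coinduced_dom.mpr (Complex.continuous_ofReal.comp hf)⟩
  have hi : ∀ g : ℝ → ℝ, Continuous g →
      IntervalIntegrable (fun x => f x * g x) MeasureTheory.volume 0 (2 * Real.pi) :=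
    fun g hg => (hf.mul hg).intervalIntegrable _ _
  have hcos : ∀ n : ℤ, ∫ x in (0 : ℝ)..2 * Real.pi, f x * Real.cos (n * x) = 0 := by
    intro n
    have e : ∀ x : ℝ, f x * Real.cos (n * x)
        = (1 / 2) * (f x * cas n x) + (1 / 2) * (f x * cas (-n) x) := by
      intro x
      simp only [cas, Int.cast_neg, neg_mul, Real.cos_neg, Real.sin_neg]
      ring
    simp only [e]
    rw [intervalIntegral.integral_add ((hi _ (continuous_cas n)).const_mul _)
      ((hi _ (continuous_cas (-n))).const_mul _), intervalIntegral.integral_const_mul,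
      intervalIntegral.integral_const_mul, h, h]
    norm_num
  have hsin : ∀ n : ℤ, ∫ x in (0 : ℝ)..2 * Real.pi, f x * Real.sin (n * x) = 0 := by
    intro n
    have e : ∀ x : ℝ, f x * Real.sin (n * x) = f x * cas n x - f x * Real.cos (n * x) := by
      intro x
      simp only [cas]
      ring
    simp only [e]
    rw [intervalIntegral.integral_sub (hi _ (continuous_cas n))
      (hi (fun x => Real.cos (n * x)) (by fun_prop)), h, hcos, sub_zero]
  have hF : ∀ n : ℤ, fourierCoeff F n = 0 := by
    intro n
    rw [fourierCoeff_eq_intervalIntegral _ _ 0, zero_add]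
    have e : ∀ x : ℝ, fourier (-n) (x : AddCircle (2 * Real.pi)) • F x
        = ((f x * Real.cos (n * x) : ℝ) : ℂ) - Complex.I * ((f x * Real.sin (n * x) : ℝ) : ℂ) := by
      intro x
      have e1 : (2 * (Real.pi : ℂ) * Complex.I * ((-n : ℤ) : ℂ) * x / ((2 * Real.pi : ℝ) : ℂ))
          = ((-(n * x) : ℝ) : ℂ) * Complex.I := by
        have : (Real.pi : ℂ) ≠ 0 := by exact_mod_cast Real.pi_ne_zero
        push_cast
        field_simp
      rw [fourier_coe_apply, e1, Complex.exp_mul_I, ← Complex.ofReal_cos, ← Complex.ofReal_sin,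
        Real.cos_neg, Real.sin_neg]
      change _ • (f x : ℂ) = _
      push_cast
      rw [smul_eq_mul]
      ring
    have hi' : ∀ g : ℝ → ℝ, Continuous g →
      IntervalIntegrable (fun x => ((f x * g x : ℝ) : ℂ)) MeasureTheory.volume 0 (2 * Real.pi) :=
      fun g hg => (Complex.continuous_ofReal.comp (hf.mul hg)).intervalIntegrable _ _
    simp only [e]
    rw [intervalIntegral.integral_sub (hi' (fun x => Real.cos (n * x)) (by fun_prop))
      ((hi' (fun x => Real.sin (n * x)) (by fun_prop)).const_mul _),
      intervalIntegral.integral_const_mul, intervalIntegral.integral_ofReal,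
      intervalIntegral.integral_ofReal, hcos, hsin]
    simp
  have hs := has_pointwise_sum_fourier_series_of_summable (f := F)
    (by rw [show fourierCoeff F = fun _ => 0 from funext hF]; exact summable_zero) (φ : AddCircle _)
  simp only [hF, zero_smul] at hs
  have := hs.unique hasSum_zero
  change (f φ : ℂ) = 0 at this
  exact_mod_cast this

/-! ### Coefficients with respect to spherical harmonics -/

/-- A fundamental rectangle for the angular coordinates `(θ, φ)`. -/
def angleRect : Set (ℝ × ℝ) := Set.Icc 0 Real.pi ×ˢ Set.Icc 0 (2 * Real.pi)

lemma isCompact_angleRect : IsCompact angleRect := isCompact_Icc.prod isCompact_Icc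

/-- The spherical harmonic `P_{ℓ|m|}(θ) cas (mφ)`, of squared norm `2π` on the sphere. -/
def sphHarmonic (ℓ : ℕ) (m : ℤ) (q : ℝ × ℝ) : ℝ := normLegendre ℓ m.natAbs q.1 * cas m q.2

lemma continuous_sphHarmonic (ℓ : ℕ) (m : ℤ) : Continuous (sphHarmonic ℓ m) :=
  ((isLegendreFn_normLegendre ℓ m.natAbs).continuous.comp continuous_fst).mul
    ((continuous_cas m).comp continuous_snd)

/-- The integral over the sphere of `f` against a spherical harmonic. -/
def harmonicCoeff (ℓ : ℕ) (m : ℤ) (f : ℝ × ℝ → ℝ) : ℝ :=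
  ∫ q in angleRect, f q * (sphHarmonic ℓ m q * Real.sin q.1)

/-- Fubini on a rectangle, with the iterated integrals as interval integrals. -/
lemma setIntegral_rect {a b c d : ℝ} (hab : a ≤ b) (hcd : c ≤ d) {F : ℝ × ℝ → ℝ}
    (hF : ContinuousOn F (Set.Icc a b ×ˢ Set.Icc c d)) :
    ∫ q in Set.Icc a b ×ˢ Set.Icc c d, F q = ∫ θ in a..b, ∫ φ in c..d, F (θ, φ) := by
  rw [MeasureTheory.Measure.volume_eq_prod, MeasureTheory.setIntegral_prod _
    (hF.integrableOn_compact (isCompact_Icc.prod isCompact_Icc)),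
    MeasureTheory.integral_Icc_eq_integral_Ioc, intervalIntegral.integral_of_le hab]
  congr 1
  funext θ
  rw [MeasureTheory.integral_Icc_eq_integral_Ioc, intervalIntegral.integral_of_le hcd]

lemma setIntegral_rect_swap {a b c d : ℝ} (hab : a ≤ b) (hcd : c ≤ d) {F : ℝ × ℝ → ℝ}
    (hF : ContinuousOn F (Set.Icc a b ×ˢ Set.Icc c d)) :
    ∫ q in Set.Icc a b ×ˢ Set.Icc c d, F q = ∫ φ in c..d, ∫ θ in a..b, F (θ, φ) := by
  have h : ContinuousOn (fun q : ℝ × ℝ => F q.swap) (Set.Icc c d ×ˢ Set.Icc a b) :=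
    hF.comp continuous_swap.continuousOn fun q hq => ⟨hq.2, hq.1⟩
  have := setIntegral_rect hcd hab h
  simp only [Prod.swap_prod_mk] at this
  rw [← this, MeasureTheory.Measure.volume_eq_prod]
  exact (MeasureTheory.setIntegral_prod_swap (Set.Icc a b) (Set.Icc c d) F).symm

lemma continuousOn_harmonicCoeff_integrand (ℓ : ℕ) (m : ℤ) {f : ℝ × ℝ → ℝ}
    (hf : ContinuousOn f angleRect) :
    ContinuousOn (fun q => f q * (sphHarmonic ℓ m q * Real.sin q.1)) angleRect :=
  hf.mul ((continuous_sphHarmonic ℓ m).mul (Real.continuous_sin.comp continuous_fst)).continuousOn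

lemma harmonicCoeff_eq (ℓ : ℕ) (m : ℤ) {f : ℝ × ℝ → ℝ} (hf : ContinuousOn f angleRect) :
    harmonicCoeff ℓ m f = ∫ θ in (0 : ℝ)..Real.pi,
      (∫ φ in (0 : ℝ)..2 * Real.pi, f (θ, φ) * cas m φ) * normLegendre ℓ m.natAbs θ
        * Real.sin θ := by
  rw [harmonicCoeff, angleRect, setIntegral_rect Real.pi_pos.le Real.two_pi_pos.le
    (continuousOn_harmonicCoeff_integrand ℓ m hf)]
  congr 1
  funext θ
  rw [← intervalIntegral.integral_mul_const, ← intervalIntegral.integral_mul_const]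
  congr 1
  funext φ
  simp only [sphHarmonic]
  ring

lemma harmonicCoeff_mul (ℓ : ℕ) (m : ℤ) {Θ Φ : ℝ → ℝ} (hΘ : ContinuousOn Θ (Set.Icc 0 Real.pi))
    (hΦ : Continuous Φ) :
    harmonicCoeff ℓ m (fun q => Θ q.1 * Φ q.2)
      = (∫ θ in (0 : ℝ)..Real.pi, Θ θ * normLegendre ℓ m.natAbs θ * Real.sin θ)
        * ∫ φ in (0 : ℝ)..2 * Real.pi, Φ φ * cas m φ := by
  rw [harmonicCoeff_eq]
  · rw [← intervalIntegral.integral_mul_const]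
    congr 1
    funext θ
    simp only [mul_assoc, intervalIntegral.integral_const_mul]
    ring
  · exact (hΘ.comp continuousOn_fst fun q hq => hq.1).mul (hΦ.comp continuous_snd).continuousOn

/-- Orthogonality of the spherical harmonics. -/
lemma harmonicCoeff_sphHarmonic {ℓ : ℕ} {m : ℤ} (h : m.natAbs ≤ ℓ) (ℓ' : ℕ) (m' : ℤ) :
    harmonicCoeff ℓ m (sphHarmonic ℓ' m') = if (ℓ', m') = (ℓ, m) then 2 * Real.pi else 0 := by
  have h1 : harmonicCoeff ℓ m (sphHarmonic ℓ' m') = _ :=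
    harmonicCoeff_mul ℓ m (isLegendreFn_normLegendre ℓ' m'.natAbs).continuous.continuousOn
      (continuous_cas m')
  rw [h1, integral_cas_mul_cas]
  rcases eq_or_ne m' m with rfl | hm
  · simp only [mul_comm (normLegendre ℓ' _ _)]
    rw [integral_normLegendre_mul h]
    by_cases hl : ℓ = ℓ'
    · simp [hl]
    · simp [hl, Ne.symm hl]
  · simp [hm]

lemma harmonicCoeff_const_mul (ℓ : ℕ) (m : ℤ) (a : ℝ) (f : ℝ × ℝ → ℝ) :
    harmonicCoeff ℓ m (fun q => a * f q) = a * harmonicCoeff ℓ m f := by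
  simp only [harmonicCoeff, mul_assoc]
  rw [MeasureTheory.integral_const_mul]

lemma harmonicCoeff_sum (ℓ : ℕ) (m : ℤ) {ι : Type*} (s : Finset ι) {f : ι → ℝ × ℝ → ℝ}
    (hf : ∀ i ∈ s, ContinuousOn (f i) angleRect) :
    harmonicCoeff ℓ m (fun q => ∑ i ∈ s, f i q) = ∑ i ∈ s, harmonicCoeff ℓ m (f i) := by
  simp only [harmonicCoeff, Finset.sum_mul]
  exact MeasureTheory.integral_finsetSum _ fun i hi =>
    (continuousOn_harmonicCoeff_integrand ℓ m (hf i hi)).integrableOn_compact isCompact_angleRect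

lemma harmonicCoeff_sub (ℓ : ℕ) (m : ℤ) {f g : ℝ × ℝ → ℝ} (hf : ContinuousOn f angleRect)
    (hg : ContinuousOn g angleRect) :
    harmonicCoeff ℓ m (fun q => f q - g q) = harmonicCoeff ℓ m f - harmonicCoeff ℓ m g := by
  simp only [harmonicCoeff, sub_mul]
  exact MeasureTheory.integral_sub
    ((continuousOn_harmonicCoeff_integrand ℓ m hf).integrableOn_compact isCompact_angleRect)
    ((continuousOn_harmonicCoeff_integrand ℓ m hg).integrableOn_compact isCompact_angleRect)

lemma abs_sphHarmonic_le {ℓ : ℕ} {m : ℤ} (h : m.natAbs ≤ ℓ) {q : ℝ × ℝ}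
    (hq : q.1 ∈ Set.Icc 0 Real.pi) : |sphHarmonic ℓ m q| ≤ 26 * ((ℓ : ℝ) + 1) ^ 4 := by
  rw [sphHarmonic, abs_mul]
  have h1 := (normLegendre_bounds h hq).1
  have h2 := abs_cas_le m q.2
  calc _ ≤ 13 * ((ℓ : ℝ) + 1) ^ 4 * 2 := by gcongr
    _ = _ := by ring

lemma volume_angleRect : MeasureTheory.volume.real angleRect = 2 * Real.pi ^ 2 := by
  rw [angleRect, MeasureTheory.Measure.volume_eq_prod, MeasureTheory.measureReal_prod_prod]
  rw [Real.volume_real_Icc_of_le Real.pi_pos.le, Real.volume_real_Icc_of_le Real.two_pi_pos.le]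
  ring

lemma abs_harmonicCoeff_le {ℓ : ℕ} {m : ℤ} (h : m.natAbs ≤ ℓ) {f : ℝ × ℝ → ℝ} {C : ℝ}
    (hf : ∀ q ∈ angleRect, |f q| ≤ C) :
    |harmonicCoeff ℓ m f| ≤ C * (520 * ((ℓ : ℝ) + 1) ^ 4) := by
  have hC : 0 ≤ C := (abs_nonneg _).trans (hf (0, 0) ⟨⟨le_rfl, Real.pi_pos.le⟩,
    ⟨le_rfl, Real.two_pi_pos.le⟩⟩)
  have h1 : ‖harmonicCoeff ℓ m f‖ ≤ (C * (26 * ((ℓ : ℝ) + 1) ^ 4))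
      * MeasureTheory.volume.real angleRect := by
    refine MeasureTheory.norm_setIntegral_le_of_norm_le_const
      isCompact_angleRect.measure_lt_top fun q hq => ?_
    rw [Real.norm_eq_abs, abs_mul, abs_mul]
    have h2 := abs_sphHarmonic_le h hq.1
    have h3 := Real.abs_sin_le_one q.1
    calc _ ≤ C * (26 * ((ℓ : ℝ) + 1) ^ 4 * 1) := by
          gcongr
          exact hf q hq
      _ = _ := by ring
  rw [volume_angleRect] at h1
  have hpi : 2 * Real.pi ^ 2 ≤ 20 := by nlinarith [Real.pi_lt_d2, Real.pi_gt_three]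
  calc |harmonicCoeff ℓ m f| ≤ (C * (26 * ((ℓ : ℝ) + 1) ^ 4)) * (2 * Real.pi ^ 2) := h1
    _ ≤ (C * (26 * ((ℓ : ℝ) + 1) ^ 4)) * 20 := by gcongr
    _ = _ := by ring

/-- Completeness of the spherical harmonics. -/
lemma eq_zero_of_harmonicCoeff {f : ℝ × ℝ → ℝ}
    (hf : ContinuousOn f (Set.Icc 0 Real.pi ×ˢ Set.univ))
    (hp : ∀ θ ∈ Set.Icc 0 Real.pi, ∀ φ, f (θ, φ + 2 * Real.pi) = f (θ, φ))
    (h : ∀ (ℓ : ℕ) (m : ℤ), m.natAbs ≤ ℓ → harmonicCoeff ℓ m f = 0) :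
    ∀ q ∈ Set.Icc 0 Real.pi ×ˢ (Set.univ : Set ℝ), f q = 0 := by
  -- constant extension in `θ` makes the integrand continuous everywhere
  set F : ℝ → ℝ → ℝ := fun θ φ => f (Set.projIcc 0 Real.pi Real.pi_pos.le θ, φ) with hFdef
  have hF : Continuous F.uncurry := by
    refine hf.comp_continuous (f := fun p : ℝ × ℝ =>
      (((Set.projIcc 0 Real.pi Real.pi_pos.le p.1 : Set.Icc 0 Real.pi) : ℝ), p.2)) ?_
      fun p => ⟨Subtype.coe_prop _, trivial⟩
    exact ((continuous_subtype_val.comp continuous_projIcc).comp continuous_fst).prodMk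
      continuous_snd
  have hFf : ∀ θ ∈ Set.Icc 0 Real.pi, ∀ φ, F θ φ = f (θ, φ) := by
    intro θ hθ φ
    simp only [hFdef, Set.projIcc_of_mem Real.pi_pos.le hθ]
  have hz : ∀ m : ℤ, ∀ θ ∈ Set.Icc 0 Real.pi,
      ∫ φ in (0 : ℝ)..2 * Real.pi, F θ φ * cas m φ = 0 := by
    intro m
    have hc : Continuous fun θ => ∫ φ in (0 : ℝ)..2 * Real.pi, F θ φ * cas m φ :=
      intervalIntegral.continuous_parametric_intervalIntegral_of_continuous'
        (hF.mul ((continuous_cas m).comp continuous_snd)) _ _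
    refine eq_zero_of_integral_assocLegendre m.natAbs hc.continuousOn fun ℓ hℓ => ?_
    have h1 := h ℓ m hℓ
    rw [harmonicCoeff_eq ℓ m (hf.mono (Set.prod_mono_right (Set.subset_univ _)))] at h1
    have h2 : ∫ θ in (0 : ℝ)..Real.pi, (√(IsLegendreFn.capNorm (assocLegendre ℓ m.natAbs)
        Real.pi))⁻¹ * ((∫ φ in (0 : ℝ)..2 * Real.pi, F θ φ * cas m φ)
          * assocLegendre ℓ m.natAbs θ * Real.sin θ) = 0 := by
      refine Eq.trans (intervalIntegral.integral_congr fun θ hθ => ?_) h1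
      rw [Set.uIcc_of_le Real.pi_pos.le] at hθ
      simp only [hFf θ hθ, normLegendre]
      ring
    rw [intervalIntegral.integral_const_mul] at h2
    exact (mul_eq_zero.1 h2).resolve_left
      (inv_ne_zero (Real.sqrt_pos.2 (legendreNorm_pos hℓ)).ne')
  rintro ⟨θ, φ⟩ ⟨hθ, -⟩
  rw [← hFf θ hθ]
  refine eq_zero_of_integral_cas (f := F θ) (hF.uncurry_left θ) (fun φ => ?_)
    (fun m => hz m θ hθ) φ
  rw [hFf θ hθ, hFf θ hθ, hp θ hθ]

/-! ### Solutions of the radial equation -/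

/-- The general solution `α r^ℓ + β r^{-ℓ-1}` of the Euler–Cauchy equation. -/
def eulerSol (ℓ : ℕ) (α β r : ℝ) : ℝ := α * r ^ ℓ + β * (r ^ (ℓ + 1))⁻¹

lemma hasDerivAt_eulerSol (ℓ : ℕ) (α β : ℝ) {r : ℝ} (hr : 0 < r) :
    HasDerivAt (eulerSol ℓ α β) (eulerSol ℓ (ℓ * α) (-((ℓ + 1) * β)) r / r) r := by
  have h1 : HasDerivAt (fun r : ℝ => α * r ^ ℓ) (α * (ℓ * r ^ (ℓ - 1))) r :=
    (hasDerivAt_pow ℓ r).const_mul α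
  have h2 : HasDerivAt (fun r : ℝ => β * (r ^ (ℓ + 1))⁻¹)
      (β * (-((ℓ + 1 : ℕ) * r ^ (ℓ + 1 - 1)) / (r ^ (ℓ + 1)) ^ 2)) r :=
    ((hasDerivAt_pow (ℓ + 1) r).fun_inv (by positivity)).const_mul β
  refine (h1.add h2).congr_deriv ?_
  have e : r * ((ℓ : ℝ) * r ^ (ℓ - 1)) = ℓ * r ^ ℓ := sin_mul_pow_pred ℓ r
  have e' : (ℓ : ℝ) * r ^ (ℓ - 1) = ℓ * r ^ ℓ / r := by
    rw [eq_div_iff hr.ne', mul_comm, e]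
  rw [e', eulerSol, Nat.add_sub_cancel]
  push_cast
  field_simp
  ring

lemma hasDerivAt_deriv_eulerSol (ℓ : ℕ) (α β : ℝ) {r : ℝ} (hr : 0 < r) :
    HasDerivAt (deriv (eulerSol ℓ α β))
      ((eulerSol ℓ (ℓ ^ 2 * α) ((ℓ + 1) ^ 2 * β) r
        - eulerSol ℓ (ℓ * α) (-((ℓ + 1) * β)) r) / r ^ 2) r := by
  have h : deriv (eulerSol ℓ α β) =ᶠ[𝓝 r]
      fun s => eulerSol ℓ (ℓ * α) (-((ℓ + 1) * β)) s / s := by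
    filter_upwards [Ioi_mem_nhds hr] with s hs
    exact (hasDerivAt_eulerSol ℓ α β hs).deriv
  refine HasDerivAt.congr_of_eventuallyEq ?_ h
  refine ((hasDerivAt_eulerSol ℓ (ℓ * α) (-((ℓ + 1) * β)) hr).div (hasDerivAt_id r)
    hr.ne').congr_deriv ?_
  simp only [eulerSol, id]
  field_simp

lemma contDiffOn_eulerSol (ℓ : ℕ) (α β : ℝ) {s : Set ℝ} (hs : s ⊆ Set.Ioi 0) :
    ContDiffOn ℝ 2 (eulerSol ℓ α β) s :=
  (contDiffOn_const.mul (contDiffOn_id.pow ℓ)).add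
    (contDiffOn_const.mul ((contDiffOn_id.pow (ℓ + 1)).inv
      fun r hr => by have : 0 < r := hs hr; simp only [id]; positivity))

/-- The product form `(r² R')' = r² R'' + 2 r R'` of the radial operator. -/
lemma deriv_sq_mul_deriv {R : ℝ → ℝ} {r R2 : ℝ} (h : HasDerivAt (deriv R) R2 r) :
    deriv (fun s => s ^ 2 * deriv R s) r = r ^ 2 * R2 + 2 * r * deriv R r := by
  have := ((hasDerivAt_pow 2 r).fun_mul h).deriv
  rw [this]
  norm_num
  ring

lemma radialEquation_eulerSol (ℓ : ℕ) (α β : ℝ) {s : Set ℝ} (hs : s ⊆ Set.Ioi 0) :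
    RadialEquation s ((ℓ : ℝ) * (ℓ + 1)) (eulerSol ℓ α β) where
  contDiffOn := contDiffOn_eulerSol ℓ α β hs
  ode r hr := by
    have hr0 : 0 < r := hs hr
    rw [deriv_sq_mul_deriv (hasDerivAt_deriv_eulerSol ℓ α β hr0),
      (hasDerivAt_eulerSol ℓ α β hr0).deriv]
    simp only [eulerSol]
    field_simp
    ring

/-- `c` agrees on `s` with a function of the form `α r^ℓ + β r^{-ℓ-1}`. -/
def IsEuler (ℓ : ℕ) (s : Set ℝ) (c : ℝ → ℝ) : Prop :=
  ∃ α β : ℝ, ∀ r ∈ s, c r = eulerSol ℓ α β r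

lemma IsEuler.congr {ℓ : ℕ} {s : Set ℝ} {c d : ℝ → ℝ} (h : IsEuler ℓ s c)
    (e : ∀ r ∈ s, d r = c r) : IsEuler ℓ s d := by
  obtain ⟨α, β, h⟩ := h
  exact ⟨α, β, fun r hr => (e r hr).trans (h r hr)⟩

lemma IsEuler.sum {ℓ : ℕ} {s : Set ℝ} {ι : Type*} (t : Finset ι) {c : ι → ℝ → ℝ}
    (h : ∀ i ∈ t, IsEuler ℓ s (c i)) : IsEuler ℓ s (fun r => ∑ i ∈ t, c i r) := by
  choose! α β hc using h
  refine ⟨∑ i ∈ t, α i, ∑ i ∈ t, β i, fun r hr => ?_⟩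
  refine (Finset.sum_congr rfl fun i hi => hc i hi r hr).trans ?_
  simp only [eulerSol, Finset.sum_add_distrib, Finset.sum_mul]

/-- The solution space is finite-dimensional, hence closed: a function which is approximated by
solutions on compact intervals is a solution. -/
lemma isEuler_of_approx {ℓ : ℕ} {I : Set ℝ} {c : ℝ → ℝ}
    (h : ∀ a ∈ I, ∀ b ∈ I, a ≤ b → ∀ δ > 0, ∃ α β : ℝ,
      ∀ r ∈ Set.Icc a b, |c r - eulerSol ℓ α β r| ≤ δ) : IsEuler ℓ I c := by
  let L : ℝ × ℝ →ₗ[ℝ] (I → ℝ) :=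
    { toFun := fun p r => eulerSol ℓ p.1 p.2 r
      map_add' := fun p q => by
        funext r
        simp only [eulerSol, Prod.fst_add, Prod.snd_add, Pi.add_apply]
        ring
      map_smul' := fun a p => by
        funext r
        simp only [eulerSol, Prod.smul_fst, Prod.smul_snd, Pi.smul_apply, smul_eq_mul,
          RingHom.id_apply]
        ring }
  have hcl : IsClosed (LinearMap.range L : Set (I → ℝ)) := Submodule.closed_of_finiteDimensional _
  have hmem : (fun r : I => c r) ∈ (LinearMap.range L : Set (I → ℝ)) := by
    rw [← hcl.closure_eq, mem_closure_iff_nhds]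
    intro t ht
    rw [nhds_pi, Filter.mem_pi] at ht
    obtain ⟨F, hF, u, hu, hut⟩ := ht
    have hδ : ∀ᶠ δ : ℝ in 𝓝[>] 0, ∀ r ∈ F, Metric.closedBall (c r) δ ⊆ u r := by
      rw [hF.eventually_all]
      intro r _
      obtain ⟨ε, hε, hεu⟩ := Metric.nhds_basis_closedBall.mem_iff.1 (hu r)
      filter_upwards [Ioc_mem_nhdsGT hε] with δ hδ
      exact (Metric.closedBall_subset_closedBall hδ.2).trans hεu
    obtain ⟨δ, hδF, hδ0⟩ := (hδ.and self_mem_nhdsWithin).exists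
    rcases F.eq_empty_or_nonempty with rfl | hne
    · exact ⟨0, hut (by simp), zero_mem _⟩
    obtain ⟨a, haF, ha⟩ := Set.exists_min_image F id hF hne
    obtain ⟨b, hbF, hb⟩ := Set.exists_max_image F id hF hne
    obtain ⟨α, β, hαβ⟩ := h a a.2 b b.2 (ha b hbF) δ hδ0
    refine ⟨L (α, β), hut fun r hr => hδF r hr ?_, LinearMap.mem_range_self L _⟩
    rw [Metric.mem_closedBall, dist_comm, Real.dist_eq]
    exact hαβ r ⟨ha r hr, hb r hr⟩
  obtain ⟨p, hp⟩ := hmem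
  exact ⟨p.1, p.2, fun r hr => (congrFun hp ⟨r, hr⟩).symm⟩

/-- Approximate solutions of the Euler–Cauchy equation are close to exact ones, with a constant
depending only on the interval and on `ℓ`. The function `W` below is the Wronskian with `r^ℓ`. -/
lemma exists_eulerSol_near (ℓ : ℕ) {a b : ℝ} (ha : 0 < a) (hab : a ≤ b) :
    ∃ K > 0, ∀ (f f' f'' : ℝ → ℝ) (δ : ℝ), (∀ r ∈ Set.Icc a b, HasDerivAt f (f' r) r) →
      (∀ r ∈ Set.Icc a b, HasDerivAt f' (f'' r) r) →
      (∀ r ∈ Set.Icc a b, |r ^ 2 * f'' r + 2 * r * f' r - (ℓ : ℝ) * (ℓ + 1) * f r| ≤ δ) →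
      ∃ α β : ℝ, ∀ r ∈ Set.Icc a b, |f r - eulerSol ℓ α β r| ≤ K * δ := by
  refine ⟨b ^ ℓ * (b ^ ℓ * (b - a) / a ^ (2 * ℓ + 2) * (b - a)) + 1, ?_, ?_⟩
  · have : 0 ≤ b - a := sub_nonneg.2 hab
    have hb : 0 < b := ha.trans_le hab
    positivity
  intro f f' f'' δ hf hf' hδ
  have hb : 0 < b := ha.trans_le hab
  have hab' : 0 ≤ b - a := sub_nonneg.2 hab
  have haI : a ∈ Set.Icc a b := Set.left_mem_Icc.2 hab
  have hδ0 : 0 ≤ δ := (abs_nonneg _).trans (hδ a haI)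
  set W : ℝ → ℝ := fun r => r ^ (ℓ + 2) * f' r - ℓ * r ^ (ℓ + 1) * f r with hW
  have hWd : ∀ r ∈ Set.Icc a b, HasDerivAt W
      (r ^ ℓ * (r ^ 2 * f'' r + 2 * r * f' r - (ℓ : ℝ) * (ℓ + 1) * f r)) r := by
    intro r hr
    refine (((hasDerivAt_pow (ℓ + 2) r).mul (hf' r hr)).sub
      (((hasDerivAt_pow (ℓ + 1) r).const_mul (ℓ : ℝ)).mul (hf r hr))).congr_deriv ?_
    simp only [Nat.add_sub_cancel, show ℓ + 2 - 1 = ℓ + 1 from rfl, pow_succ]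
    push_cast
    ring
  have hWb : ∀ r ∈ Set.Icc a b, |W r - W a| ≤ b ^ ℓ * δ * (b - a) := by
    intro r hr
    have h1 := (convex_Icc a b).norm_image_sub_le_of_norm_hasDerivWithin_le
      (C := b ^ ℓ * δ) (fun x hx => (hWd x hx).hasDerivWithinAt) (fun x hx => by
        have hx0 : 0 < x := ha.trans_le hx.1
        rw [norm_mul, Real.norm_eq_abs, Real.norm_eq_abs, abs_of_pos (pow_pos hx0 ℓ)]
        exact mul_le_mul (pow_le_pow_left₀ hx0.le hx.2 ℓ) (hδ x hx) (abs_nonneg _)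
          (by positivity)) haI hr
    refine h1.trans ?_
    rw [Real.norm_eq_abs, abs_of_nonneg (by linarith [hr.1])]
    exact mul_le_mul_of_nonneg_left (by linarith [hr.2]) (by positivity)
  set g : ℝ → ℝ := fun r => f r * (r ^ ℓ)⁻¹ + W a / (2 * ℓ + 1) * (r ^ (2 * ℓ + 1))⁻¹ with hg
  have hgd : ∀ r ∈ Set.Icc a b, HasDerivAt g ((W r - W a) / r ^ (2 * ℓ + 2)) r := by
    intro r hr
    have hr0 : 0 < r := ha.trans_le hr.1
    have h1 := (hf r hr).fun_mul ((hasDerivAt_pow ℓ r).fun_inv (by positivity))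
    have h2 := ((hasDerivAt_pow (2 * ℓ + 1) r).fun_inv (by positivity)).const_mul
      (W a / (2 * ℓ + 1))
    refine (h1.add h2).congr_deriv ?_
    have e : r * ((ℓ : ℝ) * r ^ (ℓ - 1)) = ℓ * r ^ ℓ := sin_mul_pow_pred ℓ r
    have e' : (ℓ : ℝ) * r ^ (ℓ - 1) = ℓ * r ^ ℓ / r := by
      rw [eq_div_iff hr0.ne', mul_comm, e]
    have e3 : (2 * (ℓ : ℝ) + 1) ≠ 0 := by positivity
    rw [e', Nat.add_sub_cancel]
    simp only [hW]
    push_cast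
    field_simp
    ring
  refine ⟨g a, -(W a / (2 * ℓ + 1)), fun r hr => ?_⟩
  have hr0 : 0 < r := ha.trans_le hr.1
  have h1 := (convex_Icc a b).norm_image_sub_le_of_norm_hasDerivWithin_le
      (C := b ^ ℓ * δ * (b - a) / a ^ (2 * ℓ + 2))
      (fun x hx => (hgd x hx).hasDerivWithinAt) (fun x hx => by
        have hx0 : 0 < x := ha.trans_le hx.1
        rw [norm_div, Real.norm_eq_abs, Real.norm_eq_abs, abs_of_pos (pow_pos hx0 _)]
        exact div_le_div₀ (by positivity) (hWb x hx) (by positivity)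
          (pow_le_pow_left₀ ha.le hx.1 _)) haI hr
  have h2 : |g r - g a| ≤ b ^ ℓ * δ * (b - a) / a ^ (2 * ℓ + 2) * (b - a) := by
    refine h1.trans ?_
    rw [Real.norm_eq_abs, abs_of_nonneg (by linarith [hr.1])]
    exact mul_le_mul_of_nonneg_left (by linarith [hr.2]) (by positivity)
  have h3 : f r - eulerSol ℓ (g a) (-(W a / (2 * ℓ + 1))) r = r ^ ℓ * (g r - g a) := by
    have e : g r = f r * (r ^ ℓ)⁻¹ + W a / (2 * ℓ + 1) * (r ^ (2 * ℓ + 1))⁻¹ := rfl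
    have e3 : (2 * (ℓ : ℝ) + 1) ≠ 0 := by positivity
    rw [e]
    generalize g a = x
    generalize W a = y
    simp only [eulerSol]
    field_simp
    ring
  rw [h3, abs_mul, abs_of_pos (pow_pos hr0 ℓ)]
  calc r ^ ℓ * |g r - g a|
      ≤ b ^ ℓ * (b ^ ℓ * δ * (b - a) / a ^ (2 * ℓ + 2) * (b - a)) := by
        gcongr
        exact hr.2
    _ = b ^ ℓ * (b ^ ℓ * (b - a) / a ^ (2 * ℓ + 2) * (b - a)) * δ := by ring
    _ ≤ _ := by
      rw [add_mul, one_mul]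
      linarith

lemma abs_eulerSol_mul_le (ℓ : ℕ) {α β x y r M : ℝ} (hr : 0 < r) (hx : |x| ≤ M) (hy : |y| ≤ M) :
    |eulerSol ℓ (x * α) (y * β) r| ≤ M * (|α| * r ^ ℓ + |β| * (r ^ (ℓ + 1))⁻¹) := by
  have h1 : |x * α * r ^ ℓ| ≤ M * (|α| * r ^ ℓ) := by
    rw [abs_mul, abs_mul, abs_of_pos (pow_pos hr ℓ), mul_assoc]
    gcongr
  have h2 : |y * β * (r ^ (ℓ + 1))⁻¹| ≤ M * (|β| * (r ^ (ℓ + 1))⁻¹) := by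
    rw [abs_mul, abs_mul, abs_of_pos (inv_pos.2 (pow_pos hr (ℓ + 1))), mul_assoc]
    gcongr
  rw [mul_add]
  exact (abs_add_le _ _).trans (add_le_add h1 h2)

/-- Both coefficients are controlled by the values at two radii. -/
lemma abs_coeff_le {ℓ : ℕ} {α β a b B : ℝ} (ha : 0 < a) (hab : a < b)
    (h1 : |eulerSol ℓ α β a| ≤ B) (h2 : |eulerSol ℓ α β b| ≤ B) :
    |α| * b ^ ℓ ≤ 2 / (1 - a / b) * B ∧ |β| * (a ^ (ℓ + 1))⁻¹ ≤ 2 / (1 - a / b) * B := by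
  have hb : 0 < b := ha.trans hab
  set t := a / b with ht
  have ht0 : 0 < t := by positivity
  have ht1 : t < 1 := (div_lt_one hb).2 hab
  have hB : 0 ≤ B := (abs_nonneg _).trans h1
  have hpow : t ^ (2 * ℓ + 1) ≤ t := by
    calc t ^ (2 * ℓ + 1) ≤ t ^ 1 := pow_le_pow_of_le_one ht0.le ht1.le (by omega)
      _ = t := pow_one t
  have e1 : eulerSol ℓ α β b - t ^ (ℓ + 1) * eulerSol ℓ α β a
      = (α * b ^ ℓ) * (1 - t ^ (2 * ℓ + 1)) := by
    rw [ht]; simp only [eulerSol, div_pow]; field_simp; ring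
  have e2 : eulerSol ℓ α β a - t ^ ℓ * eulerSol ℓ α β b
      = (β * (a ^ (ℓ + 1))⁻¹) * (1 - t ^ (2 * ℓ + 1)) := by
    rw [ht]; simp only [eulerSol, div_pow]; field_simp; ring
  have key : ∀ (x y A : ℝ) (n : ℕ), |x| ≤ B → |y| ≤ B →
      x - t ^ n * y = A * (1 - t ^ (2 * ℓ + 1)) → |A| ≤ 2 / (1 - t) * B := by
    intro x y A n hx hy h
    have h3 : |A| * (1 - t ^ (2 * ℓ + 1)) ≤ 2 * B := by
      have : |A * (1 - t ^ (2 * ℓ + 1))| = |A| * (1 - t ^ (2 * ℓ + 1)) := by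
        rw [abs_mul, abs_of_nonneg (sub_nonneg.2 (hpow.trans ht1.le))]
      rw [← this, ← h]
      have h4 : |t ^ n * y| ≤ B := by
        rw [abs_mul, abs_of_pos (pow_pos ht0 n)]
        calc t ^ n * |y| ≤ 1 * B := by
              gcongr
              exact pow_le_one₀ ht0.le ht1.le
          _ = B := one_mul B
      linarith [abs_sub x (t ^ n * y)]
    rw [div_mul_eq_mul_div, le_div_iff₀ (by linarith)]
    nlinarith [abs_nonneg A]
  have h3 := key _ _ _ _ h2 h1 e1
  have h4 := key _ _ _ _ h1 h2 e2
  rw [abs_mul, abs_of_pos (pow_pos hb ℓ)] at h3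
  rw [abs_mul, abs_of_pos (inv_pos.2 (pow_pos ha (ℓ + 1)))] at h4
  exact ⟨h3, h4⟩

/-- Geometric decay: a solution of degree `ℓ` bounded by `B` at the radii `a < b` is, together with
its first two derivatives, of size `B ℓ² ρ^ℓ` with `ρ < 1` on any smaller interval. -/
lemma eulerSol_bounds {a a' b' b : ℝ} (ha : 0 < a) (haa : a < a') (hab : a' ≤ b') (hbb : b' < b) :
    ∃ C ρ : ℝ, 0 ≤ C ∧ 0 ≤ ρ ∧ ρ < 1 ∧ ∀ (ℓ : ℕ) (α β B : ℝ), |eulerSol ℓ α β a| ≤ B →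
      |eulerSol ℓ α β b| ≤ B → ∀ r ∈ Set.Icc a' b',
        |eulerSol ℓ α β r| ≤ C * (B * ((ℓ : ℝ) + 1) ^ 2 * ρ ^ ℓ) ∧
        |deriv (eulerSol ℓ α β) r| ≤ C * (B * ((ℓ : ℝ) + 1) ^ 2 * ρ ^ ℓ) ∧
        |deriv (deriv (eulerSol ℓ α β)) r| ≤ C * (B * ((ℓ : ℝ) + 1) ^ 2 * ρ ^ ℓ) := by
  have ha' : 0 < a' := ha.trans haa
  have hb' : 0 < b' := ha'.trans_le hab
  have hb : 0 < b := hb'.trans hbb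
  have hlt : a < b := by linarith
  have ht1 : a / b < 1 := (div_lt_one hb).2 hlt
  set C0 := 2 / (1 - a / b) with hC0
  have hC0p : 0 ≤ C0 := by
    have : 0 < 1 - a / b := by linarith
    positivity
  set ρ := max (b' / b) (a / a') with hρ
  have hρ0 : 0 ≤ ρ := le_max_of_le_left (by positivity)
  have hρ1 : ρ < 1 := max_lt ((div_lt_one hb).2 hbb) ((div_lt_one ha').2 haa)
  refine ⟨2 * C0 * (1 + 1 / a' + 2 / a' ^ 2), ρ, by positivity, hρ0, hρ1, ?_⟩
  intro ℓ α β B h1 h2 r hr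
  have hr0 : 0 < r := ha'.trans_le hr.1
  have hB : 0 ≤ B := (abs_nonneg _).trans h1
  obtain ⟨hα, hβ⟩ := abs_coeff_le ha hlt h1 h2
  rw [← hC0] at hα hβ
  set S := |α| * r ^ ℓ + |β| * (r ^ (ℓ + 1))⁻¹ with hS
  have hSb : S ≤ 2 * C0 * (B * ρ ^ ℓ) := by
    have e1 : |α| * r ^ ℓ = |α| * b ^ ℓ * (r / b) ^ ℓ := by
      rw [div_pow]; field_simp
    have e2 : |β| * (r ^ (ℓ + 1))⁻¹ = |β| * (a ^ (ℓ + 1))⁻¹ * (a / r) ^ (ℓ + 1) := by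
      rw [div_pow]; field_simp
    have h3 : (r / b) ^ ℓ ≤ ρ ^ ℓ := by
      refine pow_le_pow_left₀ (by positivity) (le_max_of_le_left ?_) ℓ
      exact div_le_div_of_nonneg_right hr.2 hb.le
    have h4 : (a / r) ^ (ℓ + 1) ≤ ρ ^ ℓ := by
      have h5 : a / r ≤ ρ := le_max_of_le_right (div_le_div_of_nonneg_left ha.le ha' hr.1)
      calc (a / r) ^ (ℓ + 1) ≤ ρ ^ (ℓ + 1) := pow_le_pow_left₀ (by positivity) h5 _
        _ ≤ ρ ^ ℓ := pow_le_pow_of_le_one hρ0 hρ1.le (by omega)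
    have h6 : |α| * r ^ ℓ ≤ C0 * B * ρ ^ ℓ := by
      rw [e1]; exact mul_le_mul hα h3 (by positivity) (by positivity)
    have h7 : |β| * (r ^ (ℓ + 1))⁻¹ ≤ C0 * B * ρ ^ ℓ := by
      rw [e2]; exact mul_le_mul hβ h4 (by positivity) (by positivity)
    linarith
  have hS0 : 0 ≤ S := by positivity
  have hl : (0 : ℝ) ≤ ℓ := Nat.cast_nonneg ℓ
  have hL1 : (1 : ℝ) ≤ ((ℓ : ℝ) + 1) ^ 2 := by nlinarith
  have hLl : (ℓ : ℝ) + 1 ≤ ((ℓ : ℝ) + 1) ^ 2 := by nlinarith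
  set L := ((ℓ : ℝ) + 1) ^ 2 with hL
  have hTS : ∀ k : ℝ, 0 ≤ k → k ≤ 1 + 1 / a' + 2 / a' ^ 2 → ∀ x : ℝ, x ≤ k * (L * S) →
      x ≤ 2 * C0 * (1 + 1 / a' + 2 / a' ^ 2) * (B * L * ρ ^ ℓ) := by
    intro k hk0 hk x hx
    calc x ≤ k * (L * S) := hx
      _ ≤ (1 + 1 / a' + 2 / a' ^ 2) * (L * (2 * C0 * (B * ρ ^ ℓ))) := by gcongr
      _ = _ := by ring
  have hp1 : 0 ≤ 1 / a' := by positivity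
  have hp2 : 0 ≤ 2 / a' ^ 2 := by positivity
  have g0 : |eulerSol ℓ α β r| ≤ L * S := by
    have := abs_eulerSol_mul_le ℓ (α := α) (β := β) (x := 1) (y := 1) hr0 (M := L)
      (by simpa using hL1) (by simpa using hL1)
    simpa using this
  have g1 : |eulerSol ℓ (ℓ * α) (-((ℓ + 1) * β)) r| ≤ L * S := by
    have := abs_eulerSol_mul_le ℓ (α := α) (β := β) (x := ℓ) (y := -(ℓ + 1)) hr0 (M := L)
      (by rw [abs_of_nonneg hl]; linarith) (by rw [abs_neg, abs_of_nonneg (by linarith)]; linarith)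
    rwa [neg_mul] at this
  have g2 : |eulerSol ℓ (ℓ ^ 2 * α) ((ℓ + 1) ^ 2 * β) r| ≤ L * S := by
    refine abs_eulerSol_mul_le ℓ hr0 ?_ ?_
    · rw [abs_of_nonneg (by positivity)]; nlinarith
    · rw [abs_of_nonneg (by positivity)]
  have hi : 1 / r ≤ 1 / a' := one_div_le_one_div_of_le ha' hr.1
  have hi2 : 1 / r ^ 2 ≤ 1 / a' ^ 2 :=
    one_div_le_one_div_of_le (by positivity) (pow_le_pow_left₀ ha'.le hr.1 2)
  refine ⟨hTS 1 zero_le_one (by linarith) _ (by linarith), hTS (1 / a') hp1 (by linarith) _ ?_,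
    hTS (2 / a' ^ 2) hp2 (by linarith) _ ?_⟩
  · rw [(hasDerivAt_eulerSol ℓ α β hr0).deriv, abs_div, abs_of_pos hr0, div_eq_mul_one_div,
      mul_comm]
    gcongr
  · rw [(hasDerivAt_deriv_eulerSol ℓ α β hr0).deriv, abs_div, abs_of_pos (pow_pos hr0 2),
      div_eq_mul_one_div, mul_comm]
    have h3 := (abs_sub (eulerSol ℓ (ℓ ^ 2 * α) ((ℓ + 1) ^ 2 * β) r)
      (eulerSol ℓ (ℓ * α) (-((ℓ + 1) * β)) r)).trans (add_le_add g2 g1)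
    calc _ ≤ 1 / a' ^ 2 * (L * S + L * S) := by gcongr
      _ = _ := by ring

/-! ### The spherical Laplacian in terms of total derivatives -/

lemma isOpen_openShell {I : Set ℝ} (hI : IsOpen I) : IsOpen (openShell I) :=
  hI.prod (isOpen_Ioo.prod isOpen_univ)

lemma openShell_subset_closedShell (I : Set ℝ) : openShell I ⊆ closedShell I :=
  Set.prod_mono le_rfl (Set.prod_mono Set.Ioo_subset_Icc_self le_rfl)

/-- The value at `(r, θ)` of `r²` times the spherical Laplacian of a function with first and second
derivatives `A` and `B`. -/
def lapForm (r θ : ℝ) (A : ℝ × ℝ × ℝ →L[ℝ] ℝ) (B : ℝ × ℝ × ℝ →L[ℝ] ℝ × ℝ × ℝ →L[ℝ] ℝ) : ℝ :=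
  (r ^ 2 * B (1, 0, 0) (1, 0, 0) + 2 * r * A (1, 0, 0))
    + (B (0, 1, 0) (0, 1, 0) + Real.cos θ / Real.sin θ * A (0, 1, 0))
    + B (0, 0, 1) (0, 0, 1) / Real.sin θ ^ 2

section slices

variable {F' : ℝ × ℝ × ℝ → ℝ × ℝ × ℝ →L[ℝ] ℝ}
  {B : ℝ × ℝ × ℝ →L[ℝ] ℝ × ℝ × ℝ →L[ℝ] ℝ} {E : Type*} [NormedAddCommGroup E] [NormedSpace ℝ E]
  {F : ℝ × ℝ × ℝ → E} {A : ℝ × ℝ × ℝ →L[ℝ] E} {r θ φ : ℝ}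

lemma hasDerivAt_slice_fst (h : HasFDerivAt F A (r, θ, φ)) :
    HasDerivAt (fun t => F (t, θ, φ)) (A (1, 0, 0)) r :=
  h.comp_hasDerivAt (f := fun t : ℝ => (t, θ, φ)) r
    ((hasDerivAt_id r).prodMk ((hasDerivAt_const r θ).prodMk (hasDerivAt_const r φ)))

lemma hasDerivAt_slice_snd (h : HasFDerivAt F A (r, θ, φ)) :
    HasDerivAt (fun t => F (r, t, φ)) (A (0, 1, 0)) θ :=
  h.comp_hasDerivAt (f := fun t : ℝ => (r, t, φ)) θ
    ((hasDerivAt_const θ r).prodMk ((hasDerivAt_id θ).prodMk (hasDerivAt_const θ φ)))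

lemma hasDerivAt_slice_thd (h : HasFDerivAt F A (r, θ, φ)) :
    HasDerivAt (fun t => F (r, θ, t)) (A (0, 0, 1)) φ :=
  h.comp_hasDerivAt (f := fun t : ℝ => (r, θ, t)) φ
    ((hasDerivAt_const φ r).prodMk ((hasDerivAt_const φ θ).prodMk (hasDerivAt_id φ)))

end slices

lemma HasDerivAt.clm_eval {G : ℝ → ℝ × ℝ × ℝ →L[ℝ] ℝ} {G' : ℝ × ℝ × ℝ →L[ℝ] ℝ} {t : ℝ}
    (h : HasDerivAt G G' t) (v : ℝ × ℝ × ℝ) : HasDerivAt (fun s => G s v) (G' v) t := by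
  simpa using h.clm_apply (hasDerivAt_const t v)

/-- `sphericalLaplacian` computed from total derivatives. -/
lemma sphericalLaplacian_eq_lapForm {O : Set (ℝ × ℝ × ℝ)} (hO : IsOpen O)
    {U : ℝ → ℝ → ℝ → ℝ} {F' : ℝ × ℝ × ℝ → ℝ × ℝ × ℝ →L[ℝ] ℝ}
    {F'' : ℝ × ℝ × ℝ → ℝ × ℝ × ℝ →L[ℝ] ℝ × ℝ × ℝ →L[ℝ] ℝ}
    (h1 : ∀ p ∈ O, HasFDerivAt (fun p : ℝ × ℝ × ℝ => U p.1 p.2.1 p.2.2) (F' p) p)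
    (h2 : ∀ p ∈ O, HasFDerivAt F' (F'' p) p) {r θ φ : ℝ} (hp : (r, θ, φ) ∈ O) (hr : r ≠ 0)
    (hs : Real.sin θ ≠ 0) :
    sphericalLaplacian U r θ φ = lapForm r θ (F' (r, θ, φ)) (F'' (r, θ, φ)) / r ^ 2 := by
  have hO' : ∀ᶠ p in 𝓝 (r, θ, φ), p ∈ O := hO.mem_nhds hp
  have c1 : Tendsto (fun t : ℝ => (t, θ, φ)) (𝓝 r) (𝓝 (r, θ, φ)) :=
    Continuous.tendsto' (by fun_prop) _ _ rfl
  have c2 : Tendsto (fun t : ℝ => (r, t, φ)) (𝓝 θ) (𝓝 (r, θ, φ)) :=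
    Continuous.tendsto' (by fun_prop) _ _ rfl
  have c3 : Tendsto (fun t : ℝ => (r, θ, t)) (𝓝 φ) (𝓝 (r, θ, φ)) :=
    Continuous.tendsto' (by fun_prop) _ _ rfl
  have e1 : (fun s => s ^ 2 * deriv (fun t => U t θ φ) s)
      =ᶠ[𝓝 r] fun s => s ^ 2 * F' (s, θ, φ) (1, 0, 0) := by
    filter_upwards [c1.eventually hO'] with s hs
    rw [(hasDerivAt_slice_fst (h1 _ hs)).deriv]
  have e2 : (fun t => Real.sin t * deriv (fun τ => U r τ φ) t)
      =ᶠ[𝓝 θ] fun s => Real.sin s * F' (r, s, φ) (0, 1, 0) := by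
    filter_upwards [c2.eventually hO'] with s hs
    rw [(hasDerivAt_slice_snd (h1 _ hs)).deriv]
  have e3 : deriv (fun ψ => U r θ ψ) =ᶠ[𝓝 φ] fun s => F' (r, θ, s) (0, 0, 1) := by
    filter_upwards [c3.eventually hO'] with s hs
    exact (hasDerivAt_slice_thd (h1 _ hs)).deriv
  have d1 := (((hasDerivAt_pow 2 r).fun_mul
    ((hasDerivAt_slice_fst (h2 _ hp)).clm_eval (1, 0, 0))).congr_of_eventuallyEq e1).deriv
  have d2 := (((Real.hasDerivAt_sin θ).fun_mul
    ((hasDerivAt_slice_snd (h2 _ hp)).clm_eval (0, 1, 0))).congr_of_eventuallyEq e2).deriv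
  have d3 := (((hasDerivAt_slice_thd (h2 _ hp)).clm_eval (0, 0, 1)).congr_of_eventuallyEq e3).deriv
  rw [sphericalLaplacian, iteratedDeriv_succ, iteratedDeriv_one, d1, d2, d3, lapForm]
  norm_num
  field_simp
  ring

/-- A `C²` function on an open set has total derivatives of order one and two there. -/
lemma contDiffOn_two_fderiv {E : Type*} [NormedAddCommGroup E] [NormedSpace ℝ E] {O : Set E}
    (hO : IsOpen O) {F : E → ℝ} (hF : ContDiffOn ℝ 2 F O) :
    (∀ p ∈ O, HasFDerivAt F (fderiv ℝ F p) p) ∧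
    (∀ p ∈ O, HasFDerivAt (fderiv ℝ F) (fderiv ℝ (fderiv ℝ F) p) p) ∧
    ContinuousOn (fderiv ℝ F) O ∧ ContinuousOn (fderiv ℝ (fderiv ℝ F)) O := by
  have h1 : ContDiffOn ℝ 1 (fderiv ℝ F) O := hF.fderiv_of_isOpen hO (by norm_num)
  have h2 : ContDiffOn ℝ 0 (fderiv ℝ (fderiv ℝ F)) O := h1.fderiv_of_isOpen hO (by norm_num)
  exact ⟨fun p hp => ((hF.differentiableOn (by norm_num)).differentiableAt
      (hO.mem_nhds hp)).hasFDerivAt,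
    fun p hp => ((h1.differentiableOn (by norm_num)).differentiableAt
      (hO.mem_nhds hp)).hasFDerivAt, h1.continuousOn, h2.continuousOn⟩

/-! ### Angular averages of solutions -/

/-- Differentiation under the integral over a compact set. -/
lemma hasDerivAt_setIntegral_param {K : Set (ℝ × ℝ)} (hK : IsCompact K) {J : Set ℝ}
    (hJ : IsOpen J) {G G' : ℝ → ℝ × ℝ → ℝ}
    (hG : ContinuousOn (fun p : ℝ × ℝ × ℝ => G p.1 p.2) (J ×ˢ K))
    (hG' : ContinuousOn (fun p : ℝ × ℝ × ℝ => G' p.1 p.2) (J ×ˢ K))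
    (h : ∀ r ∈ J, ∀ q ∈ K, HasDerivAt (fun s => G s q) (G' r q) r) {r : ℝ} (hr : r ∈ J) :
    HasDerivAt (fun s => ∫ q in K, G s q) (∫ q in K, G' r q) r := by
  obtain ⟨ε, hε, hεJ⟩ := Metric.nhds_basis_closedBall.mem_iff.1 (hJ.mem_nhds hr)
  obtain ⟨C, hC⟩ := ((isCompact_closedBall r ε).prod hK).exists_bound_of_continuousOn
    (hG'.mono (Set.prod_mono_left hεJ))
  have slice : ∀ {g : ℝ → ℝ × ℝ → ℝ}, ContinuousOn (fun p : ℝ × ℝ × ℝ => g p.1 p.2) (J ×ˢ K) →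
      ∀ s ∈ J, ContinuousOn (g s) K := fun hg s hs =>
    hg.comp (f := fun q : ℝ × ℝ => (s, q)) (by fun_prop) fun q hq => ⟨hs, hq⟩
  have hm : ∀ {g : ℝ → ℝ × ℝ → ℝ}, ContinuousOn (fun p : ℝ × ℝ × ℝ => g p.1 p.2) (J ×ˢ K) →
      ∀ s ∈ J, MeasureTheory.IntegrableOn (g s) K := fun hg s hs =>
    (slice hg s hs).integrableOn_compact hK
  refine (hasDerivAt_integral_of_dominated_loc_of_deriv_le (F := G) (F' := G')
    (bound := fun _ => C) (Metric.closedBall_mem_nhds r hε) ?_ (hm hG r hr)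
    (hm hG' r hr).aestronglyMeasurable ?_ ?_ ?_).2
  · filter_upwards [hJ.mem_nhds hr] with s hs using (hm hG s hs).aestronglyMeasurable
  · filter_upwards [MeasureTheory.ae_restrict_mem hK.measurableSet] with q hq s hs
    exact hC (s, q) ⟨hs, hq⟩
  · exact MeasureTheory.integrableOn_const hK.measure_lt_top.ne
  · filter_upwards [MeasureTheory.ae_restrict_mem hK.measurableSet] with q hq s hs
    exact h s (hεJ hs) q hq

/-- Green's formula in the polar angle, for a weight `w` which vanishes to first order at the
endpoints. -/
lemma green_polar {A B : ℝ} (hAB : A ≤ B) {u u1 u2 w w1 v : ℝ → ℝ}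
    (hu : ∀ θ ∈ Set.Icc A B, HasDerivAt u (u1 θ) θ)
    (hu1 : ∀ θ ∈ Set.Icc A B, HasDerivAt u1 (u2 θ) θ) (hu2 : ContinuousOn u2 (Set.Icc A B))
    (hw : ∀ θ ∈ Set.Icc A B, HasDerivAt w (w1 θ) θ)
    (hv : ∀ θ ∈ Set.Icc A B, HasDerivAt (fun t => Real.sin t * w1 t) (v θ) θ)
    (hvc : ContinuousOn v (Set.Icc A B)) (hwA : w A = 0) (hwB : w B = 0) (hwA1 : w1 A = 0)
    (hwB1 : w1 B = 0) :
    ∫ θ in A..B, (Real.sin θ * u2 θ + Real.cos θ * u1 θ) * w θ = ∫ θ in A..B, u θ * v θ := by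
  have hi : Set.uIcc A B = Set.Icc A B := Set.uIcc_of_le hAB
  have huc : ContinuousOn u (Set.Icc A B) := fun t ht => (hu t ht).continuousAt.continuousWithinAt
  have hu1c : ContinuousOn u1 (Set.Icc A B) :=
    fun t ht => (hu1 t ht).continuousAt.continuousWithinAt
  have hwc : ContinuousOn w (Set.Icc A B) := fun t ht => (hw t ht).continuousAt.continuousWithinAt
  have i1 : IntervalIntegrable (fun θ => (Real.sin θ * u2 θ + Real.cos θ * u1 θ) * w θ)
      MeasureTheory.volume A B := by
    apply ContinuousOn.intervalIntegrable
    rw [hi]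
    exact ((Real.continuous_sin.continuousOn.mul hu2).add
      (Real.continuous_cos.continuousOn.mul hu1c)).mul hwc
  have i2 : IntervalIntegrable (fun θ => u θ * v θ) MeasureTheory.volume A B := by
    apply ContinuousOn.intervalIntegrable
    rw [hi]
    exact huc.mul hvc
  rw [← sub_eq_zero, ← intervalIntegral.integral_sub i1 i2]
  rw [intervalIntegral.integral_eq_sub_of_hasDerivAt
    (f := fun t => (Real.sin t * u1 t) * w t - u t * (Real.sin t * w1 t)) ?_ (i1.sub i2)]
  · simp [hwA, hwB, hwA1, hwB1]
  · intro θ hθ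
    rw [hi] at hθ
    refine (((((Real.hasDerivAt_sin θ).mul (hu1 θ hθ)).mul (hw θ hθ))).sub
      ((hu θ hθ).mul (hv θ hθ))).congr_deriv ?_
    simp only [Pi.mul_apply]
    ring

/-- Green's formula in the azimuth. -/
lemma green_azimuth (m : ℤ) {u u1 u2 : ℝ → ℝ} (hu : ∀ φ, HasDerivAt u (u1 φ) φ)
    (hu1 : ∀ φ, HasDerivAt u1 (u2 φ) φ) (hu2 : Continuous u2)
    (hp : ∀ φ, u (φ + 2 * Real.pi) = u φ) :
    ∫ φ in (0 : ℝ)..2 * Real.pi, u2 φ * cas m φ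
      = -(m : ℝ) ^ 2 * ∫ φ in (0 : ℝ)..2 * Real.pi, u φ * cas m φ := by
  have huc : Continuous u := continuous_iff_continuousAt.2 fun t => (hu t).continuousAt
  have i1 : IntervalIntegrable (fun φ => u2 φ * cas m φ) MeasureTheory.volume 0 (2 * Real.pi) :=
    (hu2.mul (continuous_cas m)).intervalIntegrable _ _
  have i2 : IntervalIntegrable (fun φ => -(m : ℝ) ^ 2 * (u φ * cas m φ)) MeasureTheory.volume
      0 (2 * Real.pi) := (continuous_const.mul (huc.mul (continuous_cas m))).intervalIntegrable _ _
  rw [← intervalIntegral.integral_const_mul, ← sub_eq_zero, ← intervalIntegral.integral_sub i1 i2]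
  rw [intervalIntegral.integral_eq_sub_of_hasDerivAt
    (f := fun t => u1 t * cas m t - u t * deriv (cas m) t) ?_ (i1.sub i2)]
  · have hp1 : u1 (2 * Real.pi) = u1 0 := by
      have h1 : HasDerivAt (fun t => u (t + 2 * Real.pi)) (u1 (0 + 2 * Real.pi)) 0 :=
        (hu (0 + 2 * Real.pi)).comp_add_const 0 _
      rw [funext hp, zero_add] at h1
      exact h1.unique (hu 0)
    have hp0 : u (2 * Real.pi) = u 0 := by simpa using hp 0
    have hc0 : cas m (2 * Real.pi) = cas m 0 := by simpa using cas_periodic m 0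
    have hc1 : cas (-m) (2 * Real.pi) = cas (-m) 0 := by simpa using cas_periodic (-m) 0
    simp only [hp1, hp0, hc0, deriv_cas, hc1, sub_self]
  · intro φ _
    refine (((hu1 φ).mul (hasDerivAt_cas m φ)).sub
      ((hu φ).mul (hasDerivAt_deriv_cas m φ))).congr_deriv ?_
    rw [deriv_cas]
    ring

/-- The average of a solution against `w(θ) cas (mφ)`, with `w` supported away from the poles,
solves an inhomogeneous radial equation. -/
lemma radial_equation_average {I : Set ℝ} (hI : IsOpen I) (hpos : I ⊆ Set.Ioi 0)
    {U : ℝ → ℝ → ℝ → ℝ} (hU : IsLaplaceSolution I U) (m : ℤ) {A B : ℝ} (hA : 0 < A) (hAB : A ≤ B)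
    (hB : B < Real.pi) {w w1 v : ℝ → ℝ}
    (hw : ∀ θ ∈ Set.Icc A B, HasDerivAt w (w1 θ) θ)
    (hv : ∀ θ ∈ Set.Icc A B, HasDerivAt (fun t => Real.sin t * w1 t) (v θ) θ)
    (hvc : ContinuousOn v (Set.Icc A B)) (hwA : w A = 0) (hwB : w B = 0) (hwA1 : w1 A = 0)
    (hwB1 : w1 B = 0) :
    ∃ c' c'' : ℝ → ℝ,
      (∀ r ∈ I, HasDerivAt (fun r => ∫ q in Set.Icc A B ×ˢ Set.Icc 0 (2 * Real.pi),
        U r q.1 q.2 * (w q.1 * cas m q.2 * Real.sin q.1)) (c' r) r) ∧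
      (∀ r ∈ I, HasDerivAt c' (c'' r) r) ∧
      (∀ r ∈ I, r ^ 2 * c'' r + 2 * r * c' r
        = -∫ q in Set.Icc A B ×ˢ Set.Icc 0 (2 * Real.pi),
          U r q.1 q.2 * ((v q.1 - m ^ 2 * w q.1 / Real.sin q.1) * cas m q.2)) := by
  set F : ℝ × ℝ × ℝ → ℝ := fun p => U p.1 p.2.1 p.2.2 with hF
  set K : Set (ℝ × ℝ) := Set.Icc A B ×ˢ Set.Icc 0 (2 * Real.pi) with hKdef
  have hK : IsCompact K := isCompact_Icc.prod isCompact_Icc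
  have hsub : Set.Icc A B ⊆ Set.Ioo 0 Real.pi := fun t ht => ⟨hA.trans_le ht.1, ht.2.trans_lt hB⟩
  have hO := isOpen_openShell hI
  obtain ⟨h1, h2, c1, c2⟩ := contDiffOn_two_fderiv hO hU.contDiffOn
  set D1 := fderiv ℝ F with hD1
  set D2 := fderiv ℝ (fderiv ℝ F) with hD2
  have hmem : ∀ r ∈ I, ∀ θ ∈ Set.Icc A B, ∀ φ : ℝ, (r, θ, φ) ∈ openShell I :=
    fun r hr θ hθ φ => ⟨hr, hsub hθ, trivial⟩
  have hIK : I ×ˢ K ⊆ openShell I := fun p hp => ⟨hp.1, hsub hp.2.1, trivial⟩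
  have hwc : ContinuousOn w (Set.Icc A B) := fun t ht => (hw t ht).continuousAt.continuousWithinAt
  have hsinne : ∀ θ ∈ Set.Icc A B, Real.sin θ ≠ 0 :=
    fun θ hθ => (Real.sin_pos_of_mem_Ioo (hsub hθ)).ne'
  have cont1 : ∀ e, ContinuousOn (fun p => D1 p e) (openShell I) :=
    fun e => c1.clm_apply continuousOn_const
  have cont2 : ∀ e e', ContinuousOn (fun p => D2 p e e') (openShell I) :=
    fun e e' => (c2.clm_apply continuousOn_const).clm_apply continuousOn_const
  have cont0 : ContinuousOn F (openShell I) := hU.contDiffOn.continuousOn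
  have hfstK : ContinuousOn (fun q : ℝ × ℝ => w q.1) K :=
    hwc.comp continuousOn_fst fun q hq => hq.1
  have hωK : ContinuousOn (fun q : ℝ × ℝ => w q.1 * cas m q.2 * Real.sin q.1) K :=
    (hfstK.mul ((continuous_cas m).comp continuous_snd).continuousOn).mul
      (Real.continuous_sin.comp continuous_fst).continuousOn
  have hω : ContinuousOn (fun p : ℝ × ℝ × ℝ => w p.2.1 * cas m p.2.2 * Real.sin p.2.1) (I ×ˢ K) :=
    hωK.comp continuousOn_snd fun p hp => hp.2
  refine ⟨fun r => ∫ q in K, D1 (r, q) (1, 0, 0) * (w q.1 * cas m q.2 * Real.sin q.1),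
    fun r => ∫ q in K, D2 (r, q) (1, 0, 0) (1, 0, 0) * (w q.1 * cas m q.2 * Real.sin q.1),
    ?_, ?_, ?_⟩
  · intro r hr
    exact hasDerivAt_setIntegral_param hK hI
      (G := fun r q => F (r, q) * (w q.1 * cas m q.2 * Real.sin q.1))
      ((cont0.mono hIK).mul hω) (((cont1 _).mono hIK).mul hω)
      (fun s hs q hq => (hasDerivAt_slice_fst (h1 _ (hmem s hs q.1 hq.1 q.2))).mul_const _) hr
  · intro r hr
    exact hasDerivAt_setIntegral_param hK hI
      (((cont1 _).mono hIK).mul hω) (((cont2 _ _).mono hIK).mul hω)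
      (fun s hs q hq => ((hasDerivAt_slice_fst
        (h2 _ (hmem s hs q.1 hq.1 q.2))).clm_eval (1, 0, 0)).mul_const _) hr
  intro r hr
  have hr0 : r ≠ 0 := (show 0 < r from hpos hr).ne'
  have slice : ∀ {g : ℝ × ℝ × ℝ → ℝ}, ContinuousOn g (openShell I) →
      ContinuousOn (fun q : ℝ × ℝ => g (r, q)) K := fun hg =>
    hg.comp (f := fun q : ℝ × ℝ => (r, q)) (by fun_prop) fun q hq => hIK ⟨hr, hq⟩
  have sliceθ : ∀ {g : ℝ × ℝ × ℝ → ℝ}, ContinuousOn g (openShell I) → ∀ φ,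
      ContinuousOn (fun θ : ℝ => g (r, θ, φ)) (Set.Icc A B) := fun hg φ =>
    hg.comp (f := fun θ : ℝ => (r, θ, φ)) (by fun_prop) fun θ hθ => hmem r hr θ hθ φ
  have sliceφ : ∀ {g : ℝ × ℝ × ℝ → ℝ}, ContinuousOn g (openShell I) → ∀ θ ∈ Set.Icc A B,
      Continuous (fun φ : ℝ => g (r, θ, φ)) := fun hg θ hθ =>
    hg.comp_continuous (f := fun φ : ℝ => (r, θ, φ)) (by fun_prop) fun φ => hmem r hr θ hθ φ
  have hint : ∀ {g : ℝ × ℝ → ℝ}, ContinuousOn g K → MeasureTheory.IntegrableOn g K :=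
    fun hg => hg.integrableOn_compact hK
  have hcasK : ContinuousOn (fun q : ℝ × ℝ => cas m q.2) K :=
    ((continuous_cas m).comp continuous_snd).continuousOn
  have hsinK : ContinuousOn (fun q : ℝ × ℝ => Real.sin q.1) K :=
    (Real.continuous_sin.comp continuous_fst).continuousOn
  have hcosK : ContinuousOn (fun q : ℝ × ℝ => Real.cos q.1) K :=
    (Real.continuous_cos.comp continuous_fst).continuousOn
  have hvK : ContinuousOn (fun q : ℝ × ℝ => v q.1) K := hvc.comp continuousOn_fst fun q hq => hq.1
  have hwsK : ContinuousOn (fun q : ℝ × ℝ => w q.1 / Real.sin q.1) K :=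
    hfstK.div hsinK fun q hq => hsinne _ hq.1
  have k1 : ContinuousOn (fun q : ℝ × ℝ => D2 (r, q) (1, 0, 0) (1, 0, 0)
      * (w q.1 * cas m q.2 * Real.sin q.1)) K := (slice (cont2 _ _)).mul hωK
  have k2 : ContinuousOn (fun q : ℝ × ℝ => D1 (r, q) (1, 0, 0)
      * (w q.1 * cas m q.2 * Real.sin q.1)) K := (slice (cont1 _)).mul hωK
  have k3 : ContinuousOn (fun q : ℝ × ℝ => (Real.sin q.1 * D2 (r, q) (0, 1, 0) (0, 1, 0)
      + Real.cos q.1 * D1 (r, q) (0, 1, 0)) * w q.1 * cas m q.2) K :=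
    (((hsinK.mul (slice (cont2 _ _))).add (hcosK.mul (slice (cont1 _)))).mul hfstK).mul hcasK
  have k4 : ContinuousOn (fun q : ℝ × ℝ => w q.1 / Real.sin q.1
      * (D2 (r, q) (0, 0, 1) (0, 0, 1) * cas m q.2)) K := hwsK.mul ((slice (cont2 _ _)).mul hcasK)
  have k5 : ContinuousOn (fun q : ℝ × ℝ => F (r, q) * v q.1 * cas m q.2) K :=
    ((slice cont0).mul hvK).mul hcasK
  have k6 : ContinuousOn (fun q : ℝ × ℝ => w q.1 / Real.sin q.1 * (F (r, q) * cas m q.2)) K :=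
    hwsK.mul ((slice cont0).mul hcasK)
  -- the polar part
  have hpolar : ∫ q in K, (Real.sin q.1 * D2 (r, q) (0, 1, 0) (0, 1, 0)
        + Real.cos q.1 * D1 (r, q) (0, 1, 0)) * w q.1 * cas m q.2
      = ∫ q in K, F (r, q) * v q.1 * cas m q.2 := by
    rw [hKdef, setIntegral_rect_swap hAB Real.two_pi_pos.le k3,
      setIntegral_rect_swap hAB Real.two_pi_pos.le k5]
    congr 1
    funext φ
    simp only [intervalIntegral.integral_mul_const]
    congr 1
    exact green_polar hAB (u := fun θ => F (r, θ, φ)) (u1 := fun θ => D1 (r, θ, φ) (0, 1, 0))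
      (fun θ hθ => hasDerivAt_slice_snd (h1 _ (hmem r hr θ hθ φ)))
      (fun θ hθ => (hasDerivAt_slice_snd (h2 _ (hmem r hr θ hθ φ))).clm_eval (0, 1, 0))
      (sliceθ (cont2 _ _) φ) hw hv hvc hwA hwB hwA1 hwB1
  -- the azimuthal part
  have hazi : ∫ q in K, w q.1 / Real.sin q.1 * (D2 (r, q) (0, 0, 1) (0, 0, 1) * cas m q.2)
      = -(m : ℝ) ^ 2 * ∫ q in K, w q.1 / Real.sin q.1 * (F (r, q) * cas m q.2) := by
    rw [hKdef, setIntegral_rect hAB Real.two_pi_pos.le k4,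
      setIntegral_rect hAB Real.two_pi_pos.le k6,
      ← intervalIntegral.integral_const_mul]
    refine intervalIntegral.integral_congr fun θ hθ => ?_
    rw [Set.uIcc_of_le hAB] at hθ
    simp only [intervalIntegral.integral_const_mul]
    rw [green_azimuth m (u := fun φ => F (r, θ, φ)) (u1 := fun φ => D1 (r, θ, φ) (0, 0, 1))
      (fun φ => hasDerivAt_slice_thd (h1 _ (hmem r hr θ hθ φ)))
      (fun φ => (hasDerivAt_slice_thd (h2 _ (hmem r hr θ hθ φ))).clm_eval (0, 0, 1))
      (sliceφ (cont2 _ _) θ hθ) (hU.periodic r hr θ (Set.Ioo_subset_Icc_self (hsub hθ)))]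
    ring
  rw [← MeasureTheory.integral_const_mul, ← MeasureTheory.integral_const_mul,
    ← MeasureTheory.integral_add ((hint k1).const_mul _) ((hint k2).const_mul _)]
  have hpt : ∫ q in K, (r ^ 2 * (D2 (r, q) (1, 0, 0) (1, 0, 0) * (w q.1 * cas m q.2 * Real.sin q.1))
        + 2 * r * (D1 (r, q) (1, 0, 0) * (w q.1 * cas m q.2 * Real.sin q.1)))
      = -∫ q in K, ((Real.sin q.1 * D2 (r, q) (0, 1, 0) (0, 1, 0)
        + Real.cos q.1 * D1 (r, q) (0, 1, 0)) * w q.1 * cas m q.2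
        + w q.1 / Real.sin q.1 * (D2 (r, q) (0, 0, 1) (0, 0, 1) * cas m q.2)) := by
    rw [← MeasureTheory.integral_neg]
    refine MeasureTheory.setIntegral_congr_fun hK.measurableSet fun q hq => ?_
    have hs := hsinne _ hq.1
    have hL := hU.laplace r hr q.1 (hsub hq.1) q.2
    rw [sphericalLaplacian_eq_lapForm hO h1 h2 (hmem r hr q.1 hq.1 q.2) hr0 hs] at hL
    have hL' := (div_eq_zero_iff.1 hL).resolve_right (pow_ne_zero 2 hr0)
    simp only [lapForm] at hL'
    field_simp at hL' ⊢
    linear_combination w q.1 * cas m q.2 * hL'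
  rw [hpt, MeasureTheory.integral_add (hint k3) (hint k4), hpolar, hazi]
  have hrhs : ∫ q in K, U r q.1 q.2 * ((v q.1 - m ^ 2 * w q.1 / Real.sin q.1) * cas m q.2)
      = ∫ q in K, (F (r, q) * v q.1 * cas m q.2
        - (m : ℝ) ^ 2 * (w q.1 / Real.sin q.1 * (F (r, q) * cas m q.2))) := by
    congr 1
    funext q
    simp only [hF]
    ring
  rw [hrhs, MeasureTheory.integral_sub (hint k5) ((hint k6).const_mul _),
    MeasureTheory.integral_const_mul]
  ring

/-! ### Cutoff at the poles -/

/-- The Mercator coordinate `log tan (θ/2)`, in which `sin θ d/dθ` becomes `d/dx`. -/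
def mercator (θ : ℝ) : ℝ := Real.log (Real.sin θ / (1 + Real.cos θ))

lemma one_add_cos_pos {θ : ℝ} (h : θ ∈ Set.Ioo 0 Real.pi) : 0 < 1 + Real.cos θ := by
  have h1 := Real.sin_pos_of_mem_Ioo h
  nlinarith [Real.sin_sq_add_cos_sq θ, Real.neg_one_le_cos θ]

lemma hasDerivAt_mercator {θ : ℝ} (h : θ ∈ Set.Ioo 0 Real.pi) :
    HasDerivAt mercator (1 / Real.sin θ) θ := by
  have h1 := Real.sin_pos_of_mem_Ioo h
  have h2 := one_add_cos_pos h
  refine ((((Real.hasDerivAt_sin θ).fun_div ((Real.hasDerivAt_cos θ).const_add 1) h2.ne').log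
    (div_pos h1 h2).ne')).congr_deriv ?_
  have := Real.sin_sq_add_cos_sq θ
  field_simp
  linear_combination this

lemma mercator_monotoneOn : MonotoneOn mercator (Set.Ioo 0 Real.pi) := by
  refine monotoneOn_of_hasDerivWithinAt_nonneg (f' := fun θ => 1 / Real.sin θ) (convex_Ioo _ _)
    (fun θ hθ => (hasDerivAt_mercator hθ).continuousAt.continuousWithinAt) ?_ ?_
  · intro θ hθ
    rw [interior_Ioo] at hθ
    exact (hasDerivAt_mercator hθ).hasDerivWithinAt
  · intro θ hθ
    rw [interior_Ioo] at hθ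
    exact one_div_nonneg.2 (Real.sin_pos_of_mem_Ioo hθ).le

lemma two_arctan_mem {s : ℝ} (hs : 0 < s) : 2 * Real.arctan s ∈ Set.Ioo 0 Real.pi :=
  ⟨by linarith [Real.arctan_pos.2 hs], by linarith [Real.arctan_lt_pi_div_two s]⟩

lemma mercator_two_arctan {s : ℝ} (hs : 0 < s) : mercator (2 * Real.arctan s) = Real.log s := by
  have hc := Real.cos_arctan_pos s
  rw [mercator, Real.sin_two_mul, Real.cos_two_mul]
  have h := Real.tan_arctan s
  rw [Real.tan_eq_sin_div_cos, div_eq_iff hc.ne'] at h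
  congr 1
  rw [h]
  field_simp
  ring

/-- Outside the Mercator strip of half-width `n`, the factor `sin θ` is of size `O(1/n)`. -/
lemma sin_mul_le_two {θ n : ℝ} (h : θ ∈ Set.Icc 0 Real.pi)
    (hn : θ ∈ Set.Ioo 0 Real.pi → n ≤ |mercator θ|) : Real.sin θ * n ≤ 2 := by
  rcases eq_or_lt_of_le h.1 with h0 | h0
  · rw [← h0]; simp
  rcases eq_or_lt_of_le h.2 with h1 | h1
  · rw [h1]; simp
  have hθ : θ ∈ Set.Ioo 0 Real.pi := ⟨h0, h1⟩
  have hs := Real.sin_pos_of_mem_Ioo hθ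
  have hc := one_add_cos_pos hθ
  have hexp : Real.exp (mercator θ) = Real.sin θ / (1 + Real.cos θ) :=
    Real.exp_log (div_pos hs hc)
  have hsq := Real.sin_sq_add_cos_sq θ
  have key : Real.sin θ * Real.exp |mercator θ| ≤ 2 := by
    rcases abs_cases (mercator θ) with ⟨he, -⟩ | ⟨he, -⟩
    · rw [he, hexp]
      have : Real.sin θ * (Real.sin θ / (1 + Real.cos θ)) = 1 - Real.cos θ := by
        field_simp; linear_combination hsq
      rw [this]
      linarith [Real.neg_one_le_cos θ]
    · rw [he, Real.exp_neg, hexp, inv_div]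
      have : Real.sin θ * ((1 + Real.cos θ) / Real.sin θ) = 1 + Real.cos θ := by
        field_simp
      rw [this]
      linarith [Real.cos_le_one θ]
  have h2 : n ≤ Real.exp |mercator θ| :=
    (hn hθ).trans (by linarith [Real.add_one_le_exp |mercator θ|])
  exact (mul_le_mul_of_nonneg_left h2 hs.le).trans key

/-- A `C²` cutoff, equal to `1` on `[-1, 1]` and supported in `[-3, 3]`, with its first two
derivatives. -/
lemma exists_cutoff : ∃ (χ χ1 χ2 : ℝ → ℝ) (C : ℝ), 0 ≤ C ∧ (∀ y, HasDerivAt χ (χ1 y) y) ∧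
    (∀ y, HasDerivAt χ1 (χ2 y) y) ∧ Continuous χ2 ∧ (∀ y, |χ1 y| ≤ C) ∧ (∀ y, |χ2 y| ≤ C) ∧
    (∀ y, 0 ≤ χ y ∧ χ y ≤ 1) ∧ (∀ y, |y| ≤ 1 → χ y = 1) ∧ (∀ y, 3 ≤ |y| → χ y = 0 ∧ χ1 y = 0) := by
  let b : ContDiffBump (0 : ℝ) := ⟨1, 2, one_pos, one_lt_two⟩
  have hb : ContDiff ℝ 2 b := b.contDiff
  have hb1 : ContDiff ℝ 1 (deriv b) := ((contDiff_succ_iff_deriv (n := 1)).1 hb).2.2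
  have hb2 : Continuous (deriv (deriv b)) := hb1.continuous_deriv (by norm_num)
  obtain ⟨C1, h1⟩ := b.hasCompactSupport.deriv.exists_bound_of_continuous hb1.continuous
  obtain ⟨C2, h2⟩ := b.hasCompactSupport.deriv.deriv.exists_bound_of_continuous hb2
  refine ⟨b, deriv b, deriv (deriv b), max C1 C2,
    le_max_of_le_left ((norm_nonneg _).trans (h1 0)),
    fun y => (hb.differentiable (by norm_num) y).hasDerivAt,
    fun y => (hb1.differentiable (by norm_num) y).hasDerivAt, hb2,
    fun y => (h1 y).trans (le_max_left _ _), fun y => (h2 y).trans (le_max_right _ _),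
    fun y => ⟨b.nonneg, b.le_one⟩, fun y hy => b.one_of_mem_closedBall ?_, fun y hy => ?_⟩
  · simpa [Metric.mem_closedBall, Real.dist_eq] using hy
  · have hy' : y ∉ tsupport b := by
      rw [b.tsupport_eq, Metric.mem_closedBall, Real.dist_eq, sub_zero, not_le]
      change (2 : ℝ) < |y|
      linarith
    refine ⟨image_eq_zero_of_notMem_tsupport hy', ?_⟩
    have : y ∉ tsupport (deriv b) := fun h => hy' (tsupport_deriv_subset h)
    exact image_eq_zero_of_notMem_tsupport this

/-- The spherical harmonic coefficients of a regular solution solve the radial equation exactly: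
cutting off at the poles on the logarithmic scale costs an error `O(1/n)`. -/
lemma IsLaplaceSolution.isEuler_harmonicCoeff {I : Set ℝ} (hI : IsOpen I) (hIc : I.OrdConnected)
    (hpos : I ⊆ Set.Ioi 0) {U : ℝ → ℝ → ℝ → ℝ} (hU : IsLaplaceSolution I U) (ℓ : ℕ) (m : ℤ) :
    IsEuler ℓ I (fun r => harmonicCoeff ℓ m (fun q => U r q.1 q.2)) := by
  obtain ⟨χ, χ1, χ2, C, hC0, hχ, hχ1, hχ2c, hC1, hC2, hχ01, hχone, hχzero⟩ := exists_cutoff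
  have hχc : Continuous χ := continuous_iff_continuousAt.2 fun y => (hχ y).continuousAt
  have hχ1c : Continuous χ1 := continuous_iff_continuousAt.2 fun y => (hχ1 y).continuousAt
  have hp := isLegendreFn_normLegendre ℓ m.natAbs
  set p := normLegendre ℓ m.natAbs with hpdef
  set lam : ℝ := (ℓ : ℝ) * (ℓ + 1) with hlam
  have hm2 : ((m.natAbs : ℕ) : ℝ) ^ 2 = (m : ℝ) ^ 2 := by
    rw [Nat.cast_natAbs, Int.cast_abs, sq_abs]
  obtain ⟨P0, hP0⟩ := isCompact_Icc.exists_bound_of_continuousOn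
    (s := Set.Icc 0 Real.pi) hp.continuous.continuousOn
  obtain ⟨P1, hP1⟩ := isCompact_Icc.exists_bound_of_continuousOn
    (s := Set.Icc 0 Real.pi) hp.contDiff_deriv.continuous.continuousOn
  have hpi0 : (0 : ℝ) ∈ Set.Icc 0 Real.pi := ⟨le_rfl, Real.pi_pos.le⟩
  have hP00 : 0 ≤ P0 := (norm_nonneg _).trans (hP0 0 hpi0)
  have hP10 : 0 ≤ P1 := (norm_nonneg _).trans (hP1 0 hpi0)
  refine isEuler_of_approx fun a ha b hb hab δ hδ => ?_
  have ha0 : 0 < a := hpos ha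
  have hsubI : Set.Icc a b ⊆ I := hIc.out ha hb
  obtain ⟨M, hM⟩ := ((isCompact_Icc (a := a) (b := b)).prod
    isCompact_angleRect).exists_bound_of_continuousOn
    (hU.regular.mono fun x hx => ⟨hsubI hx.1, hx.2.1, trivial⟩)
  have hM' : ∀ r ∈ Set.Icc a b, ∀ q ∈ angleRect, |U r q.1 q.2| ≤ M :=
    fun r hr q hq => hM (r, q) ⟨hr, hq⟩
  have hM0 : 0 ≤ M := (abs_nonneg _).trans (hM' a ⟨le_rfl, hab⟩ (0, 0)
    ⟨hpi0, le_rfl, Real.two_pi_pos.le⟩)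
  obtain ⟨K, hK0, hK⟩ := exists_eulerSol_near ℓ ha0 hab
  set D1 := 2 * Real.pi * (12 * M * C * P0 + 4 * Real.pi * M * C * P1) with hD1
  set D2 := 4 * M * P0 * (2 * Real.pi ^ 2) with hD2
  have hD10 : 0 ≤ D1 := by have := Real.pi_pos; positivity
  have hD20 : 0 ≤ D2 := by positivity
  obtain ⟨n, hn0, hn⟩ : ∃ n : ℝ, 0 < n ∧ (K * D1 + D2) / n ≤ δ := by
    refine ⟨(K * D1 + D2 + 1) / δ, by positivity, ?_⟩
    rw [div_div_eq_mul_div, div_le_iff₀ (by positivity)]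
    nlinarith [mul_nonneg hK0.le hD10]
  -- the polar band on which `|mercator θ| ≤ 3 n`
  set A := 2 * Real.arctan (Real.exp (-(3 * n))) with hAdef
  set B := 2 * Real.arctan (Real.exp (3 * n)) with hBdef
  have hAm : A ∈ Set.Ioo 0 Real.pi := two_arctan_mem (Real.exp_pos _)
  have hBm : B ∈ Set.Ioo 0 Real.pi := two_arctan_mem (Real.exp_pos _)
  have hxA : mercator A = -(3 * n) := by
    rw [hAdef, mercator_two_arctan (Real.exp_pos _), Real.log_exp]
  have hxB : mercator B = 3 * n := by rw [hBdef, mercator_two_arctan (Real.exp_pos _), Real.log_exp]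
  have hAB : A ≤ B := by
    have : Real.exp (-(3 * n)) ≤ Real.exp (3 * n) := Real.exp_le_exp.2 (by linarith)
    have := Real.arctan_strictMono.monotone this
    linarith
  have hsub : Set.Icc A B ⊆ Set.Ioo 0 Real.pi :=
    fun t ht => ⟨hAm.1.trans_le ht.1, ht.2.trans_lt hBm.2⟩
  have hsin : ∀ θ ∈ Set.Icc A B, 0 < Real.sin θ := fun θ hθ => Real.sin_pos_of_mem_Ioo (hsub hθ)
  have hxc : ContinuousOn mercator (Set.Icc A B) := fun θ hθ =>
    (hasDerivAt_mercator (hsub hθ)).continuousAt.continuousWithinAt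
  set S : Set (ℝ × ℝ) := Set.Icc A B ×ˢ Set.Icc 0 (2 * Real.pi) with hSdef
  have hS : IsCompact S := isCompact_Icc.prod isCompact_Icc
  have hSrect : S ⊆ angleRect := Set.prod_mono_left (hsub.trans Set.Ioo_subset_Icc_self)
  have hdx : ∀ θ ∈ Set.Ioo 0 Real.pi,
      HasDerivAt (fun t => mercator t / n) (1 / Real.sin θ / n) θ :=
    fun θ hθ => (hasDerivAt_mercator hθ).div_const n
  set w : ℝ → ℝ := fun θ => χ (mercator θ / n) * p θ with hwdef
  set w1 : ℝ → ℝ := fun θ => χ1 (mercator θ / n) * (1 / Real.sin θ / n) * p θ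
    + χ (mercator θ / n) * deriv p θ with hw1def
  set v : ℝ → ℝ := fun θ => χ2 (mercator θ / n) * p θ / (n ^ 2 * Real.sin θ)
    + 2 * χ1 (mercator θ / n) * deriv p θ / n
    + χ (mercator θ / n) * (((m : ℝ) ^ 2 / Real.sin θ - lam * Real.sin θ) * p θ) with hvdef
  have hw : ∀ θ ∈ Set.Icc A B, HasDerivAt w (w1 θ) θ := fun θ hθ =>
    ((hχ _).comp θ (hdx θ (hsub hθ))).mul (hp.differentiable θ).hasDerivAt
  have hv : ∀ θ ∈ Set.Icc A B, HasDerivAt (fun t => Real.sin t * w1 t) (v θ) θ := by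
    intro θ hθ
    have hs := (hsin θ hθ).ne'
    have e : (fun t => Real.sin t * w1 t) =ᶠ[𝓝 θ] fun t => χ1 (mercator t / n) * p t / n
        + χ (mercator t / n) * (Real.sin t * deriv p t) := by
      filter_upwards [isOpen_Ioo.mem_nhds (hsub hθ)] with t ht
      have := (Real.sin_pos_of_mem_Ioo ht).ne'
      simp only [hw1def]
      field_simp
    refine HasDerivAt.congr_of_eventuallyEq ?_ e
    have h1 := (((hχ1 _).comp θ (hdx θ (hsub hθ))).mul (hp.differentiable θ).hasDerivAt).div_const n
    have h2 := ((hχ _).comp θ (hdx θ (hsub hθ))).mul (hp.hasDerivAt_flux hs)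
    refine (h1.add h2).congr_deriv ?_
    simp only [hvdef, Function.comp_apply, hm2]
    field_simp
    ring
  have hχn : ∀ {g : ℝ → ℝ}, Continuous g →
      ContinuousOn (fun θ => g (mercator θ / n)) (Set.Icc A B) :=
    fun hg => hg.comp_continuousOn (hxc.div_const n)
  have hpc : ContinuousOn p (Set.Icc A B) := hp.continuous.continuousOn
  have hp1c : ContinuousOn (deriv p) (Set.Icc A B) := hp.contDiff_deriv.continuous.continuousOn
  have hsc : ContinuousOn Real.sin (Set.Icc A B) := Real.continuous_sin.continuousOn
  have hvc : ContinuousOn v (Set.Icc A B) := by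
    refine ((((hχn hχ2c).mul hpc).div (continuousOn_const.mul hsc)
      fun θ hθ => (mul_pos (pow_pos hn0 2) (hsin θ hθ)).ne').add
      (((continuousOn_const.mul (hχn hχ1c)).mul hp1c).div_const n)).add
      ((hχn hχc).mul (((continuousOn_const.div hsc fun θ hθ => (hsin θ hθ).ne').sub
        (continuousOn_const.mul hsc)).mul hpc))
  have hzA : χ (mercator A / n) = 0 ∧ χ1 (mercator A / n) = 0 := hχzero _ (by
    rw [hxA, abs_div, abs_neg, abs_of_pos (by positivity : 0 < 3 * n), abs_of_pos hn0]
    field_simp; rfl)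
  have hzB : χ (mercator B / n) = 0 ∧ χ1 (mercator B / n) = 0 := hχzero _ (by
    rw [hxB, abs_div, abs_of_pos (by positivity : 0 < 3 * n), abs_of_pos hn0]
    field_simp; rfl)
  obtain ⟨c', c'', hc', hc'', hode⟩ :=
    radial_equation_average hI hpos hU m hAm.1 hAB hBm.2 hw hv hvc
    (by simp [hwdef, hzA.1]) (by simp [hwdef, hzB.1]) (by simp [hw1def, hzA.1, hzA.2])
    (by simp [hw1def, hzB.1, hzB.2])
  have hUS : ∀ r ∈ I, ContinuousOn (fun q : ℝ × ℝ => U r q.1 q.2) angleRect := fun r hr =>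
    hU.regular.comp (f := fun q : ℝ × ℝ => (r, q)) (by fun_prop) fun q hq => ⟨hr, hq.1, trivial⟩
  have fstS : ∀ {g : ℝ → ℝ}, ContinuousOn g (Set.Icc A B) →
      ContinuousOn (fun q : ℝ × ℝ => g q.1) S :=
    fun hg => hg.comp continuousOn_fst fun q hq => hq.1
  have hcasS : ContinuousOn (fun q : ℝ × ℝ => cas m q.2) S :=
    ((continuous_cas m).comp continuous_snd).continuousOn
  have hwc : ContinuousOn w (Set.Icc A B) := (hχn hχc).mul hpc
  -- the inhomogeneity is of size `1 / n`
  have hgn : ∀ r ∈ Set.Icc a b, |r ^ 2 * c'' r + 2 * r * c' r - (ℓ : ℝ) * (ℓ + 1) *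
      ∫ q in S, U r q.1 q.2 * (w q.1 * cas m q.2 * Real.sin q.1)| ≤ D1 / n := by
    intro r hr
    have hUr := (hUS r (hsubI hr)).mono hSrect
    have k1 : ContinuousOn (fun q : ℝ × ℝ => U r q.1 q.2 *
        ((v q.1 - m ^ 2 * w q.1 / Real.sin q.1) * cas m q.2)) S :=
      hUr.mul ((fstS (hvc.sub ((continuousOn_const.mul hwc).div hsc
        fun θ hθ => (hsin θ hθ).ne'))).mul hcasS)
    have k2 : ContinuousOn (fun q : ℝ × ℝ => U r q.1 q.2 * (w q.1 * cas m q.2 * Real.sin q.1)) S :=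
      hUr.mul (((fstS hwc).mul hcasS).mul (fstS hsc))
    have k3 : ContinuousOn (fun q : ℝ × ℝ => 2 * M * C * P0 / n ^ 2 * (1 / Real.sin q.1)
        + 4 * M * C * P1 / n) S :=
      (continuousOn_const.mul (continuousOn_const.div (fstS hsc)
        fun q hq => (hsin _ hq.1).ne')).add continuousOn_const
    have e : r ^ 2 * c'' r + 2 * r * c' r - (ℓ : ℝ) * (ℓ + 1) *
        ∫ q in S, U r q.1 q.2 * (w q.1 * cas m q.2 * Real.sin q.1)
        = -∫ q in S, (U r q.1 q.2 * ((v q.1 - m ^ 2 * w q.1 / Real.sin q.1) * cas m q.2)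
          + lam * (U r q.1 q.2 * (w q.1 * cas m q.2 * Real.sin q.1))) := by
      rw [hode r (hsubI hr), MeasureTheory.integral_add (k1.integrableOn_compact hS)
        ((k2.integrableOn_compact hS).const_mul _), MeasureTheory.integral_const_mul, hlam]
      ring
    rw [e, abs_neg]
    have h1 : ‖∫ q in S, (U r q.1 q.2 * ((v q.1 - m ^ 2 * w q.1 / Real.sin q.1) * cas m q.2)
          + lam * (U r q.1 q.2 * (w q.1 * cas m q.2 * Real.sin q.1)))‖
        ≤ ∫ q in S, (2 * M * C * P0 / n ^ 2 * (1 / Real.sin q.1) + 4 * M * C * P1 / n) := by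
      refine MeasureTheory.norm_integral_le_of_norm_le (k3.integrableOn_compact hS) ?_
      filter_upwards [MeasureTheory.ae_restrict_mem hS.measurableSet] with q hq
      have hs := hsin _ hq.1
      have e2 : U r q.1 q.2 * ((v q.1 - m ^ 2 * w q.1 / Real.sin q.1) * cas m q.2)
          + lam * (U r q.1 q.2 * (w q.1 * cas m q.2 * Real.sin q.1))
          = U r q.1 q.2 * cas m q.2 *
            (χ2 (mercator q.1 / n) * p q.1 * (1 / n ^ 2 * (1 / Real.sin q.1))
            + 2 * χ1 (mercator q.1 / n) * deriv p q.1 * (1 / n)) := by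
        simp only [hvdef, hwdef]
        field_simp
        ring
      have hθ := Set.Ioo_subset_Icc_self (hsub hq.1)
      have b1 := hM' r hr q (hSrect hq)
      have b2 := abs_cas_le m q.2
      have b3 : |p q.1| ≤ P0 := hP0 q.1 hθ
      have b4 : |deriv p q.1| ≤ P1 := hP1 q.1 hθ
      have b5 : |χ2 (mercator q.1 / n) * p q.1 * (1 / n ^ 2 * (1 / Real.sin q.1))|
          ≤ C * P0 * (1 / n ^ 2 * (1 / Real.sin q.1)) := by
        rw [abs_mul, abs_mul, abs_of_pos (by positivity : 0 < 1 / n ^ 2 * (1 / Real.sin q.1))]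
        gcongr
        exact hC2 _
      have b6 : |2 * χ1 (mercator q.1 / n) * deriv p q.1 * (1 / n)| ≤ 2 * C * P1 * (1 / n) := by
        rw [abs_mul, abs_mul, abs_mul, abs_two, abs_of_pos (by positivity : 0 < 1 / n)]
        gcongr
        exact hC1 _
      rw [e2, Real.norm_eq_abs, abs_mul, abs_mul]
      calc |U r q.1 q.2| * |cas m q.2| * |χ2 (mercator q.1 / n) * p q.1
            * (1 / n ^ 2 * (1 / Real.sin q.1)) + 2 * χ1 (mercator q.1 / n) * deriv p q.1 * (1 / n)|
          ≤ M * 2 * (C * P0 * (1 / n ^ 2 * (1 / Real.sin q.1)) + 2 * C * P1 * (1 / n)) := by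
            gcongr
            exact (abs_add_le _ _).trans (add_le_add b5 b6)
        _ = _ := by ring
    refine h1.trans ?_
    rw [hSdef, setIntegral_rect hAB Real.two_pi_pos.le k3]
    simp only [intervalIntegral.integral_const, sub_zero, smul_eq_mul]
    have i1 : IntervalIntegrable (fun θ => 1 / Real.sin θ) MeasureTheory.volume A B := by
      apply ContinuousOn.intervalIntegrable
      rw [Set.uIcc_of_le hAB]
      exact continuousOn_const.div hsc fun θ hθ => (hsin θ hθ).ne'
    have i2 : ∫ θ in A..B, 1 / Real.sin θ = 6 * n := by
      rw [intervalIntegral.integral_eq_sub_of_hasDerivAt (f := mercator) ?_ i1, hxA, hxB]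
      · ring
      · intro θ hθ
        rw [Set.uIcc_of_le hAB] at hθ
        exact hasDerivAt_mercator (hsub hθ)
    rw [intervalIntegral.integral_const_mul, intervalIntegral.integral_add (i1.const_mul _)
      intervalIntegrable_const, intervalIntegral.integral_const_mul, i2,
      intervalIntegral.integral_const, smul_eq_mul]
    have hBA : B - A ≤ Real.pi := by linarith [hAm.1, hBm.2]
    have hpi := Real.pi_pos
    calc 2 * Real.pi * (2 * M * C * P0 / n ^ 2 * (6 * n) + (B - A) * (4 * M * C * P1 / n))
        ≤ 2 * Real.pi * (2 * M * C * P0 / n ^ 2 * (6 * n) + Real.pi * (4 * M * C * P1 / n)) := by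
          gcongr
      _ = D1 / n := by
          rw [hD1]
          field_simp
          ring
  obtain ⟨α, β, hαβ⟩ := hK _ c' c'' (D1 / n) (fun r hr => hc' r (hsubI hr))
    (fun r hr => hc'' r (hsubI hr)) hgn
  refine ⟨α, β, fun r hr => ?_⟩
  -- the part of the coefficient that is cut off is of size `1 / n`
  have hdiff : |harmonicCoeff ℓ m (fun q => U r q.1 q.2)
      - ∫ q in S, U r q.1 q.2 * (w q.1 * cas m q.2 * Real.sin q.1)| ≤ D2 / n := by
    have hUr := hUS r (hsubI hr)
    have k2 : ContinuousOn (fun q : ℝ × ℝ => U r q.1 q.2 * (w q.1 * cas m q.2 * Real.sin q.1)) S :=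
      (hUr.mono hSrect).mul (((fstS hwc).mul hcasS).mul (fstS hsc))
    have e1 : ∫ q in S, U r q.1 q.2 * (w q.1 * cas m q.2 * Real.sin q.1)
        = ∫ q in angleRect, S.indicator
          (fun q => U r q.1 q.2 * (w q.1 * cas m q.2 * Real.sin q.1)) q := by
      rw [MeasureTheory.setIntegral_indicator hS.measurableSet, Set.inter_eq_right.2 hSrect]
    have i1 : MeasureTheory.IntegrableOn (S.indicator
        (fun q => U r q.1 q.2 * (w q.1 * cas m q.2 * Real.sin q.1))) angleRect := by
      rw [MeasureTheory.IntegrableOn, MeasureTheory.integrable_indicator_iff hS.measurableSet,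
        MeasureTheory.IntegrableOn, MeasureTheory.Measure.restrict_restrict hS.measurableSet,
        Set.inter_eq_left.2 hSrect]
      exact k2.integrableOn_compact hS
    have i2 := (continuousOn_harmonicCoeff_integrand ℓ m hUr).integrableOn_compact
      (μ := MeasureTheory.volume) isCompact_angleRect
    rw [e1, harmonicCoeff, ← MeasureTheory.integral_sub i2 i1]
    have h2 : ∀ q ∈ angleRect, ‖U r q.1 q.2 * (sphHarmonic ℓ m q * Real.sin q.1)
        - S.indicator (fun q => U r q.1 q.2 * (w q.1 * cas m q.2 * Real.sin q.1)) q‖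
        ≤ 4 * M * P0 / n := by
      intro q hq
      have hs0 : 0 ≤ Real.sin q.1 := Real.sin_nonneg_of_mem_Icc hq.1
      have b1 := hM' r hr q hq
      have b2 := abs_cas_le m q.2
      have b3 : |p q.1| ≤ P0 := hP0 q.1 hq.1
      -- a factor `t ∈ [0, 1]` which vanishes where `|mercator θ| < n`
      have hfac : ∀ t : ℝ, 0 ≤ t → t ≤ 1 →
          (t ≠ 0 → q.1 ∈ Set.Ioo 0 Real.pi → n ≤ |mercator q.1|) →
          ‖U r q.1 q.2 * (p q.1 * cas m q.2 * Real.sin q.1) * t‖ ≤ 4 * M * P0 / n := by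
        intro t ht0 ht1 ht
        have b4 : Real.sin q.1 * t ≤ 2 / n := by
          rcases eq_or_ne t 0 with rfl | htne
          · rw [mul_zero]; positivity
          · rw [le_div_iff₀ hn0]
            have := sin_mul_le_two hq.1 (ht htne)
            have h5 : Real.sin q.1 * t ≤ Real.sin q.1 := mul_le_of_le_one_right hs0 ht1
            nlinarith
        have e3 : U r q.1 q.2 * (p q.1 * cas m q.2 * Real.sin q.1) * t
            = U r q.1 q.2 * (p q.1 * cas m q.2) * (Real.sin q.1 * t) := by ring
        rw [e3, Real.norm_eq_abs, abs_mul, abs_mul, abs_mul, abs_of_nonneg (mul_nonneg hs0 ht0)]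
        calc _ ≤ M * (P0 * 2) * (2 / n) := by gcongr
          _ = _ := by ring
      by_cases hqS : q ∈ S
      · have e3 : U r q.1 q.2 * (sphHarmonic ℓ m q * Real.sin q.1)
            - S.indicator (fun q => U r q.1 q.2 * (w q.1 * cas m q.2 * Real.sin q.1)) q
            = U r q.1 q.2 * (p q.1 * cas m q.2 * Real.sin q.1) * (1 - χ (mercator q.1 / n)) := by
          rw [Set.indicator_of_mem hqS]
          simp only [sphHarmonic, hwdef]
          ring
        rw [e3]
        refine hfac _ (by linarith [(hχ01 (mercator q.1 / n)).2])
          (by linarith [(hχ01 (mercator q.1 / n)).1]) fun hne _ => ?_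
        by_contra hlt
        refine hne ?_
        rw [hχone _ ?_, sub_self]
        rw [abs_div, abs_of_pos hn0, div_le_one hn0]
        exact (not_le.1 hlt).le
      · have e3 : U r q.1 q.2 * (sphHarmonic ℓ m q * Real.sin q.1)
            - S.indicator (fun q => U r q.1 q.2 * (w q.1 * cas m q.2 * Real.sin q.1)) q
            = U r q.1 q.2 * (p q.1 * cas m q.2 * Real.sin q.1) * 1 := by
          rw [Set.indicator_of_notMem hqS]
          simp only [sphHarmonic]
          ring
        rw [e3]
        refine hfac 1 zero_le_one le_rfl fun _ hθ => ?_
        have hnot : ¬ (A ≤ q.1 ∧ q.1 ≤ B) := fun h => hqS ⟨h, hq.2⟩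
        rw [not_and_or, not_le, not_le] at hnot
        rcases hnot with h | h
        · have := mercator_monotoneOn hθ hAm h.le
          rw [hxA] at this
          have := neg_le_abs (mercator q.1)
          linarith
        · have := mercator_monotoneOn hBm hθ h.le
          rw [hxB] at this
          have := le_abs_self (mercator q.1)
          linarith
    have h3 := MeasureTheory.norm_setIntegral_le_of_norm_le_const (μ := MeasureTheory.volume)
      isCompact_angleRect.measure_lt_top h2
    rw [volume_angleRect] at h3
    refine h3.trans (le_of_eq ?_)
    rw [hD2]
    ring
  calc |harmonicCoeff ℓ m (fun q => U r q.1 q.2) - eulerSol ℓ α β r|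
      ≤ |harmonicCoeff ℓ m (fun q => U r q.1 q.2)
          - ∫ q in S, U r q.1 q.2 * (w q.1 * cas m q.2 * Real.sin q.1)|
        + |(∫ q in S, U r q.1 q.2 * (w q.1 * cas m q.2 * Real.sin q.1)) - eulerSol ℓ α β r| :=
        abs_sub_le _ _ _
    _ ≤ D2 / n + K * (D1 / n) := add_le_add hdiff (hαβ r hr)
    _ = (K * D1 + D2) / n := by ring
    _ ≤ δ := hn

/-! ### Termwise differentiation -/

/-- Termwise differentiation of a series which is, together with its derivatives, locally dominated
by a convergent series of constants. -/
lemma hasFDerivAt_tsum_of_locally {ι E G : Type*} [NormedAddCommGroup E] [NormedSpace ℝ E]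
    [NormedAddCommGroup G] [NormedSpace ℝ G] [CompleteSpace G] {O : Set E} (hO : IsOpen O)
    {f : ι → E → G} {f' : ι → E → E →L[ℝ] G} (hf : ∀ i, ∀ x ∈ O, HasFDerivAt (f i) (f' i x) x)
    (hb : ∀ x ∈ O, ∃ s ∈ 𝓝 x, ∃ u : ι → ℝ, Summable u ∧ ∀ i, ∀ y ∈ s, ‖f i y‖ ≤ u i ∧
      ‖f' i y‖ ≤ u i) {x : E} (hx : x ∈ O) :
    HasFDerivAt (fun y => ∑' i, f i y) (∑' i, f' i x) x := by
  obtain ⟨s, hs, u, hu, hbd⟩ := hb x hx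
  obtain ⟨ε, hε, hball⟩ := Metric.mem_nhds_iff.1 (inter_mem hs (hO.mem_nhds hx))
  have hx' : x ∈ Metric.ball x ε := Metric.mem_ball_self hε
  exact hasFDerivAt_tsum_of_isPreconnected hu Metric.isOpen_ball (convex_ball x ε).isPreconnected
    (fun i y hy => hf i y (hball hy).2) (fun i y hy => (hbd i y (hball hy).1).2) hx'
    (Summable.of_norm_bounded hu fun i => (hbd i x (hball hx').1).1) hx'

lemma contDiffOn_two_of_hasFDerivAt {E G : Type*} [NormedAddCommGroup E] [NormedSpace ℝ E]
    [NormedAddCommGroup G] [NormedSpace ℝ G] {O : Set E} (hO : IsOpen O)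
    {F : E → G} {F' : E → E →L[ℝ] G} {F'' : E → E →L[ℝ] E →L[ℝ] G}
    (h1 : ∀ x ∈ O, HasFDerivAt F (F' x) x) (h2 : ∀ x ∈ O, HasFDerivAt F' (F'' x) x)
    (h3 : ContinuousOn F'' O) : ContDiffOn ℝ 2 F O := by
  have hF' : ContDiffOn ℝ 1 F' O := by
    rw [show (1 : WithTop ℕ∞) = 0 + 1 from rfl, contDiffOn_succ_iff_fderiv_of_isOpen hO]
    refine ⟨fun x hx => (h2 x hx).differentiableAt.differentiableWithinAt, by simp, ?_⟩
    exact contDiffOn_zero.2 (h3.congr fun x hx => (h2 x hx).fderiv)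
  rw [show (2 : WithTop ℕ∞) = 1 + 1 from rfl, contDiffOn_succ_iff_fderiv_of_isOpen hO]
  exact ⟨fun x hx => (h1 x hx).differentiableAt.differentiableWithinAt, by simp,
    hF'.congr fun x hx => (h1 x hx).fderiv⟩

/-! ### Derivatives of separated functions -/

/-- The linear form with the given coordinates on `ℝ × ℝ × ℝ`. -/
def gradForm (x y z : ℝ) : ℝ × ℝ × ℝ →L[ℝ] ℝ :=
  x • ContinuousLinearMap.fst ℝ ℝ (ℝ × ℝ)
    + y • (ContinuousLinearMap.fst ℝ ℝ ℝ).comp (ContinuousLinearMap.snd ℝ ℝ (ℝ × ℝ))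
    + z • (ContinuousLinearMap.snd ℝ ℝ ℝ).comp (ContinuousLinearMap.snd ℝ ℝ (ℝ × ℝ))

@[simp] lemma gradForm_apply (x y z : ℝ) (v : ℝ × ℝ × ℝ) :
    gradForm x y z v = x * v.1 + y * v.2.1 + z * v.2.2 := rfl

lemma norm_gradForm_le {x y z M : ℝ} (hx : |x| ≤ M) (hy : |y| ≤ M) (hz : |z| ≤ M) :
    ‖gradForm x y z‖ ≤ 3 * M := by
  have hM : 0 ≤ M := (abs_nonneg x).trans hx
  refine ContinuousLinearMap.opNorm_le_bound _ (by positivity) fun v => ?_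
  have h1 : |v.1| ≤ ‖v‖ := norm_fst_le v
  have h2 : |v.2.1| ≤ ‖v‖ := (norm_fst_le v.2).trans (norm_snd_le v)
  have h3 : |v.2.2| ≤ ‖v‖ := (norm_snd_le v.2).trans (norm_snd_le v)
  rw [gradForm_apply, Real.norm_eq_abs]
  calc _ ≤ |x * v.1| + |y * v.2.1| + |z * v.2.2| :=
        (abs_add_le _ _).trans (add_le_add_left (abs_add_le _ _) _)
    _ ≤ M * ‖v‖ + M * ‖v‖ + M * ‖v‖ := by
        rw [abs_mul, abs_mul, abs_mul]
        gcongr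
    _ = 3 * M * ‖v‖ := by ring

/-- The gradient of `a(r) b(θ) c(φ)`; `a₁`, `b₁`, `c₁` are the derivatives of the factors. -/
def prodGrad (a a₁ b b₁ c c₁ : ℝ → ℝ) (p : ℝ × ℝ × ℝ) : ℝ × ℝ × ℝ →L[ℝ] ℝ :=
  gradForm (a₁ p.1 * b p.2.1 * c p.2.2) (a p.1 * b₁ p.2.1 * c p.2.2) (a p.1 * b p.2.1 * c₁ p.2.2)

lemma hasFDerivAt_prod {a a₁ b b₁ c c₁ : ℝ → ℝ} {p : ℝ × ℝ × ℝ}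
    (ha : HasDerivAt a (a₁ p.1) p.1) (hb : HasDerivAt b (b₁ p.2.1) p.2.1)
    (hc : HasDerivAt c (c₁ p.2.2) p.2.2) :
    HasFDerivAt (fun p : ℝ × ℝ × ℝ => a p.1 * b p.2.1 * c p.2.2)
      (prodGrad a a₁ b b₁ c c₁ p) p := by
  have h1 := ha.comp_hasFDerivAt p (hasFDerivAt_fst (𝕜 := ℝ) (p := p))
  have h2 := hb.comp_hasFDerivAt p
    ((hasFDerivAt_fst (𝕜 := ℝ) (p := p.2)).comp p (hasFDerivAt_snd (𝕜 := ℝ) (p := p)))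
  have h3 := hc.comp_hasFDerivAt p
    ((hasFDerivAt_snd (𝕜 := ℝ) (p := p.2)).comp p (hasFDerivAt_snd (𝕜 := ℝ) (p := p)))
  refine ((h1.mul h2).mul h3).congr_fderiv ?_
  ext <;> simp [prodGrad] <;> ring

/-- The second derivative of `a(r) b(θ) c(φ)`. -/
def prodHess (a a₁ a₂ b b₁ b₂ c c₁ c₂ : ℝ → ℝ) (p : ℝ × ℝ × ℝ) :
    ℝ × ℝ × ℝ →L[ℝ] ℝ × ℝ × ℝ →L[ℝ] ℝ :=
  (prodGrad a₁ a₂ b b₁ c c₁ p).smulRight (gradForm 1 0 0)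
    + (prodGrad a a₁ b₁ b₂ c c₁ p).smulRight (gradForm 0 1 0)
    + (prodGrad a a₁ b b₁ c₁ c₂ p).smulRight (gradForm 0 0 1)

lemma hasFDerivAt_prodGrad {a a₁ a₂ b b₁ b₂ c c₁ c₂ : ℝ → ℝ} {p : ℝ × ℝ × ℝ}
    (ha : HasDerivAt a (a₁ p.1) p.1) (hb : HasDerivAt b (b₁ p.2.1) p.2.1)
    (hc : HasDerivAt c (c₁ p.2.2) p.2.2) (ha1 : HasDerivAt a₁ (a₂ p.1) p.1)
    (hb1 : HasDerivAt b₁ (b₂ p.2.1) p.2.1) (hc1 : HasDerivAt c₁ (c₂ p.2.2) p.2.2) :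
    HasFDerivAt (prodGrad a a₁ b b₁ c c₁) (prodHess a a₁ a₂ b b₁ b₂ c c₁ c₂ p) p := by
  have e : prodGrad a a₁ b b₁ c c₁ = fun p : ℝ × ℝ × ℝ =>
      (a₁ p.1 * b p.2.1 * c p.2.2) • gradForm 1 0 0 + (a p.1 * b₁ p.2.1 * c p.2.2) • gradForm 0 1 0
        + (a p.1 * b p.2.1 * c₁ p.2.2) • gradForm 0 0 1 := by
    funext p
    ext <;> simp [prodGrad]
  rw [e]
  exact (((hasFDerivAt_prod ha1 hb hc).smul_const (gradForm 1 0 0)).add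
    ((hasFDerivAt_prod ha hb1 hc).smul_const (gradForm 0 1 0))).add
    ((hasFDerivAt_prod ha hb hc1).smul_const (gradForm 0 0 1))

lemma norm_prodGrad_le {a a₁ b b₁ c c₁ : ℝ → ℝ} {p : ℝ × ℝ × ℝ} {x y z : ℝ}
    (ha : |a p.1| ≤ x) (ha1 : |a₁ p.1| ≤ x) (hb : |b p.2.1| ≤ y) (hb1 : |b₁ p.2.1| ≤ y)
    (hc : |c p.2.2| ≤ z) (hc1 : |c₁ p.2.2| ≤ z) :
    ‖prodGrad a a₁ b b₁ c c₁ p‖ ≤ 3 * (x * y * z) := by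
  have hx : 0 ≤ x := (abs_nonneg _).trans ha
  have hy : 0 ≤ y := (abs_nonneg _).trans hb
  have hz : 0 ≤ z := (abs_nonneg _).trans hc
  have key : ∀ s t u : ℝ, |s| ≤ x → |t| ≤ y → |u| ≤ z → |s * t * u| ≤ x * y * z := by
    intro s t u hs ht hu
    rw [abs_mul, abs_mul]
    gcongr
  exact norm_gradForm_le (key _ _ _ ha1 hb hc) (key _ _ _ ha hb1 hc) (key _ _ _ ha hb hc1)

lemma norm_prodHess_le {a a₁ a₂ b b₁ b₂ c c₁ c₂ : ℝ → ℝ} {p : ℝ × ℝ × ℝ} {x y z : ℝ}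
    (ha : |a p.1| ≤ x) (ha1 : |a₁ p.1| ≤ x) (ha2 : |a₂ p.1| ≤ x) (hb : |b p.2.1| ≤ y)
    (hb1 : |b₁ p.2.1| ≤ y) (hb2 : |b₂ p.2.1| ≤ y) (hc : |c p.2.2| ≤ z) (hc1 : |c₁ p.2.2| ≤ z)
    (hc2 : |c₂ p.2.2| ≤ z) :
    ‖prodHess a a₁ a₂ b b₁ b₂ c c₁ c₂ p‖ ≤ 27 * (x * y * z) := by
  have h1 : ∀ G : ℝ × ℝ × ℝ →L[ℝ] ℝ, ‖G‖ ≤ 3 * (x * y * z) → ∀ i j k : ℝ, |i| ≤ 1 → |j| ≤ 1 →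
      |k| ≤ 1 → ‖G.smulRight (gradForm i j k)‖ ≤ 9 * (x * y * z) := by
    intro G hG i j k hi hj hk
    rw [ContinuousLinearMap.norm_smulRight_apply]
    have := norm_gradForm_le hi hj hk
    calc ‖G‖ * ‖gradForm i j k‖ ≤ 3 * (x * y * z) * (3 * 1) :=
          mul_le_mul hG this (norm_nonneg _) ((norm_nonneg _).trans hG)
      _ = _ := by ring
  have g1 := h1 _ (norm_prodGrad_le ha1 ha2 hb hb1 hc hc1) 1 0 0 (by simp) (by simp) (by simp)
  have g2 := h1 _ (norm_prodGrad_le ha ha1 hb1 hb2 hc hc1) 0 1 0 (by simp) (by simp) (by simp)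
  have g3 := h1 _ (norm_prodGrad_le ha ha1 hb hb1 hc1 hc2) 0 0 1 (by simp) (by simp) (by simp)
  have g := norm_add₃_le (a := (prodGrad a₁ a₂ b b₁ c c₁ p).smulRight (gradForm 1 0 0))
    (b := (prodGrad a a₁ b₁ b₂ c c₁ p).smulRight (gradForm 0 1 0))
    (c := (prodGrad a a₁ b b₁ c₁ c₂ p).smulRight (gradForm 0 0 1))
  rw [prodHess]
  linarith

lemma lapForm_prod (a a₁ a₂ b b₁ b₂ c c₁ c₂ : ℝ → ℝ) (p : ℝ × ℝ × ℝ) :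
    lapForm p.1 p.2.1 (prodGrad a a₁ b b₁ c c₁ p) (prodHess a a₁ a₂ b b₁ b₂ c c₁ c₂ p)
      = (p.1 ^ 2 * a₂ p.1 + 2 * p.1 * a₁ p.1) * b p.2.1 * c p.2.2
        + a p.1 * (b₂ p.2.1 + Real.cos p.2.1 / Real.sin p.2.1 * b₁ p.2.1) * c p.2.2
        + a p.1 * b p.2.1 * c₂ p.2.2 / Real.sin p.2.1 ^ 2 := by
  simp [lapForm, prodGrad, prodHess]
  ring

/-! ### Series of solid spherical harmonics -/

lemma summable_poly_mul_geometric {ρ : ℝ} (h0 : 0 ≤ ρ) (h1 : ρ < 1) (k : ℕ) :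
    Summable fun ℓ : ℕ => ((ℓ : ℝ) + 1) ^ k * ρ ^ ℓ := by
  have hρ : ‖ρ‖ < 1 := by rwa [Real.norm_eq_abs, abs_of_nonneg h0]
  refine Summable.of_nonneg_of_le (fun ℓ => by positivity) (fun ℓ => ?_)
    (((summable_pow_mul_geometric_of_norm_lt_one k hρ).mul_left (2 ^ k)).add
      (summable_geometric_of_lt_one h0 h1))
  rcases Nat.eq_zero_or_pos ℓ with rfl | hℓ
  · simp
  · have : (1 : ℝ) ≤ ℓ := by exact_mod_cast hℓ
    have h2 : ((ℓ : ℝ) + 1) ^ k ≤ 2 ^ k * (ℓ : ℝ) ^ k := by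
      rw [← mul_pow]
      exact pow_le_pow_left₀ (by positivity) (by linarith) k
    have h3 : 0 ≤ ρ ^ ℓ := pow_nonneg h0 ℓ
    nlinarith

/-- The radial factors with coefficient families `α`, `β`. -/
def solidRadial (α β : ℕ → ℤ → ℝ) (ℓ : ℕ) (m : ℤ) : ℝ → ℝ := eulerSol ℓ (α ℓ m) (β ℓ m)

/-- The degree-`ℓ` term of a series of solid spherical harmonics. -/
def solidTerm (α β : ℕ → ℤ → ℝ) : ℕ → ℝ × ℝ × ℝ → ℝ :=
  degreeTerm (solidRadial α β) (fun ℓ m => normLegendre ℓ m.natAbs) cas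

/-- The first derivative of `solidTerm`. -/
def solidGrad (α β : ℕ → ℤ → ℝ) (ℓ : ℕ) (p : ℝ × ℝ × ℝ) : ℝ × ℝ × ℝ →L[ℝ] ℝ :=
  ∑ m ∈ Finset.Icc (-(ℓ : ℤ)) (ℓ : ℤ),
    prodGrad (solidRadial α β ℓ m) (deriv (solidRadial α β ℓ m))
      (normLegendre ℓ m.natAbs) (deriv (normLegendre ℓ m.natAbs)) (cas m) (deriv (cas m)) p

/-- The second derivative of `solidTerm`. -/
def solidHess (α β : ℕ → ℤ → ℝ) (ℓ : ℕ) (p : ℝ × ℝ × ℝ) :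
    ℝ × ℝ × ℝ →L[ℝ] ℝ × ℝ × ℝ →L[ℝ] ℝ :=
  ∑ m ∈ Finset.Icc (-(ℓ : ℤ)) (ℓ : ℤ),
    prodHess (solidRadial α β ℓ m) (deriv (solidRadial α β ℓ m))
      (deriv (deriv (solidRadial α β ℓ m))) (normLegendre ℓ m.natAbs)
      (deriv (normLegendre ℓ m.natAbs)) (deriv (deriv (normLegendre ℓ m.natAbs)))
      (cas m) (deriv (cas m)) (deriv (deriv (cas m))) p

section solid

variable (α β : ℕ → ℤ → ℝ) (ℓ : ℕ) {p : ℝ × ℝ × ℝ}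

lemma hasDerivAt_solidRadial (m : ℤ) {r : ℝ} (hr : 0 < r) :
    HasDerivAt (solidRadial α β ℓ m) (deriv (solidRadial α β ℓ m) r) r :=
  (hasDerivAt_eulerSol ℓ _ _ hr).differentiableAt.hasDerivAt

lemma hasDerivAt_deriv_solidRadial (m : ℤ) {r : ℝ} (hr : 0 < r) :
    HasDerivAt (deriv (solidRadial α β ℓ m)) (deriv (deriv (solidRadial α β ℓ m)) r) r :=
  (hasDerivAt_deriv_eulerSol ℓ _ _ hr).differentiableAt.hasDerivAt

lemma hasFDerivAt_solidTerm (hp : 0 < p.1) :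
    HasFDerivAt (solidTerm α β ℓ) (solidGrad α β ℓ p) p := by
  unfold solidTerm degreeTerm solidGrad
  exact HasFDerivAt.fun_sum fun m _ => hasFDerivAt_prod (hasDerivAt_solidRadial α β ℓ m hp)
    ((isLegendreFn_normLegendre ℓ m.natAbs).differentiable _).hasDerivAt
    (hasDerivAt_cas m _).differentiableAt.hasDerivAt

lemma hasFDerivAt_solidGrad (hp : 0 < p.1) :
    HasFDerivAt (solidGrad α β ℓ) (solidHess α β ℓ p) p := by
  unfold solidGrad solidHess
  exact HasFDerivAt.fun_sum fun m _ => hasFDerivAt_prodGrad (hasDerivAt_solidRadial α β ℓ m hp)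
    ((isLegendreFn_normLegendre ℓ m.natAbs).differentiable _).hasDerivAt
    (hasDerivAt_cas m _).differentiableAt.hasDerivAt (hasDerivAt_deriv_solidRadial α β ℓ m hp)
    ((isLegendreFn_normLegendre ℓ m.natAbs).hasDerivAt_deriv _)
    (hasDerivAt_deriv_cas m _).differentiableAt.hasDerivAt

lemma lapForm_sum {ι : Type*} (s : Finset ι) (r θ : ℝ) (A : ι → ℝ × ℝ × ℝ →L[ℝ] ℝ)
    (B : ι → ℝ × ℝ × ℝ →L[ℝ] ℝ × ℝ × ℝ →L[ℝ] ℝ) :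
    lapForm r θ (∑ i ∈ s, A i) (∑ i ∈ s, B i) = ∑ i ∈ s, lapForm r θ (A i) (B i) := by
  simp only [lapForm, sum_apply, Finset.mul_sum, Finset.sum_div,
    Finset.sum_add_distrib]

lemma lapForm_solid (hp : 0 < p.1) (hs : Real.sin p.2.1 ≠ 0) :
    lapForm p.1 p.2.1 (solidGrad α β ℓ p) (solidHess α β ℓ p) = 0 := by
  rw [solidGrad, solidHess, lapForm_sum]
  refine Finset.sum_eq_zero fun m _ => ?_
  rw [lapForm_prod]
  have h1 := (radialEquation_eulerSol ℓ (α ℓ m) (β ℓ m) (s := Set.Ioi 0) le_rfl).ode p.1 hp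
  have e : eulerSol ℓ (α ℓ m) (β ℓ m) = solidRadial α β ℓ m := rfl
  rw [e] at h1
  rw [deriv_sq_mul_deriv (hasDerivAt_deriv_solidRadial α β ℓ m hp)] at h1
  have h2 := (isLegendreFn_normLegendre ℓ m.natAbs).sin_sq_mul_deriv_deriv p.2.1
  have h3 := (hasDerivAt_deriv_cas m p.2.2).deriv
  have hm2 : ((m.natAbs : ℕ) : ℝ) ^ 2 = (m : ℝ) ^ 2 := by
    rw [Nat.cast_natAbs, Int.cast_abs, sq_abs]
  rw [hm2] at h2
  rw [h3]
  have hp' := hp.ne'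
  field_simp at h1 ⊢
  linear_combination (Real.sin p.2.1 ^ 2 * normLegendre ℓ m.natAbs p.2.1 * cas m p.2.2) * h1
    + solidRadial α β ℓ m p.1 * cas m p.2.2 * h2

end solid

/-! ### Convergence and harmonicity of series of solid spherical harmonics -/

lemma contDiffOn_separated {I : Set ℝ} {R Θ Φ : ℝ → ℝ} (hR : ContDiffOn ℝ 2 R I)
    (hΘ : ContDiffOn ℝ 2 Θ (Set.Ioo 0 Real.pi)) (hΦ : ContDiff ℝ 2 Φ) :
    ContDiffOn ℝ 2 (fun p : ℝ × ℝ × ℝ => R p.1 * Θ p.2.1 * Φ p.2.2) (openShell I) := by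
  refine ((hR.comp contDiff_fst.contDiffOn fun p hp => hp.1).mul
    (hΘ.comp (contDiff_fst.comp contDiff_snd).contDiffOn fun p hp => hp.2.1)).mul
    (hΦ.comp (contDiff_snd.comp contDiff_snd)).contDiffOn

lemma continuousOn_separated {I : Set ℝ} {R Θ Φ : ℝ → ℝ} (hR : ContinuousOn R I)
    (hΘ : ContinuousOn Θ (Set.Icc 0 Real.pi)) (hΦ : Continuous Φ) :
    ContinuousOn (fun p : ℝ × ℝ × ℝ => R p.1 * Θ p.2.1 * Φ p.2.2) (closedShell I) := by
  refine ((hR.comp continuous_fst.continuousOn fun p hp => hp.1).mul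
    (hΘ.comp (continuous_fst.comp continuous_snd).continuousOn fun p hp => hp.2.1)).mul
    (hΦ.comp (continuous_snd.comp continuous_snd)).continuousOn

section synthesis

variable {I : Set ℝ} {α β : ℕ → ℤ → ℝ}

lemma continuousOn_solidHess (hI : IsOpen I) (hpos : I ⊆ Set.Ioi 0) (ℓ : ℕ) :
    ContinuousOn (solidHess α β ℓ) (openShell I) := by
  have hO := isOpen_openShell hI
  have hc : ContDiffOn ℝ 2 (solidTerm α β ℓ) (openShell I) := by
    unfold solidTerm degreeTerm
    exact ContDiffOn.sum fun m _ => contDiffOn_separated (contDiffOn_eulerSol ℓ _ _ hpos)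
      (isLegendreFn_normLegendre ℓ m.natAbs).contDiff.contDiffOn (contDiff_cas m)
  have h1 : ∀ p ∈ openShell I, fderiv ℝ (solidTerm α β ℓ) p = solidGrad α β ℓ p := fun p hp =>
    (hasFDerivAt_solidTerm α β ℓ (hpos hp.1)).fderiv
  refine (contDiffOn_two_fderiv hO hc).2.2.2.congr fun p hp => ?_
  have h2 : fderiv ℝ (solidTerm α β ℓ) =ᶠ[𝓝 p] solidGrad α β ℓ := by
    filter_upwards [hO.mem_nhds hp] with q hq using h1 q hq
  exact ((hasFDerivAt_solidGrad α β ℓ (hpos hp.1)).congr_of_eventuallyEq h2).fderiv.symm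

/-- At each radius the radial factors grow at most polynomially in the degree. -/
def PolynomialGrowth (I : Set ℝ) (α β : ℕ → ℤ → ℝ) : Prop :=
  ∀ r ∈ I, ∃ B : ℝ, ∀ (ℓ : ℕ) (m : ℤ), m.natAbs ≤ ℓ →
    |solidRadial α β ℓ m r| ≤ B * ((ℓ : ℝ) + 1) ^ 4

/-- Polynomial growth at each radius of an open set forces locally uniform geometric decay. -/
lemma PolynomialGrowth.exists_decay (H : PolynomialGrowth I α β) (hI : IsOpen I)
    (hpos : I ⊆ Set.Ioi 0) {r : ℝ} (hr : r ∈ I) :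
    ∃ J ∈ 𝓝 r, ∃ C ρ : ℝ, 0 ≤ ρ ∧ ρ < 1 ∧ ∀ (ℓ : ℕ) (m : ℤ), m.natAbs ≤ ℓ → ∀ s ∈ J,
      |solidRadial α β ℓ m s| ≤ C * (((ℓ : ℝ) + 1) ^ 6 * ρ ^ ℓ) ∧
      |deriv (solidRadial α β ℓ m) s| ≤ C * (((ℓ : ℝ) + 1) ^ 6 * ρ ^ ℓ) ∧
      |deriv (deriv (solidRadial α β ℓ m)) s| ≤ C * (((ℓ : ℝ) + 1) ^ 6 * ρ ^ ℓ) := by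
  obtain ⟨ε, hε, hball⟩ := Metric.isOpen_iff.1 hI r hr
  have ha : r - ε / 2 ∈ I := hball (by
    rw [Metric.mem_ball, Real.dist_eq, abs_lt]; constructor <;> linarith)
  have hb : r + ε / 2 ∈ I := hball (by
    rw [Metric.mem_ball, Real.dist_eq, abs_lt]; constructor <;> linarith)
  obtain ⟨B₁, hB₁⟩ := H _ ha
  obtain ⟨B₂, hB₂⟩ := H _ hb
  set B := max B₁ B₂
  obtain ⟨C, ρ, hC, h0, h1, hbd⟩ := eulerSol_bounds (a := r - ε / 2) (a' := r - ε / 4)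
    (b' := r + ε / 4) (b := r + ε / 2) (hpos ha) (by linarith) (by linarith) (by linarith)
  refine ⟨Set.Icc (r - ε / 4) (r + ε / 4), Icc_mem_nhds (by linarith) (by linarith),
    C * B, ρ, h0, h1, fun ℓ m hm s hs => ?_⟩
  have e : C * (B * ((ℓ : ℝ) + 1) ^ 4 * ((ℓ : ℝ) + 1) ^ 2 * ρ ^ ℓ)
      = C * B * (((ℓ : ℝ) + 1) ^ 6 * ρ ^ ℓ) := by ring
  rw [← e]
  exact hbd ℓ (α ℓ m) (β ℓ m) _
    ((hB₁ ℓ m hm).trans (by gcongr; exact le_max_left _ _))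
    ((hB₂ ℓ m hm).trans (by gcongr; exact le_max_right _ _)) s hs

lemma natAbs_le_of_mem_Icc {ℓ : ℕ} {m : ℤ} (hm : m ∈ Finset.Icc (-(ℓ : ℤ)) ℓ) :
    m.natAbs ≤ ℓ := by
  rw [Finset.mem_Icc] at hm
  omega

lemma norm_sum_orders_le {E : Type*} [NormedAddCommGroup E] {ℓ : ℕ} {f : ℤ → E} {c : ℝ}
    (h : ∀ m : ℤ, m.natAbs ≤ ℓ → ‖f m‖ ≤ c) :
    ‖∑ m ∈ Finset.Icc (-(ℓ : ℤ)) ℓ, f m‖ ≤ 2 * ((ℓ : ℝ) + 1) * c := by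
  have hc : 0 ≤ c := (norm_nonneg _).trans (h 0 (by simp))
  refine (norm_sum_le_of_le _ fun m hm => h m (natAbs_le_of_mem_Icc hm)).trans ?_
  rw [Finset.sum_const, Int.card_Icc, nsmul_eq_mul,
    show ((ℓ : ℤ) + 1 - -(ℓ : ℤ)).toNat = 2 * ℓ + 1 by omega]
  push_cast
  nlinarith

lemma abs_cas_derivs_le {ℓ : ℕ} {m : ℤ} (hm : m.natAbs ≤ ℓ) (φ : ℝ) :
    |cas m φ| ≤ 2 * ((ℓ : ℝ) + 1) ^ 2 ∧ |deriv (cas m) φ| ≤ 2 * ((ℓ : ℝ) + 1) ^ 2 ∧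
      |deriv (deriv (cas m)) φ| ≤ 2 * ((ℓ : ℝ) + 1) ^ 2 := by
  have hm' : |(m : ℝ)| ≤ ℓ := by
    rw [← Int.cast_abs, Int.abs_eq_natAbs]
    exact_mod_cast hm
  have hℓ : (0 : ℝ) ≤ ℓ := Nat.cast_nonneg ℓ
  have h1 := abs_cas_le m φ
  have h2 := abs_cas_le (-m) φ
  rw [(hasDerivAt_deriv_cas m φ).deriv, deriv_cas, abs_mul, abs_mul, abs_neg, abs_pow]
  refine ⟨by nlinarith, ?_, ?_⟩
  · calc |(m : ℝ)| * |cas (-m) φ| ≤ ℓ * 2 := by gcongr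
      _ ≤ _ := by nlinarith
  · calc |(m : ℝ)| ^ 2 * |cas m φ| ≤ ℓ ^ 2 * 2 := by gcongr
      _ ≤ _ := by nlinarith

/-- Near a point of the closed shell the series is dominated by a convergent series. -/
lemma PolynomialGrowth.exists_bound_solidTerm (H : PolynomialGrowth I α β) (hI : IsOpen I)
    (hpos : I ⊆ Set.Ioi 0) {p : ℝ × ℝ × ℝ} (hp : p ∈ closedShell I) :
    ∃ s ∈ 𝓝[closedShell I] p, ∃ u : ℕ → ℝ, Summable u ∧
      ∀ ℓ, ∀ q ∈ s, ‖solidTerm α β ℓ q‖ ≤ u ℓ := by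
  obtain ⟨J, hJ, C, ρ, h0, h1, hbd⟩ := H.exists_decay hI hpos hp.1
  refine ⟨Prod.fst ⁻¹' J ∩ closedShell I, inter_mem (nhdsWithin_le_nhds
    (continuous_fst.continuousAt hJ)) self_mem_nhdsWithin, fun ℓ => 2 * C * 13 * 2 *
      (((ℓ : ℝ) + 1) ^ 13 * ρ ^ ℓ), (summable_poly_mul_geometric h0 h1 13).mul_left _,
    fun ℓ q hq => ?_⟩
  refine (norm_sum_orders_le (c := C * (((ℓ : ℝ) + 1) ^ 6 * ρ ^ ℓ) * (13 * ((ℓ : ℝ) + 1) ^ 4)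
    * (2 * ((ℓ : ℝ) + 1) ^ 2)) fun m hm => ?_).trans (le_of_eq (by ring))
  rw [Real.norm_eq_abs, abs_mul, abs_mul]
  have b1 := (hbd ℓ m hm q.1 hq.1).1
  have b2 := (normLegendre_bounds hm hq.2.2.1).1
  have b3 := (abs_cas_derivs_le hm q.2.2).1
  have := (abs_nonneg _).trans b1
  gcongr

lemma normLegendre_bounds_of_le_sin {ℓ m : ℕ} (hm : m ≤ ℓ) {θ σ : ℝ} (hθ : θ ∈ Set.Icc 0 Real.pi)
    (hσ0 : 0 < σ) (hσ1 : σ ≤ 1) (hσ : σ ≤ Real.sin θ) :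
    |normLegendre ℓ m θ| ≤ 13 * ((ℓ : ℝ) + 1) ^ 4 / σ ^ 2 ∧
    |deriv (normLegendre ℓ m) θ| ≤ 13 * ((ℓ : ℝ) + 1) ^ 4 / σ ^ 2 ∧
    |deriv (deriv (normLegendre ℓ m)) θ| ≤ 13 * ((ℓ : ℝ) + 1) ^ 4 / σ ^ 2 := by
  have hp : 0 < Real.sin θ := hσ0.trans_le hσ
  obtain ⟨b1, b2, b3⟩ := normLegendre_bounds hm hθ
  rw [abs_mul, abs_of_pos hp] at b2
  rw [abs_mul, abs_of_pos (pow_pos hp 2)] at b3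
  have s1 : σ ^ 2 ≤ 1 := pow_le_one₀ hσ0.le hσ1
  have s2 : σ ^ 2 ≤ Real.sin θ := by nlinarith
  have s3 : σ ^ 2 ≤ Real.sin θ ^ 2 := pow_le_pow_left₀ hσ0.le hσ 2
  have hσ2 : 0 < σ ^ 2 := pow_pos hσ0 2
  refine ⟨?_, ?_, ?_⟩ <;> rw [le_div_iff₀ hσ2]
  · exact (mul_le_of_le_one_right (abs_nonneg _) s1).trans b1
  · rw [mul_comm]
    exact (mul_le_mul_of_nonneg_right s2 (abs_nonneg _)).trans b2
  · rw [mul_comm]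
    exact (mul_le_mul_of_nonneg_right s3 (abs_nonneg _)).trans b3

/-- Bounds for the term of degree `ℓ` and its derivatives in terms of bounds for the factors; the
sum over the order `m` has `2ℓ + 1` terms. -/
lemma norm_solid_le {ℓ : ℕ} {q : ℝ × ℝ × ℝ} {x y z : ℝ}
    (hR : ∀ m : ℤ, m.natAbs ≤ ℓ → |solidRadial α β ℓ m q.1| ≤ x ∧
      |deriv (solidRadial α β ℓ m) q.1| ≤ x ∧ |deriv (deriv (solidRadial α β ℓ m)) q.1| ≤ x)
    (hY : ∀ m : ℤ, m.natAbs ≤ ℓ → |normLegendre ℓ m.natAbs q.2.1| ≤ y ∧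
      |deriv (normLegendre ℓ m.natAbs) q.2.1| ≤ y ∧
      |deriv (deriv (normLegendre ℓ m.natAbs)) q.2.1| ≤ y)
    (hc : ∀ m : ℤ, m.natAbs ≤ ℓ → |cas m q.2.2| ≤ z ∧ |deriv (cas m) q.2.2| ≤ z ∧
      |deriv (deriv (cas m)) q.2.2| ≤ z) :
    ‖solidTerm α β ℓ q‖ ≤ 2 * ((ℓ : ℝ) + 1) * (27 * (x * y * z)) ∧
    ‖solidGrad α β ℓ q‖ ≤ 2 * ((ℓ : ℝ) + 1) * (27 * (x * y * z)) ∧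
    ‖solidHess α β ℓ q‖ ≤ 2 * ((ℓ : ℝ) + 1) * (27 * (x * y * z)) := by
  have hx : 0 ≤ x := (abs_nonneg _).trans (hR 0 (by simp)).1
  have hy : 0 ≤ y := (abs_nonneg _).trans (hY 0 (by simp)).1
  have hz : 0 ≤ z := (abs_nonneg _).trans (hc 0 (by simp)).1
  have hxyz : 0 ≤ x * y * z := by positivity
  have h0 : ∀ m : ℤ, m.natAbs ≤ ℓ →
      ‖solidRadial α β ℓ m q.1 * normLegendre ℓ m.natAbs q.2.1 * cas m q.2.2‖
        ≤ 27 * (x * y * z) := by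
    intro m hm
    have a0 := (hR m hm).1
    have b0 := (hY m hm).1
    have c0 := (hc m hm).1
    rw [Real.norm_eq_abs, abs_mul, abs_mul]
    calc _ ≤ x * y * z := by gcongr
      _ ≤ _ := by linarith
  have h1 : ∀ m : ℤ, m.natAbs ≤ ℓ → ‖prodGrad (solidRadial α β ℓ m)
      (deriv (solidRadial α β ℓ m)) (normLegendre ℓ m.natAbs) (deriv (normLegendre ℓ m.natAbs))
      (cas m) (deriv (cas m)) q‖ ≤ 27 * (x * y * z) := by
    intro m hm
    obtain ⟨a0, a1, a2⟩ := hR m hm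
    obtain ⟨b0, b1, b2⟩ := hY m hm
    obtain ⟨c0, c1, c2⟩ := hc m hm
    have := norm_prodGrad_le a0 a1 b0 b1 c0 c1
    linarith
  have h2 : ∀ m : ℤ, m.natAbs ≤ ℓ → ‖prodHess (solidRadial α β ℓ m)
      (deriv (solidRadial α β ℓ m)) (deriv (deriv (solidRadial α β ℓ m)))
      (normLegendre ℓ m.natAbs) (deriv (normLegendre ℓ m.natAbs))
      (deriv (deriv (normLegendre ℓ m.natAbs))) (cas m) (deriv (cas m)) (deriv (deriv (cas m))) q‖
        ≤ 27 * (x * y * z) := by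
    intro m hm
    obtain ⟨a0, a1, a2⟩ := hR m hm
    obtain ⟨b0, b1, b2⟩ := hY m hm
    obtain ⟨c0, c1, c2⟩ := hc m hm
    exact norm_prodHess_le a0 a1 a2 b0 b1 b2 c0 c1 c2
  refine ⟨?_, ?_, ?_⟩
  · exact norm_sum_orders_le h0
  · exact norm_sum_orders_le (E := ℝ × ℝ × ℝ →L[ℝ] ℝ) h1
  · exact norm_sum_orders_le (E := ℝ × ℝ × ℝ →L[ℝ] ℝ × ℝ × ℝ →L[ℝ] ℝ) h2

/-- Away from the poles, the series and its first two derivatives are locally dominated by a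
convergent series. -/
lemma PolynomialGrowth.exists_bound_derivs (H : PolynomialGrowth I α β) (hI : IsOpen I)
    (hpos : I ⊆ Set.Ioi 0) {p : ℝ × ℝ × ℝ} (hp : p ∈ openShell I) :
    ∃ s ∈ 𝓝 p, ∃ u : ℕ → ℝ, Summable u ∧ ∀ ℓ, ∀ q ∈ s, ‖solidTerm α β ℓ q‖ ≤ u ℓ ∧
      ‖solidGrad α β ℓ q‖ ≤ u ℓ ∧ ‖solidHess α β ℓ q‖ ≤ u ℓ := by
  obtain ⟨J, hJ, C, ρ, h0, h1, hbd⟩ := H.exists_decay hI hpos hp.1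
  set σ := Real.sin p.2.1 / 2 with hσ
  have hσ0 : 0 < σ := half_pos (Real.sin_pos_of_mem_Ioo hp.2.1)
  have hσ1 : σ ≤ 1 := by linarith [Real.sin_le_one p.2.1]
  have hs : {q : ℝ × ℝ × ℝ | σ < Real.sin q.2.1} ∈ 𝓝 p := by
    refine (isOpen_lt continuous_const (by fun_prop)).mem_nhds ?_
    show σ < Real.sin p.2.1
    linarith
  refine ⟨Prod.fst ⁻¹' J ∩ openShell I ∩ {q | σ < Real.sin q.2.1},
    inter_mem (inter_mem (continuous_fst.continuousAt hJ) ((isOpen_openShell hI).mem_nhds hp)) hs,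
    fun ℓ => 2 * 27 * C * 13 / σ ^ 2 * 2 * (((ℓ : ℝ) + 1) ^ 13 * ρ ^ ℓ),
    (summable_poly_mul_geometric h0 h1 13).mul_left _, fun ℓ q hq => ?_⟩
  obtain ⟨⟨hq1, hq2⟩, hq3⟩ := hq
  have hq3' : σ < Real.sin q.2.1 := hq3
  have hq1' : q.1 ∈ J := hq1
  have key := norm_solid_le (fun m hm => hbd ℓ m hm q.1 hq1')
    (fun m hm => normLegendre_bounds_of_le_sin hm (Set.Ioo_subset_Icc_self hq2.2.1) hσ0 hσ1 hq3'.le)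
    (fun m hm => abs_cas_derivs_le hm q.2.2)
  have e : 2 * ((ℓ : ℝ) + 1) * (27 * (C * (((ℓ : ℝ) + 1) ^ 6 * ρ ^ ℓ)
      * (13 * ((ℓ : ℝ) + 1) ^ 4 / σ ^ 2) * (2 * ((ℓ : ℝ) + 1) ^ 2)))
      = 2 * 27 * C * 13 / σ ^ 2 * 2 * (((ℓ : ℝ) + 1) ^ 13 * ρ ^ ℓ) := by ring
  rw [e] at key
  exact key

lemma PolynomialGrowth.hasSumLocallyUniformlyOn (H : PolynomialGrowth I α β) (hI : IsOpen I)
    (hpos : I ⊆ Set.Ioi 0) :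
    HasSumLocallyUniformlyOn (solidTerm α β) (fun p => ∑' ℓ, solidTerm α β ℓ p)
      (closedShell I) := by
  refine hasSumLocallyUniformlyOn_of_of_forall_exists_nhds fun p hp => ?_
  obtain ⟨s, hs, u, hu, hbd⟩ := H.exists_bound_solidTerm hI hpos hp
  exact ⟨s, hs, HasSumUniformlyOn.of_norm_le_summable hu hbd⟩

lemma PolynomialGrowth.hasFDerivAt_tsum_solidTerm (H : PolynomialGrowth I α β) (hI : IsOpen I)
    (hpos : I ⊆ Set.Ioi 0) {p : ℝ × ℝ × ℝ} (hp : p ∈ openShell I) :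
    HasFDerivAt (fun p => ∑' ℓ, solidTerm α β ℓ p) (∑' ℓ, solidGrad α β ℓ p) p := by
  have hb : ∀ q ∈ openShell I, ∃ s ∈ 𝓝 q, ∃ u : ℕ → ℝ, Summable u ∧ ∀ ℓ, ∀ y ∈ s,
      ‖solidTerm α β ℓ y‖ ≤ u ℓ ∧ ‖solidGrad α β ℓ y‖ ≤ u ℓ := by
    intro q hq
    obtain ⟨s, hs, u, hu, hbd⟩ := H.exists_bound_derivs hI hpos hq
    exact ⟨s, hs, u, hu, fun ℓ y hy => ⟨(hbd ℓ y hy).1, (hbd ℓ y hy).2.1⟩⟩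
  have hd : ∀ ℓ, ∀ q ∈ openShell I, HasFDerivAt (solidTerm α β ℓ) (solidGrad α β ℓ q) q :=
    fun ℓ q hq => hasFDerivAt_solidTerm α β ℓ (hpos hq.1)
  exact hasFDerivAt_tsum_of_locally (isOpen_openShell hI) hd hb hp

lemma PolynomialGrowth.hasFDerivAt_tsum_solidGrad (H : PolynomialGrowth I α β) (hI : IsOpen I)
    (hpos : I ⊆ Set.Ioi 0) {p : ℝ × ℝ × ℝ} (hp : p ∈ openShell I) :
    HasFDerivAt (fun p => ∑' ℓ, solidGrad α β ℓ p) (∑' ℓ, solidHess α β ℓ p) p := by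
  have hb : ∀ q ∈ openShell I, ∃ s ∈ 𝓝 q, ∃ u : ℕ → ℝ, Summable u ∧ ∀ ℓ, ∀ y ∈ s,
      ‖solidGrad α β ℓ y‖ ≤ u ℓ ∧ ‖solidHess α β ℓ y‖ ≤ u ℓ := by
    intro q hq
    obtain ⟨s, hs, u, hu, hbd⟩ := H.exists_bound_derivs hI hpos hq
    exact ⟨s, hs, u, hu, fun ℓ y hy => (hbd ℓ y hy).2⟩
  have hd : ∀ ℓ, ∀ q ∈ openShell I, HasFDerivAt (solidGrad α β ℓ) (solidHess α β ℓ q) q :=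
    fun ℓ q hq => hasFDerivAt_solidGrad α β ℓ (hpos hq.1)
  exact hasFDerivAt_tsum_of_locally (isOpen_openShell hI) hd hb hp

lemma PolynomialGrowth.lapForm_tsum (H : PolynomialGrowth I α β) (hI : IsOpen I)
    (hpos : I ⊆ Set.Ioi 0) {p : ℝ × ℝ × ℝ} (hp : p ∈ openShell I) :
    lapForm p.1 p.2.1 (∑' ℓ, solidGrad α β ℓ p) (∑' ℓ, solidHess α β ℓ p) = 0 := by
  have hs : Real.sin p.2.1 ≠ 0 := (Real.sin_pos_of_mem_Ioo hp.2.1).ne'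
  obtain ⟨s, hsn, u, hu, hbd⟩ := H.exists_bound_derivs hI hpos hp
  have hb := fun ℓ => (hbd ℓ _ (mem_of_mem_nhds hsn)).2
  have g1 : HasSum (fun ℓ => solidGrad α β ℓ p) (∑' ℓ, solidGrad α β ℓ p) :=
    (Summable.of_norm_bounded (E := ℝ × ℝ × ℝ →L[ℝ] ℝ) hu fun ℓ => (hb ℓ).1).hasSum
  have g2 : HasSum (fun ℓ => solidHess α β ℓ p) (∑' ℓ, solidHess α β ℓ p) :=
    (Summable.of_norm_bounded (E := ℝ × ℝ × ℝ →L[ℝ] ℝ × ℝ × ℝ →L[ℝ] ℝ) hu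
      fun ℓ => (hb ℓ).2).hasSum
  generalize (∑' ℓ, solidGrad α β ℓ p) = A at g1 ⊢
  generalize (∑' ℓ, solidHess α β ℓ p) = B at g2 ⊢
  have g1e : ∀ v, HasSum (fun ℓ => solidGrad α β ℓ p v) (A v) := fun v =>
    g1.mapL (ContinuousLinearMap.apply ℝ ℝ v)
  have g2e : ∀ v, HasSum (fun ℓ => solidHess α β ℓ p v v) (B v v) := fun v =>
    (g2.mapL (ContinuousLinearMap.apply ℝ (ℝ × ℝ × ℝ →L[ℝ] ℝ) v)).mapL
      (ContinuousLinearMap.apply ℝ ℝ v)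
  have g : HasSum (fun ℓ => lapForm p.1 p.2.1 (solidGrad α β ℓ p) (solidHess α β ℓ p))
      (lapForm p.1 p.2.1 A B) := by
    unfold lapForm
    exact ((((g2e _).mul_left _).add ((g1e _).mul_left _)).add ((g2e _).add
      ((g1e _).mul_left _))).add ((g2e _).div_const _)
  have e0 : ∀ ℓ, lapForm p.1 p.2.1 (solidGrad α β ℓ p) (solidHess α β ℓ p) = 0 :=
    fun ℓ => lapForm_solid α β ℓ (hpos hp.1) hs
  simp only [e0] at g
  exact g.unique hasSum_zero

/-- The sum of a series of solid spherical harmonics solves Laplace's equation. -/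
lemma PolynomialGrowth.isLaplaceSolution (H : PolynomialGrowth I α β) (hI : IsOpen I)
    (hpos : I ⊆ Set.Ioi 0) {U : ℝ → ℝ → ℝ → ℝ}
    (hU : ∀ p ∈ closedShell I, U p.1 p.2.1 p.2.2 = ∑' ℓ, solidTerm α β ℓ p) :
    IsLaplaceSolution I U := by
  have hO := isOpen_openShell hI
  have hsub := openShell_subset_closedShell I
  have h1 : ∀ p ∈ openShell I, HasFDerivAt (fun p : ℝ × ℝ × ℝ => U p.1 p.2.1 p.2.2)
      (∑' ℓ, solidGrad α β ℓ p) p := by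
    intro p hp
    refine (H.hasFDerivAt_tsum_solidTerm hI hpos hp).congr_of_eventuallyEq ?_
    filter_upwards [hO.mem_nhds hp] with q hq using hU q (hsub hq)
  have h2 : ∀ p ∈ openShell I, HasFDerivAt (fun p => ∑' ℓ, solidGrad α β ℓ p)
      (∑' ℓ, solidHess α β ℓ p) p := fun p hp => H.hasFDerivAt_tsum_solidGrad hI hpos hp
  have h3 : ContinuousOn (fun p => ∑' ℓ, solidHess α β ℓ p) (openShell I) := by
    intro p hp
    obtain ⟨s, hs, u, hu, hbd⟩ := H.exists_bound_derivs hI hpos hp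
    have hc : ContinuousOn (fun p => ∑' ℓ, solidHess α β ℓ p) (s ∩ openShell I) :=
      continuousOn_tsum (F := ℝ × ℝ × ℝ →L[ℝ] ℝ × ℝ × ℝ →L[ℝ] ℝ)
        (fun ℓ => (continuousOn_solidHess hI hpos ℓ).mono Set.inter_subset_right)
        hu fun ℓ q hq => (hbd ℓ q hq.1).2.2
    exact (hc.continuousAt (inter_mem hs (hO.mem_nhds hp))).continuousWithinAt
  refine ⟨contDiffOn_two_of_hasFDerivAt hO h1 h2 h3, ?_, ?_, ?_⟩
  · have hc : ∀ ℓ, ContinuousOn (solidTerm α β ℓ) (closedShell I) := by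
      intro ℓ q hq
      have hq1 : 0 < q.1 := hpos hq.1
      exact (hasFDerivAt_solidTerm α β ℓ hq1).continuousAt.continuousWithinAt
    have ht := (hasSumLocallyUniformlyOn_iff_tendstoLocallyUniformlyOn.1
      (H.hasSumLocallyUniformlyOn hI hpos)).continuousOn
      (Eventually.of_forall fun t : Finset ℕ =>
        continuousOn_finsetSum t fun ℓ _ => hc ℓ).frequently
    exact ht.congr hU
  · intro r hr θ hθ φ
    have e1 := hU (r, θ, φ + 2 * Real.pi) ⟨hr, hθ, trivial⟩
    have e2 := hU (r, θ, φ) ⟨hr, hθ, trivial⟩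
    have e3 : ∀ ℓ, solidTerm α β ℓ (r, θ, φ + 2 * Real.pi) = solidTerm α β ℓ (r, θ, φ) := by
      intro ℓ
      simp only [solidTerm, degreeTerm, cas_periodic _ φ]
    simp only [e3] at e1
    exact e1.trans e2.symm
  · intro r hr θ hθ φ
    have hp : (r, θ, φ) ∈ openShell I := ⟨hr, hθ, trivial⟩
    have hs : Real.sin θ ≠ 0 := (Real.sin_pos_of_mem_Ioo hθ).ne'
    rw [sphericalLaplacian_eq_lapForm hO h1 h2 hp (hpos hr).ne' hs,
      H.lapForm_tsum hI hpos hp, zero_div]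

end synthesis

/-! ### Separated solutions -/

lemma sphericalLaplacian_separated (R Θ Φ : ℝ → ℝ) (r θ φ : ℝ) :
    sphericalLaplacian (fun r θ φ => R r * Θ θ * Φ φ) r θ φ
      = (deriv (fun s => s ^ 2 * deriv R s) r * Θ θ * Φ φ
        + R r * (1 / Real.sin θ * deriv (fun t => Real.sin t * deriv Θ t) θ) * Φ φ
        + R r * Θ θ * iteratedDeriv 2 Φ φ / Real.sin θ ^ 2) / r ^ 2 := by
  have e1 : (fun s => s ^ 2 * deriv (fun t => R t * Θ θ * Φ φ) s)
      = fun s => (Θ θ * Φ φ) * (s ^ 2 * deriv R s) := by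
    funext s
    rw [deriv_mul_const_field, deriv_mul_const_field]
    ring
  have e2 : (fun t => Real.sin t * deriv (fun τ => R r * Θ τ * Φ φ) t)
      = fun t => (R r * Φ φ) * (Real.sin t * deriv Θ t) := by
    funext t
    rw [deriv_mul_const_field, deriv_const_mul_field]
    ring
  have e3 : iteratedDeriv 2 (fun ψ => R r * Θ θ * Φ ψ) φ = R r * Θ θ * iteratedDeriv 2 Φ φ := by
    have h : deriv (fun ψ => R r * Θ θ * Φ ψ) = fun ψ => R r * Θ θ * deriv Φ ψ := by
      funext ψ
      rw [deriv_const_mul_field]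
    rw [iteratedDeriv_succ, iteratedDeriv_one, iteratedDeriv_succ, iteratedDeriv_one, h,
      deriv_const_mul_field]
  rw [sphericalLaplacian, e1, e2, e3, deriv_const_mul_field, deriv_const_mul_field]
  simp only [div_eq_mul_inv, mul_inv]
  ring

lemma isLaplaceSolution_separated {I : Set ℝ} {c₁ c₂ : ℝ} {R Θ Φ : ℝ → ℝ}
    (hpos : I ⊆ Set.Ioi 0) (hR : RadialEquation I c₂ R) (hΘ : PolarEquation c₁ c₂ Θ)
    (hΦ : AzimuthalEquation c₁ Φ) : IsLaplaceSolution I (fun r θ φ => R r * Θ θ * Φ φ) where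
  contDiffOn := contDiffOn_separated hR.contDiffOn hΘ.contDiffOn hΦ.contDiff
  regular := continuousOn_separated hR.contDiffOn.continuousOn hΘ.regular hΦ.contDiff.continuous
  periodic r _ θ _ φ := by rw [hΦ.periodic]
  laplace r hr θ hθ φ := by
    have hr0 : r ≠ 0 := (hpos hr).ne'
    have e1 := hR.ode r hr
    have e2 := hΘ.ode θ hθ
    have e3 := hΦ.ode φ
    rw [sphericalLaplacian_separated]
    generalize deriv (fun s => s ^ 2 * deriv R s) r = A at *
    generalize 1 / Real.sin θ * deriv (fun t => Real.sin t * deriv Θ t) θ = B at *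
    have e1' : A = c₂ * R r := by
      field_simp at e1
      linarith
    have e2' : B = -(c₁ / Real.sin θ ^ 2 * Θ θ + c₂ * Θ θ) := by linarith
    have e3' : iteratedDeriv 2 Φ φ = c₁ * Φ φ := by linarith
    rw [e1', e2', e3']
    ring

/-- Separation of variables: if a product solves Laplace's equation, its factors inherit the
regularity and solve the separated equations. -/
lemma exists_separation_constants {I : Set ℝ} {R Θ Φ : ℝ → ℝ} (hpos : I ⊆ Set.Ioi 0)
    (hR : ∃ r ∈ I, R r ≠ 0) (hΘ : ∃ θ ∈ Set.Icc 0 Real.pi, Θ θ ≠ 0) (hΦ : ∃ φ : ℝ, Φ φ ≠ 0)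
    (hU : IsLaplaceSolution I (fun r θ φ => R r * Θ θ * Φ φ)) :
    ∃ c₁ c₂ : ℝ, RadialEquation I c₂ R ∧ PolarEquation c₁ c₂ Θ ∧ AzimuthalEquation c₁ Φ := by
  obtain ⟨r₀, hr₀, hR₀⟩ := hR
  obtain ⟨φ₀, hΦ₀⟩ := hΦ
  have hΘc : ContinuousOn Θ (Set.Icc 0 Real.pi) := by
    have h : ContinuousOn (fun θ => R r₀ * Θ θ * Φ φ₀) (Set.Icc 0 Real.pi) :=
      hU.regular.comp (f := fun θ : ℝ => (r₀, θ, φ₀)) (by fun_prop) fun θ hθ => ⟨hr₀, hθ, trivial⟩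
    refine (h.div_const (R r₀ * Φ φ₀)).congr fun θ _ => ?_
    field_simp
  -- by continuity `Θ` cannot vanish on the whole open interval
  obtain ⟨θ₀, hθ₀, hΘ₀⟩ : ∃ θ ∈ Set.Ioo 0 Real.pi, Θ θ ≠ 0 := by
    by_contra! hz
    obtain ⟨θ, hθ, hne⟩ := hΘ
    refine hne (Set.EqOn.of_subset_closure (g := fun _ => (0 : ℝ)) hz hΘc continuousOn_const
      Set.Ioo_subset_Icc_self ?_ hθ)
    rw [closure_Ioo Real.pi_pos.ne]
  have hs₀ : Real.sin θ₀ ≠ 0 := (Real.sin_pos_of_mem_Ioo hθ₀).ne'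
  have hRd : ContDiffOn ℝ 2 R I := by
    have h : ContDiffOn ℝ 2 (fun r => R r * Θ θ₀ * Φ φ₀) I :=
      hU.contDiffOn.comp (f := fun r : ℝ => (r, θ₀, φ₀)) (by fun_prop)
        fun r hr => ⟨hr, hθ₀, trivial⟩
    refine (h.div_const (Θ θ₀ * Φ φ₀)).congr fun r _ => ?_
    field_simp
  have hΘd : ContDiffOn ℝ 2 Θ (Set.Ioo 0 Real.pi) := by
    have h : ContDiffOn ℝ 2 (fun θ => R r₀ * Θ θ * Φ φ₀) (Set.Ioo 0 Real.pi) :=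
      hU.contDiffOn.comp (f := fun θ : ℝ => (r₀, θ, φ₀)) (by fun_prop)
        fun θ hθ => ⟨hr₀, hθ, trivial⟩
    refine (h.div_const (R r₀ * Φ φ₀)).congr fun θ _ => ?_
    field_simp
  have hΦd : ContDiff ℝ 2 Φ := by
    rw [← contDiffOn_univ]
    have h : ContDiffOn ℝ 2 (fun φ => R r₀ * Θ θ₀ * Φ φ) Set.univ :=
      hU.contDiffOn.comp (f := fun φ : ℝ => (r₀, θ₀, φ)) (by fun_prop)
        fun φ _ => ⟨hr₀, hθ₀, trivial⟩
    refine (h.div_const (R r₀ * Θ θ₀)).congr fun φ _ => ?_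
    field_simp
  have hΦp : ∀ φ, Φ (φ + 2 * Real.pi) = Φ φ := fun φ =>
    mul_left_cancel₀ (mul_ne_zero hR₀ hΘ₀)
      (hU.periodic r₀ hr₀ θ₀ (Set.Ioo_subset_Icc_self hθ₀) φ)
  have key : ∀ r ∈ I, ∀ θ ∈ Set.Ioo 0 Real.pi, ∀ φ,
      deriv (fun s => s ^ 2 * deriv R s) r * Θ θ * Φ φ
        + R r * (1 / Real.sin θ * deriv (fun t => Real.sin t * deriv Θ t) θ) * Φ φ
        + R r * Θ θ * iteratedDeriv 2 Φ φ / Real.sin θ ^ 2 = 0 := by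
    intro r hr θ hθ φ
    have h := hU.laplace r hr θ hθ φ
    rw [sphericalLaplacian_separated] at h
    exact (div_eq_zero_iff.1 h).resolve_right (pow_ne_zero 2 (hpos hr).ne')
  generalize hA : (fun r => deriv (fun s => s ^ 2 * deriv R s) r) = A
  generalize hB : (fun θ => 1 / Real.sin θ * deriv (fun t => Real.sin t * deriv Θ t) θ) = B
  have hA' : ∀ r, deriv (fun s => s ^ 2 * deriv R s) r = A r := congrFun hA
  have hB' : ∀ θ, 1 / Real.sin θ * deriv (fun t => Real.sin t * deriv Θ t) θ = B θ := congrFun hB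
  simp only [hA', hB'] at key
  have polar : ∀ θ ∈ Set.Ioo 0 Real.pi,
      B θ + iteratedDeriv 2 Φ φ₀ / Φ φ₀ / Real.sin θ ^ 2 * Θ θ + A r₀ / R r₀ * Θ θ = 0 := by
    intro θ hθ
    have hs : Real.sin θ ≠ 0 := (Real.sin_pos_of_mem_Ioo hθ).ne'
    have h := key r₀ hr₀ θ hθ φ₀
    field_simp at h ⊢
    linear_combination h
  have p₀ := polar θ₀ hθ₀
  refine ⟨iteratedDeriv 2 Φ φ₀ / Φ φ₀, A r₀ / R r₀, ⟨hRd, fun r hr => ?_⟩,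
    ⟨hΘd, hΘc, fun θ hθ => ?_⟩, ⟨hΦd, hΦp, fun φ => ?_⟩⟩
  · have hr0 : r ≠ 0 := (hpos hr).ne'
    have h := key r hr θ₀ hθ₀ φ₀
    generalize A r₀ / R r₀ = c₂ at *
    rw [hA']
    have h2 : (A r - c₂ * R r) * (Θ θ₀ * Φ φ₀) = 0 := by
      field_simp at h p₀ ⊢
      have hs2 : (Real.sin θ₀) ^ 2 ≠ 0 := pow_ne_zero 2 hs₀
      refine mul_left_cancel₀ hs2 ?_
      linear_combination h - R r * p₀
    have h3 := (mul_eq_zero.1 h2).resolve_right (mul_ne_zero hΘ₀ hΦ₀)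
    field_simp
    linear_combination h3
  · rw [hB']
    exact polar θ hθ
  · have h := key r₀ hr₀ θ₀ hθ₀ φ
    generalize iteratedDeriv 2 Φ φ₀ / Φ φ₀ = c₁ at *
    have h2 : (iteratedDeriv 2 Φ φ - c₁ * Φ φ) * (R r₀ * Θ θ₀) = 0 := by
      field_simp at h p₀ ⊢
      linear_combination h - Φ φ * p₀
    exact (mul_eq_zero.1 h2).resolve_right (mul_ne_zero hR₀ hΘ₀)

/-- The separation constants are read off from a nonvanishing spherical harmonic coefficient. -/
lemma separation_constants_eq {I : Set ℝ} {R Θ Φ : ℝ → ℝ} (hI : IsOpen I) (hIc : I.OrdConnected)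
    (hpos : I ⊆ Set.Ioi 0) (hR0 : ∃ r ∈ I, R r ≠ 0) (hΘ0 : ∃ θ ∈ Set.Icc 0 Real.pi, Θ θ ≠ 0)
    (hΦ0 : ∃ φ : ℝ, Φ φ ≠ 0) {c₁ c₂ : ℝ} (hR : RadialEquation I c₂ R)
    (hΘ : PolarEquation c₁ c₂ Θ) (hΦ : AzimuthalEquation c₁ Φ) :
    ∃ (ℓ : ℕ) (m : ℤ), |m| ≤ (ℓ : ℤ) ∧ c₁ = -(m : ℝ) ^ 2 ∧ c₂ = (ℓ : ℝ) * ((ℓ : ℝ) + 1) := by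
  obtain ⟨r₀, hr₀, hR₀⟩ := hR0
  obtain ⟨θ₀, hθ₀, hΘ₀⟩ := hΘ0
  obtain ⟨φ₀, hΦ₀⟩ := hΦ0
  have hΦc := hΦ.contDiff.continuous
  obtain ⟨ℓ, m, hm, hne⟩ : ∃ (ℓ : ℕ) (m : ℤ), m.natAbs ≤ ℓ ∧
      harmonicCoeff ℓ m (fun q => Θ q.1 * Φ q.2) ≠ 0 := by
    by_contra! hz
    have := eq_zero_of_harmonicCoeff (f := fun q => Θ q.1 * Φ q.2)
      ((hΘ.regular.comp continuousOn_fst fun q hq => hq.1).mul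
        (hΦc.comp continuous_snd).continuousOn)
      (fun θ _ φ => by simp only [hΦ.periodic]) hz (θ₀, φ₀) ⟨hθ₀, trivial⟩
    exact mul_ne_zero hΘ₀ hΦ₀ this
  obtain ⟨α, β, hE⟩ := (isLaplaceSolution_separated hpos hR hΘ hΦ).isEuler_harmonicCoeff
    hI hIc hpos ℓ m
  set κ := harmonicCoeff ℓ m (fun q => Θ q.1 * Φ q.2) with hκ
  have hRe : ∀ r ∈ I, R r = eulerSol ℓ (α / κ) (β / κ) r := by
    intro r hr
    have h := hE r hr
    simp only [mul_assoc (R r)] at h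
    rw [harmonicCoeff_const_mul, ← hκ] at h
    rw [eq_div_of_mul_eq hne h, eulerSol, eulerSol]
    ring
  have hev : R =ᶠ[𝓝 r₀] eulerSol ℓ (α / κ) (β / κ) := by
    filter_upwards [hI.mem_nhds hr₀] with r hr using hRe r hr
  have hdev : (fun s => s ^ 2 * deriv R s)
      =ᶠ[𝓝 r₀] fun s => s ^ 2 * deriv (eulerSol ℓ (α / κ) (β / κ)) s := by
    filter_upwards [hev.deriv] with s hs
    rw [hs]
  have o1 := hR.ode r₀ hr₀
  have o2 := (radialEquation_eulerSol ℓ (α / κ) (β / κ) hpos).ode r₀ hr₀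
  rw [hdev.deriv_eq] at o1
  rw [← hRe r₀ hr₀] at o2
  have hr0 : r₀ ≠ 0 := (hpos hr₀).ne'
  refine ⟨ℓ, m, ?_, ?_, ?_⟩
  · rw [Int.abs_eq_natAbs]
    exact_mod_cast hm
  · rw [hκ, harmonicCoeff_mul ℓ m hΘ.regular hΦc] at hne
    have hint := right_ne_zero_of_mul hne
    have e2 : ∀ φ, deriv (deriv Φ) φ = c₁ * Φ φ := by
      intro φ
      have := hΦ.ode φ
      rw [iteratedDeriv_succ, iteratedDeriv_one] at this
      linarith
    have d1 : ContDiff ℝ 1 (deriv Φ) := by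
      have h := hΦ.contDiff
      rw [show (2 : WithTop ℕ∞) = 1 + 1 from rfl, contDiff_succ_iff_deriv] at h
      exact h.2.2
    have g := green_azimuth m (u := Φ) (u1 := deriv Φ) (u2 := fun φ => c₁ * Φ φ)
      (fun φ => (hΦ.contDiff.differentiable (by norm_num) φ).hasDerivAt)
      (fun φ => by rw [← e2]; exact (d1.differentiable (by norm_num) φ).hasDerivAt)
      (continuous_const.mul hΦc) hΦ.periodic
    simp only [mul_assoc, intervalIntegral.integral_const_mul] at g
    exact mul_right_cancel₀ hint g
  · have h : (c₂ - (ℓ : ℝ) * ((ℓ : ℝ) + 1)) * R r₀ = 0 := by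
      have h3 := sub_eq_zero.2 (o1.trans o2.symm)
      field_simp at h3
      linear_combination -h3
    have := (mul_eq_zero.1 h).resolve_right hR₀
    linarith

/-! ### Expansion in solid spherical harmonics -/

/-- Locally uniform convergence on the shell makes the coefficients converge uniformly on compact
intervals of radii. -/
lemma tendsto_harmonicCoeff {I : Set ℝ} {F : ℕ → ℝ × ℝ × ℝ → ℝ} {G : ℝ × ℝ × ℝ → ℝ}
    (hF : ∀ N, ContinuousOn (F N) (closedShell I)) (hG : ContinuousOn G (closedShell I))
    (h : TendstoLocallyUniformlyOn F G atTop (closedShell I)) {a b : ℝ} (hab : Set.Icc a b ⊆ I)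
    {ℓ : ℕ} {m : ℤ} (hm : m.natAbs ≤ ℓ) {δ : ℝ} (hδ : 0 < δ) :
    ∀ᶠ N in atTop, ∀ r ∈ Set.Icc a b,
      |harmonicCoeff ℓ m (fun q => G (r, q)) - harmonicCoeff ℓ m (fun q => F N (r, q))| ≤ δ := by
  have hsub : Set.Icc a b ×ˢ angleRect ⊆ closedShell I := fun p hp =>
    ⟨hab hp.1, hp.2.1, trivial⟩
  have hu := (tendstoLocallyUniformlyOn_iff_tendstoUniformlyOn_of_compact
    (isCompact_Icc.prod isCompact_angleRect)).1 (h.mono hsub)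
  have hK : 0 < 520 * ((ℓ : ℝ) + 1) ^ 4 := by positivity
  have hslice : ∀ {f : ℝ × ℝ × ℝ → ℝ}, ContinuousOn f (closedShell I) → ∀ r ∈ Set.Icc a b,
      ContinuousOn (fun q => f (r, q)) angleRect := fun hf r hr =>
    hf.comp (Continuous.prodMk_right r).continuousOn fun q hq => hsub ⟨hr, hq⟩
  filter_upwards [Metric.tendstoUniformlyOn_iff.1 hu (δ / (520 * ((ℓ : ℝ) + 1) ^ 4))
    (div_pos hδ hK)] with N hN r hr
  rw [← harmonicCoeff_sub ℓ m (hslice hG r hr) (hslice (hF N) r hr)]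
  refine (abs_harmonicCoeff_le hm (C := δ / (520 * ((ℓ : ℝ) + 1) ^ 4)) fun q hq => ?_).trans
    (div_mul_cancel₀ _ hK.ne').le
  exact (hN (r, q) ⟨hr, hq⟩).le

/-- Coefficients of a partial sum of the series. -/
lemma harmonicCoeff_partialSum (α β : ℕ → ℤ → ℝ) {ℓ N : ℕ} {m : ℤ} (hm : m.natAbs ≤ ℓ)
    (hN : ℓ < N) (r : ℝ) :
    harmonicCoeff ℓ m (fun q => ∑ k ∈ Finset.range N, solidTerm α β k (r, q))
      = solidRadial α β ℓ m r * (2 * Real.pi) := by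
  have hc : ∀ k n, ContinuousOn (fun q => solidRadial α β k n r * sphHarmonic k n q) angleRect :=
    fun k n => continuousOn_const.mul (continuous_sphHarmonic k n).continuousOn
  have e : (fun q => ∑ k ∈ Finset.range N, solidTerm α β k (r, q)) = fun q =>
      ∑ k ∈ Finset.range N, ∑ n ∈ Finset.Icc (-(k : ℤ)) k,
        solidRadial α β k n r * sphHarmonic k n q := by
    funext q
    simp only [solidTerm, degreeTerm, sphHarmonic, mul_assoc]
  rw [e, harmonicCoeff_sum _ _ _ fun k _ => continuousOn_finsetSum _ fun n _ => hc k n,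
    Finset.sum_eq_single ℓ]
  · rw [harmonicCoeff_sum _ _ _ fun n _ => hc ℓ n, Finset.sum_eq_single m]
    · rw [harmonicCoeff_const_mul, harmonicCoeff_sphHarmonic hm, if_pos rfl]
    · intro n _ hn
      rw [harmonicCoeff_const_mul, harmonicCoeff_sphHarmonic hm, if_neg (by simp [hn]), mul_zero]
    · intro hn
      rw [Finset.mem_Icc] at hn
      omega
  · intro k _ hk
    rw [harmonicCoeff_sum _ _ _ fun n _ => hc k n]
    refine Finset.sum_eq_zero fun n _ => ?_
    rw [harmonicCoeff_const_mul, harmonicCoeff_sphHarmonic hm, if_neg (by simp [hk]), mul_zero]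
  · intro hn
    simp [hN] at hn

/-- A continuous periodic function whose spherical harmonic coefficients are radial solutions is
the sum of a series of solid spherical harmonics. -/
lemma exists_solid_expansion {I : Set ℝ} (hI : IsOpen I) (hpos : I ⊆ Set.Ioi 0)
    {U : ℝ → ℝ → ℝ → ℝ}
    (hc : ContinuousOn (fun p : ℝ × ℝ × ℝ => U p.1 p.2.1 p.2.2) (closedShell I))
    (hp : ∀ r ∈ I, ∀ θ ∈ Set.Icc 0 Real.pi, ∀ φ : ℝ, U r θ (φ + 2 * Real.pi) = U r θ φ)
    (hE : ∀ (ℓ : ℕ) (m : ℤ), m.natAbs ≤ ℓ →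
      IsEuler ℓ I (fun r => harmonicCoeff ℓ m (fun q => U r q.1 q.2))) :
    ∃ α β : ℕ → ℤ → ℝ, PolynomialGrowth I α β ∧
      ∀ p ∈ closedShell I, U p.1 p.2.1 p.2.2 = ∑' ℓ, solidTerm α β ℓ p := by
  have hE' : ∀ (ℓ : ℕ) (m : ℤ), ∃ α β : ℝ, m.natAbs ≤ ℓ → ∀ r ∈ I,
      harmonicCoeff ℓ m (fun q => U r q.1 q.2) = eulerSol ℓ α β r * (2 * Real.pi) := by
    intro ℓ m
    by_cases hm : m.natAbs ≤ ℓ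
    · obtain ⟨α, β, h⟩ := hE ℓ m hm
      refine ⟨α / (2 * Real.pi), β / (2 * Real.pi), fun _ r hr => (h r hr).trans ?_⟩
      have := Real.pi_ne_zero
      simp only [eulerSol]
      field_simp
    · exact ⟨0, 0, fun h => absurd h hm⟩
  choose α β hαβ using hE'
  have hslice : ∀ {f : ℝ × ℝ × ℝ → ℝ}, ContinuousOn f (closedShell I) → ∀ r ∈ I,
      ContinuousOn (fun q => f (r, q)) (Set.Icc 0 Real.pi ×ˢ Set.univ) := fun hf r hr =>
    hf.comp (Continuous.prodMk_right r).continuousOn fun q hq => ⟨hr, hq.1, trivial⟩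
  have hang : angleRect ⊆ Set.Icc 0 Real.pi ×ˢ (Set.univ : Set ℝ) :=
    Set.prod_mono le_rfl (Set.subset_univ _)
  have H : PolynomialGrowth I α β := by
    intro r hr
    obtain ⟨C, hC⟩ := isCompact_angleRect.exists_bound_of_continuousOn ((hslice hc r hr).mono hang)
    refine ⟨C * 520, fun ℓ m hm => ?_⟩
    have h1 := abs_harmonicCoeff_le hm hC
    have h2 : harmonicCoeff ℓ m (fun q => U r q.1 q.2) = solidRadial α β ℓ m r * (2 * Real.pi) :=
      hαβ ℓ m hm r hr
    simp only at h1
    rw [h2, abs_mul, abs_of_pos Real.two_pi_pos] at h1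
    have h3 := abs_nonneg (solidRadial α β ℓ m r)
    have h4 : |solidRadial α β ℓ m r| ≤ |solidRadial α β ℓ m r| * (2 * Real.pi) :=
      le_mul_of_one_le_right h3 (by linarith [Real.pi_gt_three])
    calc _ ≤ _ := h4.trans h1
      _ = _ := by ring
  refine ⟨α, β, H, ?_⟩
  have hV := H.isLaplaceSolution hI hpos (U := fun r θ φ => ∑' ℓ, solidTerm α β ℓ (r, θ, φ))
    fun p _ => rfl
  have hVc : ContinuousOn (fun p => ∑' ℓ, solidTerm α β ℓ p) (closedShell I) := hV.regular
  have hlim := (H.hasSumLocallyUniformlyOn hI hpos).tendstoLocallyUniformlyOn_finsetRange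
  have hterm : ∀ N, ContinuousOn (fun p => ∑ k ∈ Finset.range N, solidTerm α β k p)
      (closedShell I) := fun N => continuousOn_finsetSum _ fun k _ p hp =>
    (hasFDerivAt_solidTerm α β k
      (show 0 < p.1 from hpos hp.1)).continuousAt.continuousWithinAt
  -- the sum of the series has the same coefficients as `U`
  have hcoef : ∀ r ∈ I, ∀ (ℓ : ℕ) (m : ℤ), m.natAbs ≤ ℓ →
      harmonicCoeff ℓ m (fun q => ∑' k, solidTerm α β k (r, q))
        = solidRadial α β ℓ m r * (2 * Real.pi) := by
    intro r hr ℓ m hm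
    have hsub : Set.Icc r r ⊆ I := by simpa using hr
    refine eq_of_forall_dist_le fun δ hδ => ?_
    obtain ⟨N, hN, hℓN⟩ := ((tendsto_harmonicCoeff hterm hVc hlim hsub hm hδ).and
      (eventually_gt_atTop ℓ)).exists
    have := hN r ⟨le_rfl, le_rfl⟩
    rwa [harmonicCoeff_partialSum α β hm hℓN] at this
  rintro ⟨r, θ, φ⟩ ⟨hr, hθ, -⟩
  have hzero := eq_zero_of_harmonicCoeff
    (f := fun q => U r q.1 q.2 - ∑' ℓ, solidTerm α β ℓ (r, q))
    ((hslice hc r hr).sub (hslice hVc r hr))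
    (fun θ hθ φ => congrArg₂ (· - ·) (hp r hr θ hθ φ) (hV.periodic r hr θ hθ φ))
    (fun ℓ m hm => by
      rw [harmonicCoeff_sub ℓ m ((hslice hc r hr).mono hang) ((hslice hVc r hr).mono hang),
        hcoef r hr ℓ m hm, hαβ ℓ m hm r hr]
      exact sub_self _) (θ, φ) ⟨hθ, trivial⟩
  exact sub_eq_zero.1 hzero

lemma satisfySeparatedEquations_solid {I : Set ℝ} (hpos : I ⊆ Set.Ioi 0) (α β : ℕ → ℤ → ℝ) :
    SatisfySeparatedEquations I (solidRadial α β) (fun ℓ m => normLegendre ℓ m.natAbs) cas := by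
  intro ℓ m _
  refine ⟨radialEquation_eulerSol ℓ _ _ hpos, ?_, azimuthalEquation_cas m⟩
  have h := (isLegendreFn_normLegendre ℓ m.natAbs).polarEquation
  rwa [Nat.cast_natAbs, Int.cast_abs, sq_abs] at h

/-- A locally uniform limit of sums of separated solutions has radial solutions as its
coefficients, and is therefore a solution. -/
lemma isLaplaceSolution_of_tendsto {I : Set ℝ} (hI : IsOpen I) (hIc : I.OrdConnected)
    (hpos : I ⊆ Set.Ioi 0) {R Θ : ℕ → ℤ → ℝ → ℝ} {Φ : ℤ → ℝ → ℝ}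
    (hS : SatisfySeparatedEquations I R Θ Φ) {U : ℝ → ℝ → ℝ → ℝ}
    (hU : TendstoLocallyUniformlyOn
      (fun (N : ℕ) (p : ℝ × ℝ × ℝ) => ∑ ℓ ∈ Finset.range N, degreeTerm R Θ Φ ℓ p)
      (fun p : ℝ × ℝ × ℝ => U p.1 p.2.1 p.2.2) atTop (closedShell I)) :
    IsLaplaceSolution I U := by
  have habs : ∀ {k : ℕ} {n : ℤ}, n ∈ Finset.Icc (-(k : ℤ)) k → |n| ≤ (k : ℤ) := fun hn =>
    abs_le.2 (Finset.mem_Icc.1 hn)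
  have hsol : ∀ (k : ℕ), ∀ n ∈ Finset.Icc (-(k : ℤ)) k,
      IsLaplaceSolution I (fun r θ φ => R k n r * Θ k n θ * Φ n φ) := by
    intro k n hn
    obtain ⟨h1, h2, h3⟩ := hS k n (habs hn)
    exact isLaplaceSolution_separated hpos h1 h2 h3
  have hdeg : ∀ k, ContinuousOn (degreeTerm R Θ Φ k) (closedShell I) := fun k =>
    continuousOn_finsetSum _ fun n hn => (hsol k n hn).regular
  have hF : ∀ N, ContinuousOn (fun p => ∑ k ∈ Finset.range N, degreeTerm R Θ Φ k p)
      (closedShell I) := fun N => continuousOn_finsetSum _ fun k _ => hdeg k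
  have hc := hU.continuousOn (Eventually.of_forall hF).frequently
  have hang : ∀ {f : ℝ × ℝ × ℝ → ℝ}, ContinuousOn f (closedShell I) → ∀ r ∈ I,
      ContinuousOn (fun q => f (r, q)) angleRect := fun hf r hr =>
    hf.comp (Continuous.prodMk_right r).continuousOn fun q hq => ⟨hr, hq.1, trivial⟩
  have hp : ∀ r ∈ I, ∀ θ ∈ Set.Icc 0 Real.pi, ∀ φ : ℝ, U r θ (φ + 2 * Real.pi) = U r θ φ := by
    intro r hr θ hθ φ
    have t1 := hU.tendsto_at (a := (r, θ, φ + 2 * Real.pi)) ⟨hr, hθ, trivial⟩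
    have t2 := hU.tendsto_at (a := (r, θ, φ)) ⟨hr, hθ, trivial⟩
    refine tendsto_nhds_unique (t1.congr fun N => ?_) t2
    exact Finset.sum_congr rfl fun k _ => Finset.sum_congr rfl fun n hn => by
      rw [(hS k n (habs hn)).2.2.periodic]
  have hE : ∀ (ℓ : ℕ) (m : ℤ), m.natAbs ≤ ℓ →
      IsEuler ℓ I (fun r => harmonicCoeff ℓ m (fun q => U r q.1 q.2)) := by
    intro ℓ m hm
    have hN : ∀ N, IsEuler ℓ I (fun r => harmonicCoeff ℓ m
        (fun q => ∑ k ∈ Finset.range N, degreeTerm R Θ Φ k (r, q))) := by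
      intro N
      refine (IsEuler.sum (Finset.range N) fun k _ => IsEuler.sum (Finset.Icc (-(k : ℤ)) k)
        fun n hn => (hsol k n hn).isEuler_harmonicCoeff hI hIc hpos ℓ m).congr fun r hr => ?_
      rw [harmonicCoeff_sum _ _ _ fun k _ => hang (hdeg k) r hr]
      exact Finset.sum_congr rfl fun k _ =>
        harmonicCoeff_sum ℓ m _ fun n hn => hang (hsol k n hn).regular r hr
    refine isEuler_of_approx fun a ha b hb _ δ hδ => ?_
    have hsub : Set.Icc a b ⊆ I := hIc.out ha hb
    obtain ⟨N, hclose⟩ := (tendsto_harmonicCoeff hF hc hU hsub hm hδ).exists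
    obtain ⟨α, β, hαβ⟩ := hN N
    refine ⟨α, β, fun r hr => ?_⟩
    rw [← hαβ r (hsub hr)]
    exact hclose r hr
  obtain ⟨α, β, H, hsum⟩ := exists_solid_expansion hI hpos hc hp hE
  exact H.isLaplaceSolution hI hpos hsum

end

/-! ### Separation of variables and the general solution -/

theorem mainTheorem2 (I : Set ℝ) (hI_open : IsOpen I) (hI_interval : I.OrdConnected)
    (hI_pos : I ⊆ Set.Ioi 0) :
    -- separable solutions: the separated equations, and the forced separation constants
    (∀ R Θ Φ : ℝ → ℝ,
      (∃ r ∈ I, R r ≠ 0) → (∃ θ ∈ Set.Icc 0 Real.pi, Θ θ ≠ 0) → (∃ φ : ℝ, Φ φ ≠ 0) →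
      (IsLaplaceSolution I (fun r θ φ => R r * Θ θ * Φ φ) ↔
        ∃ c₁ c₂ : ℝ, RadialEquation I c₂ R ∧ PolarEquation c₁ c₂ Θ ∧
          AzimuthalEquation c₁ Φ) ∧
      (∀ c₁ c₂ : ℝ, RadialEquation I c₂ R → PolarEquation c₁ c₂ Θ →
        AzimuthalEquation c₁ Φ →
        ∃ (ℓ : ℕ) (m : ℤ), |m| ≤ (ℓ : ℤ) ∧ c₁ = -(m : ℝ) ^ 2 ∧
          c₂ = (ℓ : ℝ) * ((ℓ : ℝ) + 1))) ∧
    -- the general solution is a double series of separated solutions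
    (∀ U : ℝ → ℝ → ℝ → ℝ, IsLaplaceSolution I U →
      ∃ (R Θ : ℕ → ℤ → ℝ → ℝ) (Φ : ℤ → ℝ → ℝ),
        SatisfySeparatedEquations I R Θ Φ ∧
        HasSumLocallyUniformlyOn (degreeTerm R Θ Φ)
          (fun p : ℝ × ℝ × ℝ => U p.1 p.2.1 p.2.2) (closedShell I)) ∧
    -- conversely, every such convergent double series is a solution
    (∀ (R Θ : ℕ → ℤ → ℝ → ℝ) (Φ : ℤ → ℝ → ℝ), SatisfySeparatedEquations I R Θ Φ →
      ∀ U : ℝ → ℝ → ℝ → ℝ,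
        TendstoLocallyUniformlyOn
          (fun (N : ℕ) (p : ℝ × ℝ × ℝ) => ∑ ℓ ∈ Finset.range N, degreeTerm R Θ Φ ℓ p)
          (fun p : ℝ × ℝ × ℝ => U p.1 p.2.1 p.2.2) atTop (closedShell I) →
        IsLaplaceSolution I U) := by
  refine ⟨fun R Θ Φ hR hΘ hΦ => ⟨⟨fun hU => exists_separation_constants hI_pos hR hΘ hΦ hU, ?_⟩,
    fun c₁ c₂ => separation_constants_eq hI_open hI_interval hI_pos hR hΘ hΦ⟩, fun U hU => ?_,
    fun R Θ Φ hS U hU => isLaplaceSolution_of_tendsto hI_open hI_interval hI_pos hS hU⟩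
  · rintro ⟨c₁, c₂, h1, h2, h3⟩
    exact isLaplaceSolution_separated hI_pos h1 h2 h3
  · obtain ⟨α, β, H, hsum⟩ := exists_solid_expansion hI_open hI_pos hU.regular hU.periodic
      fun ℓ m _ => hU.isEuler_harmonicCoeff hI_open hI_interval hI_pos ℓ m
    refine ⟨solidRadial α β, fun ℓ m => normLegendre ℓ m.natAbs, cas,
      satisfySeparatedEquations_solid hI_pos α β, ?_⟩
    rw [hasSumLocallyUniformlyOn_iff_tendstoLocallyUniformlyOn]
    exact (hasSumLocallyUniformlyOn_iff_tendstoLocallyUniformlyOn.1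
      (H.hasSumLocallyUniformlyOn hI_open hI_pos)).congr_right fun p hp => (hsum p hp).symm
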